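/- **Proposition (construction of $m$ and $\ell$).** Let $G=\bigoplus_{i\in\mathbb Z}G_i$ be a graded real vector space with a product $(a,b)\mapsto ab$ of degree $0$ and a bracket $[\,,]$ of degree $-1$. For homogeneous $a$ of degree $|a|$ put $\deg(a)=|a|-1$ (the degree in $G[1]$). Assume that $ab=(-1)^{|a||b|}ba$ and $[a,b]=-(-1)^{\deg(a)\deg(b)}[b,a]$; associativity, Jacobi and Leibniz are not assumed. All Koszul signs $\varepsilon$ below are taken for the shifted degrees. *Spaces.* Let $\underline{\otimes^nG[1]}$ be the quotient of $\otimes^nG[1]$ by the span of the signed shuffle products of $a_1\otimes\dots\otimes a_p$ and $a_{p+1}\otimes\dots\otimes a_n$, $0<p<n$, and write $\underline{a_1\otimes\dots\otimes a_n}$ for classes. Let $\mathcal H=\bigoplus_{n\ge1}\underline{\otimes^nG[1]}$ and $S^+(\mathcal H[1])=\bigoplus_{n\ge1}S^n(\mathcal H[1])$ (graded symmetric powers), where $X=\underline{a_1\otimes\dots\otimes a_p}\in\mathcal H[1]$ has degree $\deg X=\sum_k\deg(a_k)-1$. Below, $X_1,\dots,X_n$ are such classes, $x_i=\deg X_i$,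 and $X_I$ is the product of the $X_i$, $i\in I$, in increasing order. *Coproduct and cobracket.* There are unique well-defined linear maps $\Delta,\kappa:S^+(\mathcal H[1])\to S^+(\mathcal H[1])\otimes S^+(\mathcal H[1])$ with $$\Delta(X_1\cdots X_n)=\sum_{I\sqcup J=\{1,\dots,n\},\ I,J\ne\emptyset}\varepsilon\begin{pmatrix}x_1\dots x_n\\x_I\ x_J\end{pmatrix}X_I\otimes X_J,$$ $$\kappa(X_1\cdots X_n)=\sum_{s}\ \sum_{I\sqcup J=\{1,\dots,n\}\setminus\{s\}}(-1)^{\sum_{i<s}x_i}\sum_{U\otimes V=X_s}(-1)^{u+1}\,\varepsilon\,\Big(X_IU\otimes VX_J+(-1)^{uv}X_IV\otimes UX_J\Big),$$ where the last sum runs over the cuts of the word $X_s$ into two nonempty words $U$ (of degree $u$) and $V$ (of degree $v$) and $\varepsilon$ is the Koszul sign of $X_1\cdots X_{s-1}\,U\,V\,X_{s+1}\cdots X_n\to X_I\,U\,V\,X_J$. *Extension of the product.* With $m(a\otimes b)=(-1)^{\deg(a)}ab$, the formulas $$m(\underline{a_0\otimes\dots\otimes a_n})=\sum_{j=0}^{n-1}(-1)^{\sum_{i<j}\deg(a_i)}\underline{a_0\otimes\dots\otimes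 m(a_j\otimes a_{j+1})\otimes\dots\otimes a_n},$$ $$m(X_1\cdots X_n)=\sum_{j=1}^n(-1)^{\sum_{k<j}x_k}X_1\cdots m(X_j)\cdots X_n$$ define unique linear maps on $\mathcal H$ and on $S^+(\mathcal H[1])$. *Extension of the bracket.* The formulas $$\big[\underline{a_1\otimes\dots\otimes a_p}\wedge\underline{a_{p+1}\otimes\dots\otimes a_{p+q}}\big]=\sum_{k}\ \sum_{\sigma}\varepsilon(\sigma^{-1})\,\underline{a_{\sigma^{-1}(1)}\otimes\dots\otimes[a_{\sigma^{-1}(k)},a_{\sigma^{-1}(k+1)}]\otimes\dots\otimes a_{\sigma^{-1}(p+q)}},$$ where $\sigma$ runs over the $(p,q)$-shuffles with $\sigma^{-1}(k)\le p<\sigma^{-1}(k+1)$, and $$\ell(X_1\cdots X_n)=\sum_{i<j}\varepsilon\begin{pmatrix}1\dots n\\ i,j,1\dots\hat\imath\dots\hat\jmath\dots n\end{pmatrix}\ell(X_iX_j)\,X_1\cdots\hat\imath\cdots\hat\jmath\cdots X_n,\qquad \ell(X_1X_2)=(-1)^{x_1}[X_1\wedge X_2],$$ define a unique bilinear map on $\mathcal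 H$ and a unique linear map on $S^+(\mathcal H[1])$. *Conclusions.* The maps $m$ and $\ell$ have degree $1$ and are coderivations of $\kappa$ and of $\Delta$: for $D\in\{m,\ell\}$, $$(D\otimes\mathrm{id}+\mathrm{id}\otimes D)\circ\kappa=-\kappa\circ D,\qquad (D\otimes\mathrm{id}+\mathrm{id}\otimes D)\circ\Delta=\Delta\circ D,$$ with $(\mathrm{id}\otimes D)(x\otimes y)=(-1)^{\deg x}x\otimes D(y)$. Moreover $G$ is a Gerstenhaber algebra, i.e. the product is associative, the bracket satisfies the graded Jacobi identity on $G[1]$, and $[a,bc]=[a,b]c+(-1)^{|b|\deg(a)}b[a,c]$, if and only if $(m+\ell)\circ(m+\ell)=0$; this equation is equivalent to $m^2=0$, $\ell^2=0$ and $m\ell+\ell m=0$ together. Separately, associativity is equivalent to $m^2=0$, Jacobi to $\ell^2=0$, and Leibniz to $m\ell+\ell m=0$. -/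

import Mathlib

open scoped TensorProduct

noncomputable section

namespace GInfinity

variable {G : Type*} [AddCommGroup G] [Module ℝ G]

/-- A homogeneous element `a` of the graded space `G = ⊕ 𝒢 i`, together with its degree
`|a| = a.1`. -/
abbrev HomEl (𝒢 : ℤ → Submodule ℝ G) : Type _ := Σ i : ℤ, 𝒢 i

variable {𝒢 : ℤ → Submodule ℝ G}

/-- The degree `deg a = |a| - 1` of `a` in `G[1]`. -/
def HomEl.deg (a : HomEl 𝒢) : ℤ := a.1 - 1

/-- The underlying vector of a homogeneous element. -/
def HomEl.val (a : HomEl 𝒢) : G := (a.2 : G)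

/-! ### Gerstenhaber algebras -/

/-- A graded space `G` with a graded commutative product of degree `0` and a bracket of degree
`-1` which is graded antisymmetric on `G[1]`. No associativity, Jacobi or Leibniz is required. -/
structure GradedProductBracket (𝒢 : ℤ → Submodule ℝ G) where
  mul : G →ₗ[ℝ] G →ₗ[ℝ] G
  bracket : G →ₗ[ℝ] G →ₗ[ℝ] G
  mul_mem : ∀ a b : HomEl 𝒢, mul a.val b.val ∈ 𝒢 (a.1 + b.1)
  bracket_mem : ∀ a b : HomEl 𝒢, bracket a.val b.val ∈ 𝒢 (a.1 + b.1 - 1)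
  mul_comm : ∀ a b : HomEl 𝒢,
    mul a.val b.val = (-1 : ℝ) ^ (a.1 * b.1) • mul b.val a.val
  bracket_antisymm : ∀ a b : HomEl 𝒢,
    bracket a.val b.val = -((-1 : ℝ) ^ (a.deg * b.deg) • bracket b.val a.val)

namespace GradedProductBracket

variable (A : GradedProductBracket 𝒢)

/-- `a₁(a₂a₃) = (a₁a₂)a₃`. -/
def Associative : Prop :=
  ∀ a b c : HomEl 𝒢, A.mul a.val (A.mul b.val c.val) = A.mul (A.mul a.val b.val) c.val

/-- Graded Jacobi identity on `G[1]`: the signed cyclic sum of `[[a₁,a₂],a₃]` vanishes. -/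
def Jacobi : Prop :=
  ∀ a b c : HomEl 𝒢,
    (-1 : ℝ) ^ (a.deg * c.deg) • A.bracket (A.bracket a.val b.val) c.val
      + (-1 : ℝ) ^ (b.deg * a.deg) • A.bracket (A.bracket b.val c.val) a.val
      + (-1 : ℝ) ^ (c.deg * b.deg) • A.bracket (A.bracket c.val a.val) b.val = 0

/-- `[a₁, a₂a₃] = [a₁,a₂]a₃ + (-1)^(|a₂| deg a₁) a₂[a₁,a₃]`. -/
def Leibniz : Prop :=
  ∀ a b c : HomEl 𝒢,
    A.bracket a.val (A.mul b.val c.val) =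
      A.mul (A.bracket a.val b.val) c.val
        + (-1 : ℝ) ^ (b.1 * a.deg) • A.mul b.val (A.bracket a.val c.val)

/-- The structure is a Gerstenhaber algebra. -/
def IsGerstenhaber : Prop := A.Associative ∧ A.Jacobi ∧ A.Leibniz

end GradedProductBracket

/-! ### Words and shuffles -/

/-- Degree in `G[1]^{⊗ n}` of a word of homogeneous elements: the sum of the `deg aᵢ`. -/
def wdeg (w : List (HomEl 𝒢)) : ℤ := (w.map HomEl.deg).sum

theorem wdeg_cons (a : HomEl 𝒢) (w : List (HomEl 𝒢)) : wdeg (a :: w) = a.deg + wdeg w := by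
  simp [wdeg]

/-- The tensor `a₁ ⊗ ⋯ ⊗ aₙ` in the tensor algebra of `G`. -/
def tens (w : List (HomEl 𝒢)) : TensorAlgebra ℝ G :=
  (w.map fun a => TensorAlgebra.ι ℝ a.val).prod

/-- The shuffle product of two words: the sum over all shuffles of their letters, with the Koszul
sign for the degrees `deg`. The first letter of a shuffle is either the first letter of the left
word, or the first letter `b` of the right word, which then has passed the whole left word. -/
def shuffle : List (HomEl 𝒢) → List (HomEl 𝒢) → TensorAlgebra ℝ G
  | [], v => tens v
  | a :: u, [] => tens (a :: u)
  | a :: u, b :: v =>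
      TensorAlgebra.ι ℝ a.val * shuffle u (b :: v)
        + (-1 : ℝ) ^ (b.deg * wdeg (a :: u)) • (TensorAlgebra.ι ℝ b.val * shuffle (a :: u) v)
termination_by u v => u.length + v.length

variable (𝒢) in
/-- The span of `1` and of all shuffle products of two nonempty words. -/
def shuffleRel : Submodule ℝ (TensorAlgebra ℝ G) :=
  Submodule.span ℝ
    ({1} ∪ {x | ∃ u v : List (HomEl 𝒢), u ≠ [] ∧ v ≠ [] ∧ x = shuffle u v})

variable (𝒢) in
/-- `ℋ = ⊕_{n ≥ 1} ⊗ⁿ G[1] / (shuffles)`: killing `1` removes the summand `n = 0` of the tensor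
algebra, and the other relations are homogeneous in `n`. -/
abbrev Hsp : Type _ := TensorAlgebra ℝ G ⧸ shuffleRel 𝒢

/-- The class of `a₁ ⊗ ⋯ ⊗ aₙ` in `ℋ` (it is `0` for the empty word). -/
def cls (w : List (HomEl 𝒢)) : Hsp 𝒢 := (shuffleRel 𝒢).mkQ (tens w)

/-- The degree of the class of a word in `ℋ[1]`. -/
def hdeg (w : List (HomEl 𝒢)) : ℤ := wdeg w - 1

/-! ### The space `S⁺(ℋ[1])` -/

variable (𝒢) in
/-- The span of `1` and of the two-sided ideal of the tensor algebra of `ℋ` generated by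
`X ⊗ Y - (-1)^(deg X deg Y) Y ⊗ X`, for the degrees of `ℋ[1]`. -/
def symRel : Submodule ℝ (TensorAlgebra ℝ (Hsp 𝒢)) :=
  Submodule.span ℝ
    ({1} ∪ {x | ∃ (P Q : TensorAlgebra ℝ (Hsp 𝒢)) (X Y : List (HomEl 𝒢)),
      x = P * (TensorAlgebra.ι ℝ (cls X) * TensorAlgebra.ι ℝ (cls Y)
        - (-1 : ℝ) ^ (hdeg X * hdeg Y) •
            (TensorAlgebra.ι ℝ (cls Y) * TensorAlgebra.ι ℝ (cls X))) * Q})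

variable (𝒢) in
/-- `S⁺(ℋ[1]) = ⊕_{n ≥ 1} Sⁿ(ℋ[1])`; killing `1` removes the summand `n = 0`. -/
abbrev SPlus : Type _ := TensorAlgebra ℝ (Hsp 𝒢) ⧸ symRel 𝒢

/-- The tensor `X₁ ⊗ ⋯ ⊗ Xₙ` in the tensor algebra of `ℋ`, for words `Xᵢ`. -/
def tensH (L : List (List (HomEl 𝒢))) : TensorAlgebra ℝ (Hsp 𝒢) :=
  (L.map fun X => TensorAlgebra.ι ℝ (cls X)).prod

/-- The element `X₁ ⋯ Xₙ` of `S⁺(ℋ[1])`, for words `Xᵢ` (it is `0` for the empty list). -/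
def mon (L : List (List (HomEl 𝒢))) : SPlus 𝒢 := (symRel 𝒢).mkQ (tensH L)

/-- The degree of `X₁ ⋯ Xₙ`: the sum of the degrees of the `Xᵢ` in `ℋ[1]`. -/
def sdeg (L : List (List (HomEl 𝒢))) : ℤ := (L.map hdeg).sum

variable (𝒢) in
/-- The homogeneous component of degree `n` of `S⁺(ℋ[1])`. -/
def gradeS (n : ℤ) : Submodule ℝ (SPlus 𝒢) :=
  Submodule.span ℝ {x | ∃ L : List (List (HomEl 𝒢)), sdeg L = n ∧ x = mon L}

/-! ### The sign operator of `S⁺(ℋ[1])` -/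

section Parity

variable (𝒢) [DirectSum.Decomposition 𝒢]

/-- `a ↦ (-1)^(deg a) a` on `G[1]`. -/
def parityG : G →ₗ[ℝ] G :=
  (DirectSum.toModule ℝ ℤ G fun i => (-1 : ℝ) ^ (i - 1) • (𝒢 i).subtype) ∘ₗ
    (DirectSum.decomposeLinearEquiv 𝒢).toLinearMap

/-- The induced map on the tensor algebra of `G[1]`. -/
def parityT : TensorAlgebra ℝ G →ₐ[ℝ] TensorAlgebra ℝ G :=
  TensorAlgebra.lift ℝ (TensorAlgebra.ι ℝ ∘ₗ parityG 𝒢)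

variable {𝒢}

theorem parityG_val (a : HomEl 𝒢) : parityG 𝒢 a.val = (-1 : ℝ) ^ a.deg • a.val := by
  obtain ⟨i, a⟩ := a
  have h : DirectSum.decompose 𝒢 (a : G) = DirectSum.lof ℝ ℤ (fun i => 𝒢 i) i a :=
    DirectSum.decompose_coe 𝒢 a
  simp only [parityG, HomEl.val, HomEl.deg, LinearMap.comp_apply, LinearEquiv.coe_coe,
    DirectSum.decomposeLinearEquiv_apply, h, DirectSum.toModule_lof]
  rfl

theorem parityT_ι (a : HomEl 𝒢) :
    parityT 𝒢 (TensorAlgebra.ι ℝ a.val) = (-1 : ℝ) ^ a.deg • TensorAlgebra.ι ℝ a.val := by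
  simp [parityT, parityG_val]

theorem parityT_tens (w : List (HomEl 𝒢)) :
    parityT 𝒢 (tens w) = (-1 : ℝ) ^ wdeg w • tens w := by
  induction w with
  | nil => simp [tens, wdeg]
  | cons a w ih =>
    have h : tens (a :: w) = TensorAlgebra.ι ℝ a.val * tens w := by simp [tens]
    rw [h, map_mul, ih, parityT_ι, wdeg_cons, zpow_add₀ (by norm_num)]
    rw [smul_mul_smul_comm]

theorem parityT_shuffle (u v : List (HomEl 𝒢)) :
    parityT 𝒢 (shuffle u v) = (-1 : ℝ) ^ (wdeg u + wdeg v) • shuffle u v := by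
  induction u, v using shuffle.induct with
  | case1 v => simp [shuffle, parityT_tens, wdeg]
  | case2 a u =>
    rw [shuffle, parityT_tens]
    simp [wdeg]
  | case3 a u b v ih1 ih2 =>
    have h1 : (-1 : ℝ) ≠ 0 := by norm_num
    rw [shuffle, map_add, map_smul, map_mul, map_mul, ih1, ih2, parityT_ι, parityT_ι,
      smul_mul_smul_comm, smul_mul_smul_comm, smul_add, ← zpow_add₀ h1, ← zpow_add₀ h1,
      smul_comm, wdeg_cons a u, wdeg_cons b v]
    congr 3 <;> ring_nf

theorem shuffleRel_le_comap :
    shuffleRel 𝒢 ≤ (shuffleRel 𝒢).comap (parityT 𝒢).toLinearMap := by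
  have h1 : (1 : TensorAlgebra ℝ G) ∈ shuffleRel 𝒢 := Submodule.subset_span (Or.inl rfl)
  refine Submodule.span_le.2 fun x hx => ?_
  change parityT 𝒢 x ∈ shuffleRel 𝒢
  rcases hx with hx | ⟨u, v, hu, hv, hx⟩
  · rw [Set.mem_singleton_iff.1 hx, map_one]
    exact h1
  · rw [hx, parityT_shuffle]
    exact Submodule.smul_mem _ _ (Submodule.subset_span (Or.inr ⟨u, v, hu, hv, rfl⟩))

variable (𝒢) in
/-- `X ↦ (-1)^(deg X) X` on `ℋ[1]`; the shift by one gives the additional sign. -/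
def parityH : Hsp 𝒢 →ₗ[ℝ] Hsp 𝒢 :=
  -((shuffleRel 𝒢).mapQ (shuffleRel 𝒢) (parityT 𝒢).toLinearMap shuffleRel_le_comap)

theorem parityH_cls (w : List (HomEl 𝒢)) : parityH 𝒢 (cls w) = (-1 : ℝ) ^ hdeg w • cls w := by
  have h : parityH 𝒢 (cls w) = -((shuffleRel 𝒢).mkQ (parityT 𝒢 (tens w))) := rfl
  rw [h, parityT_tens, map_smul, hdeg, zpow_sub₀ (by norm_num), cls, zpow_one, div_neg, div_one,
    neg_smul]

variable (𝒢) in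
/-- The induced map on the tensor algebra of `ℋ[1]`. -/
def parityTH : TensorAlgebra ℝ (Hsp 𝒢) →ₐ[ℝ] TensorAlgebra ℝ (Hsp 𝒢) :=
  TensorAlgebra.lift ℝ (TensorAlgebra.ι ℝ ∘ₗ parityH 𝒢)

theorem parityTH_ι (w : List (HomEl 𝒢)) :
    parityTH 𝒢 (TensorAlgebra.ι ℝ (cls w)) =
      (-1 : ℝ) ^ hdeg w • TensorAlgebra.ι ℝ (cls w) := by
  simp [parityTH, parityH_cls]

theorem symRel_le_comap : symRel 𝒢 ≤ (symRel 𝒢).comap (parityTH 𝒢).toLinearMap := by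
  have h1 : (1 : TensorAlgebra ℝ (Hsp 𝒢)) ∈ symRel 𝒢 := Submodule.subset_span (Or.inl rfl)
  refine Submodule.span_le.2 fun x hx => ?_
  change parityTH 𝒢 x ∈ symRel 𝒢
  rcases hx with hx | ⟨P, Q, X, Y, hx⟩
  · rw [Set.mem_singleton_iff.1 hx, map_one]
    exact h1
  · have key : parityTH 𝒢 x = ((-1 : ℝ) ^ hdeg X * (-1 : ℝ) ^ hdeg Y) •
        (parityTH 𝒢 P * (TensorAlgebra.ι ℝ (cls X) * TensorAlgebra.ι ℝ (cls Y)
        - (-1 : ℝ) ^ (hdeg X * hdeg Y) •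
            (TensorAlgebra.ι ℝ (cls Y) * TensorAlgebra.ι ℝ (cls X))) * parityTH 𝒢 Q) := by
      rw [hx, map_mul, map_mul, map_sub, map_smul, map_mul, map_mul, parityTH_ι, parityTH_ι,
        smul_mul_smul_comm, smul_mul_smul_comm, mul_comm ((-1 : ℝ) ^ hdeg Y), smul_comm,
        ← smul_sub, mul_smul_comm, smul_mul_assoc]
    rw [key]
    exact Submodule.smul_mem _ _ (Submodule.subset_span (Or.inr ⟨_, _, X, Y, rfl⟩))

variable (𝒢) in
/-- The sign operator `x ↦ (-1)^(deg x) x` of `S⁺(ℋ[1])`. -/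
def parityS : SPlus 𝒢 →ₗ[ℝ] SPlus 𝒢 :=
  (symRel 𝒢).mapQ (symRel 𝒢) (parityTH 𝒢).toLinearMap symRel_le_comap

theorem parityS_mon (L : List (List (HomEl 𝒢))) :
    parityS 𝒢 (mon L) = (-1 : ℝ) ^ sdeg L • mon L := by
  have h : parityS 𝒢 (mon L) = (symRel 𝒢).mkQ (parityTH 𝒢 (tensH L)) := rfl
  have h2 : parityTH 𝒢 (tensH L) = (-1 : ℝ) ^ sdeg L • tensH L := by
    induction L with
    | nil => simp [tensH, sdeg]
    | cons X L ih =>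
      have h3 : tensH (X :: L) = TensorAlgebra.ι ℝ (cls X) * tensH L := by simp [tensH]
      have h4 : sdeg (X :: L) = hdeg X + sdeg L := by simp [sdeg]
      rw [h3, map_mul, ih rfl, parityTH_ι, smul_mul_smul_comm, h4, zpow_add₀ (by norm_num)]
  rw [h, h2, map_smul, mon]

/-- `D ⊗ id + id ⊗ D` for `D` of degree `1`, with the Koszul sign:
`x ⊗ y ↦ D x ⊗ y + (-1)^(deg x) x ⊗ D y`. -/
def koszulExt (D : SPlus 𝒢 →ₗ[ℝ] SPlus 𝒢) :
    SPlus 𝒢 ⊗[ℝ] SPlus 𝒢 →ₗ[ℝ] SPlus 𝒢 ⊗[ℝ] SPlus 𝒢 :=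
  TensorProduct.map D LinearMap.id + TensorProduct.map (parityS 𝒢) D

/-- `D` is homogeneous of degree `1`. -/
def IsDegreeOne (D : SPlus 𝒢 →ₗ[ℝ] SPlus 𝒢) : Prop :=
  ∀ (n : ℤ), ∀ x ∈ gradeS 𝒢 n, D x ∈ gradeS 𝒢 (n + 1)

/-- A degree `1` coderivation of the degree `0` coproduct `Δ`. -/
def IsCoderivationOfCoproduct (Δ : SPlus 𝒢 →ₗ[ℝ] SPlus 𝒢 ⊗[ℝ] SPlus 𝒢)
    (D : SPlus 𝒢 →ₗ[ℝ] SPlus 𝒢) : Prop :=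
  koszulExt D ∘ₗ Δ = Δ ∘ₗ D

/-- A degree `1` (graded) coderivation of the degree `1` cobracket `κ`. -/
def IsCoderivationOfCobracket (κ : SPlus 𝒢 →ₗ[ℝ] SPlus 𝒢 ⊗[ℝ] SPlus 𝒢)
    (D : SPlus 𝒢 →ₗ[ℝ] SPlus 𝒢) : Prop :=
  koszulExt D ∘ₗ κ = -(κ ∘ₗ D)

end Parity

/-! ### The coproduct and the cobracket -/

/-- All decompositions `L = P ++ x :: Q`, as triples `(P, x, Q)`. -/
def picks {α : Type*} : List α → List (List α × α × List α)
  | [] => []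
  | x :: L => ([], x, L) :: (picks L).map fun t => (x :: t.1, t.2.1, t.2.2)

/-- All ways to split `X₁, …, Xₙ` into two complementary sublists `X_I`, `X_J`, each with the Koszul
sign of the reordering `X₁ ⋯ Xₙ → X_I X_J`. -/
def splits : List (List (HomEl 𝒢)) →
    List (ℝ × List (List (HomEl 𝒢)) × List (List (HomEl 𝒢)))
  | [] => [(1, [], [])]
  | X :: L =>
      (splits L).map (fun t => (t.1, X :: t.2.1, t.2.2)) ++
      (splits L).map (fun t => ((-1 : ℝ) ^ (hdeg X * sdeg t.2.1) * t.1, t.2.1, X :: t.2.2))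

/-- `Δ(X₁ ⋯ Xₙ) = ∑ ± X_I ⊗ X_J` over `I ⊔ J = {1, …, n}` (the terms with `I` or `J` empty are `0`,
since `mon [] = 0`). -/
def IsCoproduct (Δ : SPlus 𝒢 →ₗ[ℝ] SPlus 𝒢 ⊗[ℝ] SPlus 𝒢) : Prop :=
  ∀ L : List (List (HomEl 𝒢)),
    Δ (mon L) = ((splits L).map fun t => t.1 • (mon t.2.1 ⊗ₜ[ℝ] mon t.2.2)).sum

/-- The terms of `κ(X₁ ⋯ Xₙ)` that cut the `s`-th factor `X = U ⊗ V`, where `P` and `Q` are the lists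
of factors before and after `X`, and `P = I₁ ⊔ J₁`, `Q = I₂ ⊔ J₂`, so that `I = I₁ ⊔ I₂` and
`J = J₁ ⊔ J₂`. The last exponent is the one of the reordering
`X_{I₁} X_{J₁} U V X_{I₂} X_{J₂} → X_{I₁} X_{I₂} U V X_{J₁} X_{J₂}`. -/
def cobracketTerm (P : List (List (HomEl 𝒢))) (U V : List (HomEl 𝒢))
    (Q : List (List (HomEl 𝒢))) : SPlus 𝒢 ⊗[ℝ] SPlus 𝒢 :=
  ((splits P).map fun p => ((splits Q).map fun q =>
    ((-1 : ℝ) ^ sdeg P * (-1 : ℝ) ^ (hdeg U + 1) * p.1 * q.1 *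
      (-1 : ℝ) ^ (sdeg q.2.1 * (hdeg U + hdeg V + sdeg p.2.2)
        + sdeg p.2.2 * (hdeg U + hdeg V))) •
    (mon (p.2.1 ++ q.2.1 ++ [U]) ⊗ₜ[ℝ] mon (V :: (p.2.2 ++ q.2.2))
      + (-1 : ℝ) ^ (hdeg U * hdeg V) •
        (mon (p.2.1 ++ q.2.1 ++ [V]) ⊗ₜ[ℝ] mon (U :: (p.2.2 ++ q.2.2))))).sum).sum

/-- `κ(X₁ ⋯ Xₙ)` is the sum, over all `s` and all cuts of the word `X_s` into two nonempty words
`U`, `V`, of the terms above. -/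
def IsCobracket (κ : SPlus 𝒢 →ₗ[ℝ] SPlus 𝒢 ⊗[ℝ] SPlus 𝒢) : Prop :=
  ∀ L : List (List (HomEl 𝒢)),
    κ (mon L) = ((picks L).map fun t =>
      ∑ j ∈ Finset.Ico 1 t.2.1.length,
        cobracketTerm t.1 (t.2.1.take j) (t.2.1.drop j) t.2.2).sum

/-! ### The extensions of the product and of the bracket -/

namespace GradedProductBracket

variable (A : GradedProductBracket 𝒢)

/-- `a₀ ⊗ ⋯ ⊗ aₙ ↦ ∑ⱼ (-1)^(∑_{i<j} deg aᵢ) a₀ ⊗ ⋯ ⊗ m(aⱼ ⊗ aⱼ₊₁) ⊗ ⋯ ⊗ aₙ`, where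
`m(a ⊗ b) = (-1)^(deg a) ab`. -/
def mulTens : List (HomEl 𝒢) → TensorAlgebra ℝ G
  | [] => 0
  | [_] => 0
  | a :: b :: w =>
      (-1 : ℝ) ^ a.deg • (TensorAlgebra.ι ℝ (A.mul a.val b.val) * tens w)
        + (-1 : ℝ) ^ a.deg • (TensorAlgebra.ι ℝ a.val * mulTens (b :: w))

/-- The sum over all shuffles of two words, and over all places in the shuffle where a letter `a` of
the left word is directly followed by a letter `b` of the right word, of the shuffle with `a ⊗ b`
replaced by `[a,b]`, with the Koszul sign of the shuffle. The cases are: the shuffle begins with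
`a ⊗ b` and these are replaced, or its first letter is not concerned. -/
def bracketTens : List (HomEl 𝒢) → List (HomEl 𝒢) → TensorAlgebra ℝ G
  | [], _ => 0
  | _ :: _, [] => 0
  | a :: u, b :: v =>
      (-1 : ℝ) ^ (b.deg * wdeg u) • (TensorAlgebra.ι ℝ (A.bracket a.val b.val) * shuffle u v)
        + TensorAlgebra.ι ℝ a.val * bracketTens u (b :: v)
        + (-1 : ℝ) ^ (b.deg * wdeg (a :: u)) •
            (TensorAlgebra.ι ℝ b.val * bracketTens (a :: u) v)
termination_by u v => u.length + v.length

/-- `m(X) ∈ ℋ` for a word `X`. -/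
def mulWord (X : List (HomEl 𝒢)) : Hsp 𝒢 := (shuffleRel 𝒢).mkQ (A.mulTens X)

/-- `[X ∧ Y] ∈ ℋ` for words `X`, `Y`. -/
def bracketWord (X Y : List (HomEl 𝒢)) : Hsp 𝒢 := (shuffleRel 𝒢).mkQ (A.bracketTens X Y)

/-- `m₀` is the extension of the product to `ℋ`. -/
def IsProductOnH (m₀ : Hsp 𝒢 →ₗ[ℝ] Hsp 𝒢) : Prop :=
  ∀ X : List (HomEl 𝒢), m₀ (cls X) = A.mulWord X

/-- `b` is the extension of the bracket to `ℋ`. -/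
def IsBracketOnH (b : Hsp 𝒢 →ₗ[ℝ] Hsp 𝒢 →ₗ[ℝ] Hsp 𝒢) : Prop :=
  ∀ X Y : List (HomEl 𝒢), b (cls X) (cls Y) = A.bracketWord X Y

/-- `m(X₁ ⋯ Xₙ) = ∑ⱼ (-1)^(∑_{k<j} deg X_k) X₁ ⋯ m(Xⱼ) ⋯ Xₙ`. -/
def IsProductExtension (m : SPlus 𝒢 →ₗ[ℝ] SPlus 𝒢) : Prop :=
  ∀ L : List (List (HomEl 𝒢)),
    m (mon L) = ((picks L).map fun t =>
      (-1 : ℝ) ^ sdeg t.1 •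
        (symRel 𝒢).mkQ (tensH t.1 * TensorAlgebra.ι ℝ (A.mulWord t.2.1) * tensH t.2.2)).sum

/-- `ℓ(X₁ ⋯ Xₙ) = ∑_{i<j} ± ℓ(Xᵢ Xⱼ) X₁ ⋯ X̂ᵢ ⋯ X̂ⱼ ⋯ Xₙ`, where `±` is the Koszul sign of
`X₁ ⋯ Xₙ → Xᵢ Xⱼ X₁ ⋯ X̂ᵢ ⋯ X̂ⱼ ⋯ Xₙ` and `ℓ(X Y) = (-1)^(deg X) [X ∧ Y]`. The list is decomposed as
`P ++ Xᵢ :: Q ++ Xⱼ :: R`. -/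
def IsBracketExtension (l : SPlus 𝒢 →ₗ[ℝ] SPlus 𝒢) : Prop :=
  ∀ L : List (List (HomEl 𝒢)),
    l (mon L) = ((picks L).map fun t => ((picks t.2.2).map fun s =>
      ((-1 : ℝ) ^ (hdeg t.2.1 * sdeg t.1 + hdeg s.2.1 * (sdeg t.1 + sdeg s.1)) *
          (-1 : ℝ) ^ hdeg t.2.1) •
        (symRel 𝒢).mkQ (TensorAlgebra.ι ℝ (A.bracketWord t.2.1 s.2.1) *
          tensH (t.1 ++ s.1 ++ s.2.2))).sum).sum

end GradedProductBracket

end GInfinity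

end

open GInfinity

open scoped TensorProduct

noncomputable section

namespace GInfinity

/-! Signs depend only on parities, so apart from the claim about integral degrees everything is
proved for super vector spaces, where an identity between signs becomes a finite check over `ZMod
2`. Operators on the tensor algebra and on the symmetric algebra are defined by recursion on the
first factor (`recT`, `recS`), and identities between them are proved by induction on first factors.
The explicit sums over shuffles, cuts and sublists enter only at the end, where they are seen to
satisfy the same recursions.

On words, the shuffle product is commutative and associative. The extended product is a derivation
of it (`M_sh`): a letter `a` of one word and a letter `b` of the other meet in both orders, and the
contractions `m(a,b)` and `m(b,a)` cancel because the shifted product is antisymmetric. The extended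
bracket is antisymmetric and a derivation of shuffles in each argument (`B_anti`, `B_sh`). Hence
both descend to `ℋ`. Associativity, Jacobi and Leibniz pass from letters to words in `M_sq`,
`B_jacobi` and `M_B`.

Deconcatenation does not descend to `ℋ`. But the reduced deconcatenation of a shuffle of `X` and `Y`
is `X ⊗ Y ± Y ⊗ X` (`deltaH_sh`), and the antisymmetrization kills this, so the cobracket does
descend (`cobr_sh`). Its compatibility with product and bracket (`cobr_M`, `cobr_B`) needs none of
the three axioms, and this is why the coderivation statements are unconditional.

On the symmetric algebra, `m` is the derivation extending the product of `ℋ`, while `ℓ` is a second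
order operator: its commutator with multiplication by `X` is the derivation `ad X` extending `ℓ(X
·)`. The coderivation identities follow by recursion; the substantial one is `cobracket_ad`, where
the second order of `ℓ` is felt. Likewise `m² = 0`, `ℓ² = 0` and `mℓ + ℓm = 0` follow from the
corresponding identities on `ℋ` by commuting with one letter at a time. All these operators kill
`1`, so they descend to `S⁺`, the symmetric algebra modulo scalars.

For the converses, `m` keeps the number of factors and `ℓ` lowers it by one. The linear part of `(m
+ ℓ)²` on one, two or three factors therefore sees only `m²`, `mℓ + ℓm` or `ℓ²` (`linearPart_sq`).
Evaluating on very short words gives back the three axioms, because letters inject into `ℋ`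
(`quotient_pr_letter`). -/

/-! ### Signs -/

/-- The sign of a parity, as an integer. -/
def sgZ (p : ZMod 2) : ℤ := if p = 0 then 1 else -1

/-- The sign of a parity, as a real number. -/
def sg (p : ZMod 2) : ℝ := (sgZ p : ℝ)

theorem sg_zero : sg 0 = 1 := by simp [sg, sgZ]

theorem sg_one : sg 1 = -1 := by simp [sg, sgZ]

theorem sg_add (p q : ZMod 2) : sg (p + q) = sg p * sg q := by
  have h : ∀ p q : ZMod 2, sgZ (p + q) = sgZ p * sgZ q := by decide
  simp only [sg]
  exact_mod_cast h p q

theorem sg_mul_self (p : ZMod 2) : sg p * sg p = 1 := by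
  have h : ∀ p : ZMod 2, sgZ p * sgZ p = 1 := by decide
  simp only [sg]
  exact_mod_cast h p

theorem sg_ne_zero (p : ZMod 2) : sg p ≠ 0 := by
  intro h
  have := sg_mul_self p
  simp [h] at this

theorem sg_smul_sg_smul {M : Type*} [AddCommGroup M] [Module ℝ M] (p : ZMod 2) (x : M) :
    sg p • sg p • x = x := by
  rw [smul_smul, sg_mul_self, one_smul]

/-- The bridge between the integral exponents of the statement and the parities of the proof. -/
theorem neg_one_zpow_eq_sg (n : ℤ) : (-1 : ℝ) ^ n = sg (n : ZMod 2) := by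
  rcases Int.even_or_odd n with h | h
  · rw [h.neg_one_zpow, (ZMod.intCast_zmod_eq_zero_iff_dvd n 2).2 (by exact_mod_cast h.two_dvd),
      sg_zero]
  · obtain ⟨k, rfl⟩ := h
    have h2 : ((2 * k + 1 : ℤ) : ZMod 2) = 1 := by
      push_cast
      rw [show (2 : ZMod 2) = 0 from rfl, zero_mul, zero_add]
    rw [h2, sg_one, Odd.neg_one_zpow ⟨k, rfl⟩]

/-! ### Super vector spaces -/

/-- A real vector space with a parity involution. -/
class SuperModule (V : Type*) [AddCommGroup V] [Module ℝ V] where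
  par : V →ₗ[ℝ] V
  par_par : ∀ v, par (par v) = v

open SuperModule

section Basic

variable {V W : Type*} [AddCommGroup V] [Module ℝ V] [SuperModule V]
  [AddCommGroup W] [Module ℝ W] [SuperModule W]

/-- `v` is homogeneous of parity `p`. -/
def HasParity (p : ZMod 2) (v : V) : Prop := par v = sg p • v

theorem HasParity.par_eq {p : ZMod 2} {v : V} (h : HasParity p v) : par v = sg p • v := h

theorem HasParity.zero (p : ZMod 2) : HasParity p (0 : V) := by simp [HasParity]

theorem HasParity.add {p : ZMod 2} {v w : V} (hv : HasParity p v) (hw : HasParity p w) :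
    HasParity p (v + w) := by
  simp only [HasParity] at *
  rw [map_add, hv, hw, smul_add]

theorem HasParity.smul {p : ZMod 2} {v : V} (c : ℝ) (hv : HasParity p v) :
    HasParity p (c • v) := by
  simp only [HasParity] at *
  rw [map_smul, hv, smul_comm]

theorem HasParity.neg {p : ZMod 2} {v : V} (hv : HasParity p v) : HasParity p (-v) := by
  simpa using hv.smul (-1)

theorem HasParity.congr {p q : ZMod 2} {v : V} (hv : HasParity p v) (h : p = q) :
    HasParity q v := h ▸ hv

theorem HasParity.par {p : ZMod 2} {v : V} (hv : HasParity p v) :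
    HasParity p (par v) := by
  rw [hv.par_eq]; exact hv.smul _

/-- The component of parity `p`. -/
def proj (p : ZMod 2) : V →ₗ[ℝ] V := (1 / 2 : ℝ) • (LinearMap.id + sg p • par)

theorem proj_apply (p : ZMod 2) (v : V) : proj p v = (1 / 2 : ℝ) • (v + sg p • par v) := rfl

theorem hasParity_proj (p : ZMod 2) (v : V) : HasParity p (proj p v) := by
  rw [HasParity, proj_apply, map_smul, map_add, map_smul, par_par, smul_comm (sg p), smul_add,
    smul_add, smul_add, sg_smul_sg_smul, add_comm]

theorem proj_add_proj (v : V) : proj 0 v + proj 1 v = v := by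
  rw [proj_apply, proj_apply, sg_zero, sg_one]
  module

theorem HasParity.proj_self {p : ZMod 2} {v : V} (h : HasParity p v) : proj p v = v := by
  rw [proj_apply, h.par_eq, sg_smul_sg_smul]
  module

theorem HasParity.proj_of_ne {p q : ZMod 2} {v : V} (h : HasParity p v) (hq : q ≠ p) :
    proj q v = 0 := by
  have h2 : ∀ p q : ZMod 2, q ≠ p → q + p = 1 := by decide
  rw [proj_apply, h.par_eq, smul_smul, ← sg_add, h2 p q hq, sg_one]
  module

/-- A bilinear map with the Koszul sign of the exchange of its arguments. -/
def koszul {M : Type*} [AddCommGroup M] [Module ℝ M] (f : V →ₗ[ℝ] W →ₗ[ℝ] M) :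
    V →ₗ[ℝ] W →ₗ[ℝ] M :=
  f ∘ₗ proj 0 + (f.compl₂ par) ∘ₗ proj 1

theorem koszul_apply {M : Type*} [AddCommGroup M] [Module ℝ M] (f : V →ₗ[ℝ] W →ₗ[ℝ] M)
    {p q : ZMod 2} {v : V} {w : W} (hv : HasParity p v) (hw : HasParity q w) :
    koszul f v w = sg (p * q) • f v w := by
  have h : ∀ p : ZMod 2, p = 0 ∨ p = 1 := by decide
  rcases h p with rfl | rfl
  · simp [koszul, hv.proj_self, hv.proj_of_ne (q := 1) (by decide), sg_zero]
  · simp [koszul, hv.proj_self, hv.proj_of_ne (q := 0) (by decide), hw.par_eq]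

/-- `v ↦ (-1)^(e |v|) v`. -/
def parPow (e : ZMod 2) : V →ₗ[ℝ] V := if e = 0 then LinearMap.id else par

theorem HasParity.parPow {p : ZMod 2} {v : V} (e : ZMod 2) (h : HasParity p v) :
    parPow e v = sg (e * p) • v := by
  have h2 : ∀ p : ZMod 2, p = 0 ∨ p = 1 := by decide
  rcases h2 e with rfl | rfl
  · simp [GInfinity.parPow, sg_zero]
  · simp [GInfinity.parPow, h.par_eq]

theorem parPow_one : (parPow 1 : V →ₗ[ℝ] V) = par := by simp [parPow]

instance : SuperModule (V ⊗[ℝ] W) where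
  par := TensorProduct.map par par
  par_par x := by
    induction x with
    | zero => simp
    | add x y hx hy => rw [map_add, map_add, hx, hy]
    | tmul x y => simp [par_par]

theorem par_tmul (v : V) (w : W) : par (v ⊗ₜ[ℝ] w) = par v ⊗ₜ par w := rfl

theorem HasParity.tmul {p q : ZMod 2} {v : V} {w : W} (hv : HasParity p v) (hw : HasParity q w) :
    HasParity (p + q) (v ⊗ₜ[ℝ] w) := by
  rw [HasParity, par_tmul, hv.par_eq, hw.par_eq, TensorProduct.smul_tmul_smul, sg_add]

/-- Homogeneous elements generate. -/
theorem parity_induction {C : V → Prop} (hadd : ∀ x y, C x → C y → C (x + y))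
    (h : ∀ p v, HasParity p v → C v) (v : V) : C v := by
  rw [← proj_add_proj v]
  exact hadd _ _ (h _ _ (hasParity_proj _ _)) (h _ _ (hasParity_proj _ _))

theorem linearMap_ext_parity {M : Type*} [AddCommGroup M] [Module ℝ M] {f g : V →ₗ[ℝ] M}
    (h : ∀ p v, HasParity p v → f v = g v) : f = g :=
  LinearMap.ext fun v => parity_induction (C := fun v => f v = g v)
    (fun x y hx hy => by rw [map_add, map_add, hx, hy]) h v

theorem tmul_parity_induction {C : V ⊗[ℝ] W → Prop} (h0 : C 0)
    (hadd : ∀ x y, C x → C y → C (x + y))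
    (h : ∀ p q v w, HasParity p v → HasParity q w → C (v ⊗ₜ w)) (z : V ⊗[ℝ] W) : C z := by
  induction z with
  | zero => exact h0
  | add x y hx hy => exact hadd _ _ hx hy
  | tmul v w =>
    refine parity_induction (C := fun v => C (v ⊗ₜ w)) (fun x y hx hy => ?_) (fun p v hv => ?_) v
    · rw [TensorProduct.add_tmul]; exact hadd _ _ hx hy
    · refine parity_induction (C := fun w => C (v ⊗ₜ w)) (fun x y hx hy => ?_) (fun q w hw => ?_) w
      · rw [TensorProduct.tmul_add]; exact hadd _ _ hx hy
      · exact h p q v w hv hw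

/-- Homogeneous tensors are sums of tensors of homogeneous elements of the right parities. -/
@[elab_as_elim]
theorem HasParity.tmul_induction {C : V ⊗[ℝ] W → Prop} (h0 : C 0)
    (hadd : ∀ x y, C x → C y → C (x + y)) {e : ZMod 2}
    (h : ∀ p q v w, HasParity p v → HasParity q w → p + q = e → C (v ⊗ₜ w)) {z : V ⊗[ℝ] W}
    (hz : HasParity e z) : C z := by
  rw [← hz.proj_self]
  clear hz
  -- With `proj e z` in place of `z` the induction may run over all tensors: those of the wrong
  -- total parity project to `0`.
  refine tmul_parity_induction (C := fun z => C (proj e z)) (by simpa using h0)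
    (fun x y hx hy => by rw [map_add]; exact hadd _ _ hx hy) (fun p q v w hv hw => ?_) z
  by_cases hpq : e = p + q
  · subst hpq
    rw [(hv.tmul hw).proj_self]
    exact h p q v w hv hw rfl
  · rw [(hv.tmul hw).proj_of_ne hpq]
    exact h0

theorem tensor_ext_parity {M : Type*} [AddCommGroup M] [Module ℝ M] {f g : V ⊗[ℝ] W →ₗ[ℝ] M}
    (h : ∀ p q v w, HasParity p v → HasParity q w → f (v ⊗ₜ w) = g (v ⊗ₜ w)) : f = g :=
  LinearMap.ext fun z => tmul_parity_induction (C := fun z => f z = g z) (by simp)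
    (fun x y hx hy => by rw [map_add, map_add, hx, hy]) h z

end Basic

/-! ### The tensor algebra -/

section Tensor

variable {V : Type*} [AddCommGroup V] [Module ℝ V]

namespace TensorInstances

scoped instance tensorAddCommGroup : AddCommGroup (TensorAlgebra ℝ V) := Ring.toAddCommGroup

scoped instance tensorAddCommMonoid : AddCommMonoid (TensorAlgebra ℝ V) :=
  AddCommGroup.toAddCommMonoid

scoped instance tensorModule : Module ℝ (TensorAlgebra ℝ V) := Algebra.toModule

end TensorInstances

open TensorInstances

/-- A tensor starting with the letter `v`. -/
def cons (v : V) (t : TensorAlgebra ℝ V) : TensorAlgebra ℝ V := TensorAlgebra.ι ℝ v * t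

/-- Left concatenation by a letter. -/
def consL : V →ₗ[ℝ] TensorAlgebra ℝ V →ₗ[ℝ] TensorAlgebra ℝ V :=
  LinearMap.mul ℝ (TensorAlgebra ℝ V) ∘ₗ TensorAlgebra.ι ℝ

@[simp] theorem consL_apply (v : V) (t : TensorAlgebra ℝ V) : consL v t = cons v t := rfl

theorem cons_add (v : V) (s t : TensorAlgebra ℝ V) : cons v (s + t) = cons v s + cons v t :=
  mul_add _ _ _

theorem cons_smul (v : V) (r : ℝ) (t : TensorAlgebra ℝ V) : cons v (r • t) = r • cons v t :=
  mul_smul_comm _ _ _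

theorem add_cons (v w : V) (t : TensorAlgebra ℝ V) : cons (v + w) t = cons v t + cons w t := by
  simp [cons, add_mul]

theorem smul_cons (v : V) (r : ℝ) (t : TensorAlgebra ℝ V) : cons (r • v) t = r • cons v t := by
  simp [cons]

theorem cons_zero (v : V) : cons v 0 = 0 := mul_zero _

theorem zero_cons (t : TensorAlgebra ℝ V) : cons 0 t = 0 := by simp [cons]

theorem tensor_induction {C : TensorAlgebra ℝ V → Prop}
    (hadd : ∀ x y, C x → C y → C (x + y)) (hsmul : ∀ (c : ℝ) x, C x → C (c • x))
    (h1 : C 1) (hcons : ∀ v t, C t → C (cons v t)) (t : TensorAlgebra ℝ V) : C t := by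
  -- Generalized to left multiplication by `t`, since the induction on the tensor algebra splits
  -- arbitrary products and not first letters.
  have key : ∀ x, C x → C (t * x) := by
    induction t using TensorAlgebra.induction with
    | algebraMap r => intro x hx; rw [← Algebra.smul_def]; exact hsmul _ _ hx
    | ι v => exact fun x hx => hcons v x hx
    | mul a b ha hb => intro x hx; rw [mul_assoc]; exact ha _ (hb _ hx)
    | add a b ha hb => intro x hx; rw [add_mul]; exact hadd _ _ (ha _ hx) (hb _ hx)
  simpa using key 1 h1

/-! ### Primitive recursion on tensors -/

section Rec

variable {M : Type*} [AddCommGroup M] [Module ℝ M]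

/-- One step of the primitive recursion `recT`. -/
def recStep (c : V →ₗ[ℝ] Module.End ℝ M) (d : V →ₗ[ℝ] TensorAlgebra ℝ V →ₗ[ℝ] M) :
    V →ₗ[ℝ] Module.End ℝ (TensorAlgebra ℝ V × M) where
  toFun v := LinearMap.prod (consL v ∘ₗ LinearMap.fst ℝ _ _)
    (c v ∘ₗ LinearMap.snd ℝ _ _ + d v ∘ₗ LinearMap.fst ℝ _ _)
  map_add' v w := by
    ext x <;> simp [cons]
  map_smul' r v := by
    ext x <;> simp [cons]

theorem recStep_apply (c : V →ₗ[ℝ] Module.End ℝ M) (d : V →ₗ[ℝ] TensorAlgebra ℝ V →ₗ[ℝ] M)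
    (v : V) (t : TensorAlgebra ℝ V) (m : M) : recStep c d v (t, m) = (cons v t, c v m + d v t) :=
  rfl

/-- Primitive recursion on the tensor algebra. -/
def recT (c : V →ₗ[ℝ] Module.End ℝ M) (m₀ : M) (d : V →ₗ[ℝ] TensorAlgebra ℝ V →ₗ[ℝ] M) :
    TensorAlgebra ℝ V →ₗ[ℝ] M :=
  LinearMap.snd ℝ _ _ ∘ₗ LinearMap.applyₗ (1, m₀) ∘ₗ
    (TensorAlgebra.lift ℝ (recStep c d)).toLinearMap

variable (c : V →ₗ[ℝ] Module.End ℝ M) (m₀ : M) (d : V →ₗ[ℝ] TensorAlgebra ℝ V →ₗ[ℝ] M)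

theorem recT_one : recT c m₀ d 1 = m₀ := by simp [recT]

theorem recT_cons (v : V) (t : TensorAlgebra ℝ V) :
    recT c m₀ d (cons v t) = c v (recT c m₀ d t) + d v t := by
  -- The first component of the state rebuilds the tensor itself, so that the inhomogeneous term `d
  -- v t` can read it.
  have h : ∀ t, (TensorAlgebra.lift ℝ (recStep c d) t (1, m₀)).1 = t := by
    intro t
    induction t using tensor_induction with
    | hadd x y hx hy => simp [hx, hy]
    | hsmul r x hx => simp [hx]
    | h1 => simp
    | hcons v t ht =>
      rw [cons, map_mul, TensorAlgebra.lift_ι_apply, Module.End.mul_apply]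
      exact congrArg (cons v) ht
  have h2 : TensorAlgebra.lift ℝ (recStep c d) t (1, m₀) = (t, recT c m₀ d t) :=
    Prod.ext (h t) rfl
  change (TensorAlgebra.lift ℝ (recStep c d) (cons v t) (1, m₀)).2 = _
  rw [cons, map_mul, TensorAlgebra.lift_ι_apply, Module.End.mul_apply, h2, recStep_apply]

end Rec

variable [SuperModule V]

instance : SuperModule (TensorAlgebra ℝ V) where
  par := (TensorAlgebra.lift ℝ (TensorAlgebra.ι ℝ ∘ₗ par)).toLinearMap
  par_par x := by
    induction x using tensor_induction with
    | hadd x y hx hy => rw [map_add, map_add, hx, hy]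
    | hsmul c x hx => rw [map_smul, map_smul, hx]
    | h1 => simp
    | hcons v t ht =>
      simp only [AlgHom.toLinearMap_apply] at *
      simp [cons, ht, par_par]

theorem par_cons (v : V) (t : TensorAlgebra ℝ V) : par (cons v t) = cons (par v) (par t) := by
  simp [par, cons]

theorem par_one : par (1 : TensorAlgebra ℝ V) = 1 := by
  simp [par]

theorem HasParity.one : HasParity 0 (1 : TensorAlgebra ℝ V) := by
  simp [HasParity, par_one, sg_zero]

theorem HasParity.cons {p q : ZMod 2} {v : V} {t : TensorAlgebra ℝ V} (hv : HasParity p v)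
    (ht : HasParity q t) : HasParity (p + q) (cons v t) := by
  rw [HasParity, par_cons, hv.par_eq, ht.par_eq, sg_add]
  simp [GInfinity.cons, smul_smul, mul_comm]

/-- Induction on homogeneous tensors by their first letters. -/
theorem HasParity.induction {C : ZMod 2 → TensorAlgebra ℝ V → Prop} (h0 : ∀ p, C p 0)
    (hadd : ∀ p x y, C p x → C p y → C p (x + y)) (hsmul : ∀ p (c : ℝ) x, C p x → C p (c • x))
    (h1 : C 0 1)
    (hcons : ∀ p q v t, HasParity p v → HasParity q t → C q t → C (p + q) (GInfinity.cons v t))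
    {p : ZMod 2} {t : TensorAlgebra ℝ V} (ht : HasParity p t) : C p t := by
  -- All parities are treated together: which component of `t` contributes to a given component of
  -- `cons v t` depends on the parity of `v`.
  have key : ∀ q, C q (proj q t) := by
    clear ht
    induction t using tensor_induction with
    | hadd x y hx hy => intro q; rw [map_add]; exact hadd _ _ _ (hx q) (hy q)
    | hsmul c x hx => intro q; rw [map_smul]; exact hsmul _ _ _ (hx q)
    | h1 =>
      intro q
      by_cases hq : q = 0
      · subst hq; rw [HasParity.one.proj_self]; exact h1
      · rw [HasParity.one.proj_of_ne hq]; exact h0 _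
    | hcons v t ih =>
      refine parity_induction (C := fun v => ∀ q, C q (proj q (GInfinity.cons v t)))
        (fun x y hx hy q => ?_) (fun r v hv q => ?_) v
      · rw [add_cons, map_add]; exact hadd _ _ _ (hx q) (hy q)
      · have h2 : ∀ s, C q (proj q (GInfinity.cons v (proj s t))) := by
          intro s
          have h3 := hv.cons (hasParity_proj s t)
          by_cases hq : q = r + s
          · subst hq
            rw [h3.proj_self]
            exact hcons _ _ _ _ hv (hasParity_proj s t) (ih s)
          · rw [h3.proj_of_ne hq]; exact h0 _
        rw [← proj_add_proj t, cons_add, map_add]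
        exact hadd _ _ _ (h2 0) (h2 1)
  rw [← ht.proj_self]
  exact key p

end Tensor

end GInfinity

end

open scoped TensorProduct

noncomputable section

namespace GInfinity

open SuperModule TensorInstances

/-! ### Words with the shuffle product -/

section RecLinear

variable {V M : Type*} [AddCommGroup V] [Module ℝ V] [AddCommGroup M] [Module ℝ M]

/-- A recursion depends additively on its starting value and inhomogeneous term taken jointly. This
makes `shStep` and `B` linear in the letters and words that enter as parameters. -/
theorem recT_add (c : V →ₗ[ℝ] Module.End ℝ M) (m m' : M)
    (d d' : V →ₗ[ℝ] TensorAlgebra ℝ V →ₗ[ℝ] M) :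
    recT c (m + m') (d + d') = recT c m d + recT c m' d' := by
  ext t
  induction t using tensor_induction with
  | hadd x y hx hy => rw [map_add, map_add, hx, hy]
  | hsmul r x hx => rw [map_smul, map_smul, hx]
  | h1 => simp [recT_one]
  | hcons v t ht =>
    simp only [recT_cons, LinearMap.add_apply] at *
    rw [ht, map_add]
    abel

theorem recT_smul (c : V →ₗ[ℝ] Module.End ℝ M) (r : ℝ) (m : M)
    (d : V →ₗ[ℝ] TensorAlgebra ℝ V →ₗ[ℝ] M) :
    recT c (r • m) (r • d) = r • recT c m d := by
  ext t
  induction t using tensor_induction with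
  | hadd x y hx hy => rw [map_add, map_add, hx, hy]
  | hsmul r x hx => rw [map_smul, map_smul, hx]
  | h1 => simp [recT_one]
  | hcons v t ht =>
    simp only [recT_cons, LinearMap.smul_apply] at *
    rw [ht, map_smul, smul_add]

end RecLinear

section Words

variable {V : Type*} [AddCommGroup V] [Module ℝ V] [SuperModule V]

theorem koszul_add {V W M : Type*} [AddCommGroup V] [Module ℝ V] [SuperModule V]
    [AddCommGroup W] [Module ℝ W] [SuperModule W] [AddCommGroup M] [Module ℝ M]
    (f g : V →ₗ[ℝ] W →ₗ[ℝ] M) : koszul (f + g) = koszul f + koszul g := by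
  ext v w
  simp only [koszul, LinearMap.add_apply, LinearMap.comp_apply, LinearMap.compl₂_apply]
  abel

theorem koszul_smul {V W M : Type*} [AddCommGroup V] [Module ℝ V] [SuperModule V]
    [AddCommGroup W] [Module ℝ W] [SuperModule W] [AddCommGroup M] [Module ℝ M]
    (r : ℝ) (f : V →ₗ[ℝ] W →ₗ[ℝ] M) : koszul (r • f) = r • koszul f := by
  ext v w
  simp [koszul]

/-- From `x ↦ x ⧢ v` to `x ↦ x ⧢ bv`, without the terms that come from the letter `b`. -/
def shStep : V →ₗ[ℝ] Module.End ℝ (TensorAlgebra ℝ V →ₗ[ℝ] TensorAlgebra ℝ V) :=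
  LinearMap.mk₂ ℝ
    (fun b F => recT consL (cons b (F 1)) (consL.compr₂ (koszul (consL.compl₂ F) b)))
    (fun b b' F => by
      rw [add_cons, ← recT_add, map_add]
      rfl)
    (fun r b F => by
      rw [smul_cons, ← recT_smul, map_smul]
      rfl)
    (fun b F F' => by
      rw [LinearMap.add_apply, cons_add, ← recT_add,
        show consL.compl₂ (F + F') = consL.compl₂ F + consL.compl₂ F' by ext; simp [cons_add],
        koszul_add]
      rfl)
    (fun r b F => by
      rw [LinearMap.smul_apply, cons_smul, ← recT_smul,
        show consL.compl₂ (r • F) = r • consL.compl₂ F by ext; simp,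
        koszul_smul]
      rfl)

theorem shStep_one (b : V) (F : TensorAlgebra ℝ V →ₗ[ℝ] TensorAlgebra ℝ V) :
    shStep b F 1 = cons b (F 1) := recT_one _ _ _

/-- Applied to `F x = sh x y` this is the shuffle recursion: the first letter is `a`, or it is `b`
after passing the whole left word. -/
theorem shStep_cons {p q : ZMod 2} (b : V) (F : TensorAlgebra ℝ V →ₗ[ℝ] TensorAlgebra ℝ V) (a : V)
    (x : TensorAlgebra ℝ V) (hb : HasParity p b) (hx : HasParity q (cons a x)) :
    shStep b F (cons a x) = cons a (shStep b F x) + sg (p * q) • cons b (F (cons a x)) := by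
  refine (recT_cons _ _ _ _ _).trans ?_
  rw [LinearMap.compr₂_apply, consL_apply, consL_apply, koszul_apply _ hb hx]
  rfl

/-- The shuffle product with Koszul signs. -/
def sh : TensorAlgebra ℝ V →ₗ[ℝ] TensorAlgebra ℝ V →ₗ[ℝ] TensorAlgebra ℝ V :=
  (recT shStep LinearMap.id 0).flip

theorem sh_one (x : TensorAlgebra ℝ V) : sh x 1 = x := by
  rw [sh, LinearMap.flip_apply, recT_one]
  rfl

theorem one_sh (y : TensorAlgebra ℝ V) : sh 1 y = y := by
  induction y using tensor_induction with
  | hadd x y hx hy => rw [map_add, hx, hy]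
  | hsmul r x hx => rw [map_smul, hx]
  | h1 => exact sh_one 1
  | hcons v t ht =>
    rw [sh, LinearMap.flip_apply] at *
    rw [recT_cons, LinearMap.zero_apply, LinearMap.zero_apply, add_zero, shStep_one, ht]

/-- Together with `sh_one`, `one_sh` and bilinearity this determines the shuffle product, and the
later facts about it are derived from these rules. -/
theorem cons_sh_cons {p q r : ZMod 2} {a b : V} {x : TensorAlgebra ℝ V} (ha : HasParity p a)
    (hx : HasParity q x) (hb : HasParity r b) (y : TensorAlgebra ℝ V) :
    sh (cons a x) (cons b y) =
      cons a (sh x (cons b y)) + sg (r * (p + q)) • cons b (sh (cons a x) y) := by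
  simp only [sh, LinearMap.flip_apply, recT_cons, LinearMap.zero_apply, add_zero]
  exact shStep_cons b _ a x hb (ha.cons hx)

theorem HasParity.sh {p q : ZMod 2} {x y : TensorAlgebra ℝ V} (hx : HasParity p x)
    (hy : HasParity q y) : HasParity (p + q) (sh x y) := by
  revert q y
  refine HasParity.induction (C := fun p x => ∀ {q y}, HasParity q y →
    HasParity (p + q) (GInfinity.sh x y)) ?_ ?_ ?_ ?_ ?_ hx
  · intro p q y _; simpa using HasParity.zero _
  · intro p x y h1 h2 q z hz
    rw [map_add, LinearMap.add_apply]
    exact (h1 hz).add (h2 hz)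
  · intro p c x h q z hz
    rw [map_smul, LinearMap.smul_apply]
    exact (h hz).smul c
  · intro q y hy
    rw [one_sh]; exact hy.congr (zero_add q).symm
  · intro p q a x ha hx ih r y hy
    refine HasParity.induction (C := fun r y =>
      HasParity (p + q + r) (GInfinity.sh (GInfinity.cons a x) y)) ?_ ?_ ?_ ?_ ?_ hy
    · intro r; simpa using HasParity.zero _
    · intro r y z h1 h2; rw [map_add]; exact h1.add h2
    · intro r c y h; rw [map_smul]; exact h.smul c
    · rw [sh_one, add_zero]; exact ha.cons hx
    · intro r s b y hb hy ih2
      rw [cons_sh_cons ha hx hb]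
      refine HasParity.add ?_ (HasParity.smul _ ?_)
      · exact (ha.cons (ih (hb.cons hy))).congr (by ring)
      · exact (hb.cons ih2).congr (by ring)

end Words

/-! ### Odd product and even bracket, and their extensions to words -/

/-- A super vector space with an odd product and an even bracket, both antisymmetric. -/
structure ShiftedOps (V : Type*) [AddCommGroup V] [Module ℝ V] [SuperModule V] where
  mm : V →ₗ[ℝ] V →ₗ[ℝ] V
  br : V →ₗ[ℝ] V →ₗ[ℝ] V
  mm_parity : ∀ {p q : ZMod 2} {a b : V}, HasParity p a → HasParity q b →
    HasParity (p + q + 1) (mm a b)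
  br_parity : ∀ {p q : ZMod 2} {a b : V}, HasParity p a → HasParity q b →
    HasParity (p + q) (br a b)
  mm_anti : ∀ {p q : ZMod 2} {a b : V}, HasParity p a → HasParity q b →
    mm a b = -(sg (p * q) • mm b a)
  br_anti : ∀ {p q : ZMod 2} {a b : V}, HasParity p a → HasParity q b →
    br a b = -(sg (p * q) • br b a)

namespace ShiftedOps

variable {V : Type*} [AddCommGroup V] [Module ℝ V] [SuperModule V] (A : ShiftedOps V)

/-- `φ a (b w) = m(a,b) w`. -/
def phi : V →ₗ[ℝ] TensorAlgebra ℝ V →ₗ[ℝ] TensorAlgebra ℝ V :=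
  (recT 0 0 (LinearMap.mk₂ ℝ (fun b t => consL.flip t ∘ₗ A.mm.flip b)
    (fun b b' t => by ext; simp) (fun r b t => by ext; simp)
    (fun b t t' => by ext; simp) (fun r b t => by ext; simp))).flip

theorem phi_one (a : V) : A.phi a 1 = 0 := by
  rw [phi, LinearMap.flip_apply, recT_one, LinearMap.zero_apply]

theorem phi_cons (a b : V) (t : TensorAlgebra ℝ V) :
    A.phi a (cons b t) = cons (A.mm a b) t := by
  rw [phi, LinearMap.flip_apply, recT_cons]
  simp

/-- The extension of the product to words. -/
def M : TensorAlgebra ℝ V →ₗ[ℝ] TensorAlgebra ℝ V := recT (consL ∘ₗ par) 0 A.phi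

theorem M_one : A.M 1 = 0 := recT_one _ _ _

theorem M_cons {p : ZMod 2} {a : V} (ha : HasParity p a) (t : TensorAlgebra ℝ V) :
    A.M (cons a t) = A.phi a t + sg p • cons a (A.M t) := by
  rw [M, recT_cons, LinearMap.comp_apply, consL_apply, ha.par_eq, smul_cons, add_comm]

/-- The terms of the bracket in which the first letters are bracketed. -/
def brHead (y : TensorAlgebra ℝ V) (b : V) :
    V →ₗ[ℝ] TensorAlgebra ℝ V →ₗ[ℝ] TensorAlgebra ℝ V :=
  LinearMap.mk₂ ℝ (fun a x => koszul (consL.compl₂ (sh.flip y) ∘ₗ A.br a) b x)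
    (fun a a' x => by
      rw [map_add, LinearMap.comp_add, koszul_add, LinearMap.add_apply, LinearMap.add_apply])
    (fun r a x => by
      rw [map_smul, LinearMap.comp_smul, koszul_smul, LinearMap.smul_apply, LinearMap.smul_apply])
    (fun a x x' => map_add _ _ _) (fun r a x => map_smul _ _ _)

theorem brHead_def (y : TensorAlgebra ℝ V) (b a : V) (x : TensorAlgebra ℝ V) :
    A.brHead y b a x = koszul (consL.compl₂ (sh.flip y) ∘ₗ A.br a) b x := rfl

theorem brHead_apply {p q : ZMod 2} {b : V} {x : TensorAlgebra ℝ V} (hb : HasParity p b)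
    (hx : HasParity q x) (y : TensorAlgebra ℝ V) (a : V) :
    A.brHead y b a x = sg (p * q) • cons (A.br a b) (sh x y) := by
  rw [brHead_def, koszul_apply _ hb hx, LinearMap.comp_apply, LinearMap.compl₂_apply,
    LinearMap.flip_apply, consL_apply]

theorem brHead_add_right (y : TensorAlgebra ℝ V) (b b' : V) :
    A.brHead y (b + b') = A.brHead y b + A.brHead y b' := by
  ext a x : 2
  simp only [LinearMap.add_apply, brHead_def, map_add]

theorem brHead_smul_right (y : TensorAlgebra ℝ V) (r : ℝ) (b : V) :
    A.brHead y (r • b) = r • A.brHead y b := by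
  ext a x : 2
  simp only [LinearMap.smul_apply, brHead_def, map_smul]

theorem brHead_add_left (y y' : TensorAlgebra ℝ V) (b : V) :
    A.brHead (y + y') b = A.brHead y b + A.brHead y' b := by
  ext a x : 2
  simp only [LinearMap.add_apply, brHead_def]
  rw [← LinearMap.add_apply, ← LinearMap.add_apply, ← koszul_add, ← LinearMap.add_comp]
  congr 4
  ext
  simp [cons_add]

theorem brHead_smul_left (r : ℝ) (y : TensorAlgebra ℝ V) (b : V) :
    A.brHead (r • y) b = r • A.brHead y b := by
  ext a x : 2
  simp only [LinearMap.smul_apply, brHead_def]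
  rw [← LinearMap.smul_apply, ← LinearMap.smul_apply, ← koszul_smul, ← LinearMap.smul_comp]
  congr 4
  ext
  simp

/-- The extension of the bracket to words. -/
def B : TensorAlgebra ℝ V →ₗ[ℝ] TensorAlgebra ℝ V →ₗ[ℝ] TensorAlgebra ℝ V :=
  (recT shStep 0 (LinearMap.mk₂ ℝ (fun b y => recT consL 0 (A.brHead y b))
    (fun b b' y => by rw [← recT_add, add_zero, brHead_add_right])
    (fun r b y => by rw [← recT_smul, smul_zero, brHead_smul_right])
    (fun b y y' => by rw [← recT_add, add_zero, brHead_add_left])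
    (fun r b y => by rw [← recT_smul, smul_zero, brHead_smul_left]))).flip

theorem B_one (x : TensorAlgebra ℝ V) : A.B x 1 = 0 := by
  rw [B, LinearMap.flip_apply, recT_one, LinearMap.zero_apply]

theorem one_B (y : TensorAlgebra ℝ V) : A.B 1 y = 0 := by
  induction y using tensor_induction with
  | hadd x y hx hy => rw [map_add, hx, hy, add_zero]
  | hsmul r x hx => rw [map_smul, hx, smul_zero]
  | h1 => exact A.B_one 1
  | hcons v t ht =>
    rw [B, LinearMap.flip_apply] at *
    rw [recT_cons, LinearMap.add_apply, shStep_one, ht, LinearMap.mk₂_apply, recT_one, cons_zero,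
      add_zero]

/-- The definition adds a shuffle step and a recursion that produces the heads `[a,b]`; both have a
part starting with `a`, and these parts recombine to the middle summand. -/
theorem B_cons {p q r : ZMod 2} {a b : V} {x : TensorAlgebra ℝ V} (ha : HasParity p a)
    (hx : HasParity q x) (hb : HasParity r b) (y : TensorAlgebra ℝ V) :
    A.B (cons a x) (cons b y) = sg (r * q) • cons (A.br a b) (sh x y)
      + cons a (A.B x (cons b y)) + sg (r * (p + q)) • cons b (A.B (cons a x) y) := by
  simp only [B, LinearMap.flip_apply, recT_cons, LinearMap.add_apply, LinearMap.mk₂_apply,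
    shStep_cons b _ a x hb (ha.cons hx), A.brHead_apply hb hx, cons_add, consL_apply]
  abel

end ShiftedOps

end GInfinity

end

/-! ### Symmetry and associativity of shuffles; the bracket as a derivation -/

open scoped TensorProduct

noncomputable section

namespace GInfinity

open SuperModule TensorInstances

section Words

variable {V : Type*} [AddCommGroup V] [Module ℝ V] [SuperModule V]

/-- Exchanging the words exchanges the two cases of the recursion, so a nested induction on both
words suffices. -/
theorem sh_comm {p q : ZMod 2} {x y : TensorAlgebra ℝ V} (hx : HasParity p x)
    (hy : HasParity q y) : sh x y = sg (p * q) • sh y x := by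
  revert q y
  refine HasParity.induction (C := fun p x => ∀ {q y}, HasParity q y →
    sh x y = sg (p * q) • sh y x) ?_ ?_ ?_ ?_ ?_ hx
  · intros; simp
  · intro p x x' h h' q y hy
    simp only [map_add, LinearMap.add_apply, h hy, h' hy, smul_add]
  · intro p c x h q y hy
    simp only [map_smul, LinearMap.smul_apply, h hy, smul_comm c]
  · intro q y hy
    simp [one_sh, sh_one, sg_zero]
  · intro p q a x ha hx ih r y hy
    refine HasParity.induction (C := fun r y =>
      sh (cons a x) y = sg ((p + q) * r) • sh y (cons a x)) ?_ ?_ ?_ ?_ ?_ hy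
    · intros; simp
    · intro r y y' h h'
      simp only [map_add, LinearMap.add_apply, h, h', smul_add]
    · intro p c x h
      simp only [map_smul, LinearMap.smul_apply, h, smul_comm c]
    · simp [one_sh, sh_one, sg_zero]
    · intro r s b y hb hy ih2
      rw [cons_sh_cons ha hx hb, cons_sh_cons hb hy ha, ih (hb.cons hy), ih2]
      simp only [cons_smul]
      -- Both sides are combinations of the same tensors. Comparing coefficients leaves identities
      -- between signs, which are decided by running through all parities; the same device closes
      -- most sign computations below.
      match_scalars
      all_goals
        simp only [sg]; norm_cast; clear * -; revert p q r s; decide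

/-- Both sides satisfy one recursion with three cases, according to which of the three words
supplies the first letter; the three induction hypotheses are the cases. -/
theorem sh_assoc {p q r : ZMod 2} {x y z : TensorAlgebra ℝ V} (hx : HasParity p x)
    (hy : HasParity q y) (hz : HasParity r z) : sh (sh x y) z = sh x (sh y z) := by
  revert r z
  revert q y
  refine HasParity.induction (C := fun p x => ∀ {q y}, HasParity q y → ∀ {r z}, HasParity r z →
    sh (sh x y) z = sh x (sh y z)) ?_ ?_ ?_ ?_ ?_ hx
  · intros; simp
  · intro p x x' h h' q y hy r z hz
    simp only [map_add, LinearMap.add_apply, h hy hz, h' hy hz]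
  · intro p c x h q y hy r z hz
    simp only [map_smul, LinearMap.smul_apply, h hy hz]
  · intros; rw [one_sh, one_sh]
  intro p p' a x ha hx ihx q y hy
  refine HasParity.induction (C := fun q y => ∀ {r z}, HasParity r z →
    sh (sh (cons a x) y) z = sh (cons a x) (sh y z)) ?_ ?_ ?_ ?_ ?_ hy
  · intros; simp
  · intro q y y' h h' r z hz
    simp only [map_add, LinearMap.add_apply, h hz, h' hz]
  · intro q c y h r z hz
    simp only [map_smul, LinearMap.smul_apply, h hz]
  · intros; rw [sh_one, one_sh]
  intro q q' b y hb hy ihy r z hz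
  refine HasParity.induction (C := fun r z =>
    sh (sh (cons a x) (cons b y)) z = sh (cons a x) (sh (cons b y) z)) ?_ ?_ ?_ ?_ ?_ hz
  · intros; simp
  · intro r z z' h h'
    simp only [map_add, h, h']
  · intro r c z h
    simp only [map_smul, h]
  · rw [sh_one, sh_one]
  intro r r' c z hc hz ihz
  have h1 := congrArg (cons a) (ihx (hb.cons hy) (hc.cons hz))
  have h2 := congrArg (cons b) (ihy (hc.cons hz))
  have h3 := congrArg (cons c) ihz
  rw [cons_sh_cons hb hy hc] at h1
  rw [cons_sh_cons ha hx hb] at h3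
  rw [cons_sh_cons ha hx hb, cons_sh_cons hb hy hc]
  simp only [map_add, map_smul, LinearMap.add_apply, LinearMap.smul_apply, cons_add, cons_smul]
    at h1 h3 ⊢
  rw [cons_sh_cons ha (hx.sh (hb.cons hy)) hc, cons_sh_cons hb ((ha.cons hx).sh hy) hc,
    cons_sh_cons ha hx hb, cons_sh_cons ha hx hc]
  linear_combination (norm := skip) h1 + sg (q * (p + p')) • h2 +
    sg (r * (p + p' + q + q')) • h3
  match_scalars
  all_goals first
    | ring1
    | simp only [sg]; norm_cast; clear * - p p' q q' r r'; revert p p' q q' r r'; decide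

end Words

namespace ShiftedOps

variable {V : Type*} [AddCommGroup V] [Module ℝ V] [SuperModule V] (A : ShiftedOps V)

theorem phi_parity {p q : ZMod 2} {a : V} {t : TensorAlgebra ℝ V} (ha : HasParity p a)
    (ht : HasParity q t) : HasParity (p + q + 1) (A.phi a t) := by
  refine HasParity.induction (C := fun q t => HasParity (p + q + 1) (A.phi a t)) ?_ ?_ ?_ ?_ ?_ ht
  · intro q; rw [map_zero]; exact HasParity.zero _
  · intro q x y h h'; rw [map_add]; exact h.add h'
  · intro q c x h; rw [map_smul]; exact h.smul c
  · rw [phi_one]; exact HasParity.zero _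
  · intro q r b t hb ht _
    rw [phi_cons]
    exact ((A.mm_parity ha hb).cons ht).congr (by ring)

theorem M_parity {q : ZMod 2} {t : TensorAlgebra ℝ V} (ht : HasParity q t) :
    HasParity (q + 1) (A.M t) := by
  refine HasParity.induction (C := fun q t => HasParity (q + 1) (A.M t)) ?_ ?_ ?_ ?_ ?_ ht
  · intro q; rw [map_zero]; exact HasParity.zero _
  · intro q x y h h'; rw [map_add]; exact h.add h'
  · intro q c x h; rw [map_smul]; exact h.smul c
  · rw [M_one]; exact HasParity.zero _
  · intro q r b t hb ht ih
    rw [A.M_cons hb]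
    exact (A.phi_parity hb ht).add (((hb.cons ih).smul _).congr (by ring))

theorem B_parity {p q : ZMod 2} {x y : TensorAlgebra ℝ V} (hx : HasParity p x)
    (hy : HasParity q y) : HasParity (p + q) (A.B x y) := by
  revert q y
  refine HasParity.induction (C := fun p x => ∀ {q y}, HasParity q y →
    HasParity (p + q) (A.B x y)) ?_ ?_ ?_ ?_ ?_ hx
  · intro p q y _; simpa using HasParity.zero _
  · intro p x y h1 h2 q z hz
    rw [map_add, LinearMap.add_apply]
    exact (h1 hz).add (h2 hz)
  · intro p c x h q z hz
    rw [map_smul, LinearMap.smul_apply]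
    exact (h hz).smul c
  · intro q y hy
    rw [one_B]; exact HasParity.zero _
  · intro p q a x ha hx ih r y hy
    refine HasParity.induction (C := fun r y =>
      HasParity (p + q + r) (A.B (GInfinity.cons a x) y)) ?_ ?_ ?_ ?_ ?_ hy
    · intro r; simpa using HasParity.zero _
    · intro r y z h1 h2; rw [map_add]; exact h1.add h2
    · intro r c y h; rw [map_smul]; exact h.smul c
    · rw [B_one]; exact HasParity.zero _
    · intro r s b y hb hy ih2
      rw [A.B_cons ha hx hb]
      refine ((HasParity.smul _ ?_).add ?_).add (HasParity.smul _ ?_)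
      · exact ((A.br_parity ha hb).cons (hx.sh hy)).congr (by ring)
      · exact (ha.cons (ih (hb.cons hy))).congr (by ring)
      · exact (hb.cons ih2).congr (by ring)

/-- The exchange swaps the two cases in which a single letter stands in front; the case with `[a,b]`
in front needs antisymmetry on letters and commutativity of the shuffle of the remainders. -/
theorem B_anti {p q : ZMod 2} {x y : TensorAlgebra ℝ V} (hx : HasParity p x)
    (hy : HasParity q y) : A.B x y = -(sg (p * q) • A.B y x) := by
  revert q y
  refine HasParity.induction (C := fun p x => ∀ {q y}, HasParity q y →
    A.B x y = -(sg (p * q) • A.B y x)) ?_ ?_ ?_ ?_ ?_ hx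
  · intros; simp
  · intro p x x' h h' q y hy
    simp only [map_add, LinearMap.add_apply, h hy, h' hy, smul_add, neg_add]
  · intro p c x h q y hy
    simp only [map_smul, LinearMap.smul_apply, h hy, smul_comm c, smul_neg]
  · intro q y hy
    simp [one_B, B_one]
  intro p q a x ha hx ih r y hy
  refine HasParity.induction (C := fun r y =>
    A.B (cons a x) y = -(sg ((p + q) * r) • A.B y (cons a x))) ?_ ?_ ?_ ?_ ?_ hy
  · intros; simp
  · intro r y y' h h'
    simp only [map_add, LinearMap.add_apply, h, h', smul_add, neg_add]
  · intro p c x h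
    simp only [map_smul, LinearMap.smul_apply, h, smul_comm c, smul_neg]
  · simp [one_B, B_one]
  intro r s b y hb hy ih2
  rw [A.B_cons ha hx hb, A.B_cons hb hy ha, ih (hb.cons hy), ih2, A.br_anti ha hb, sh_comm hx hy,
    ← neg_one_smul ℝ (sg (p * r) • _), ← neg_one_smul ℝ (sg (q * (r + s)) • _),
    ← neg_one_smul ℝ (sg ((p + q) * s) • _)]
  simp only [cons_smul, smul_cons]
  match_scalars
  all_goals first
    | ring1
    | simp only [sg]; norm_cast; clear * - p q r s; revert p q r s; decide

/-- A letter of `z` is bracketed with a letter of `x` or with a letter of `y`, and the other word is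
merely shuffled in. In the induction, terms with an unbracketed first letter are covered by the
hypotheses, and those starting with a bracket by associativity and commutativity of the shuffle
product. -/
theorem B_sh {p q r : ZMod 2} {x y z : TensorAlgebra ℝ V} (hx : HasParity p x)
    (hy : HasParity q y) (hz : HasParity r z) :
    A.B (sh x y) z = sh x (A.B y z) + sg (q * r) • sh (A.B x z) y := by
  revert r z
  revert q y
  refine HasParity.induction (C := fun p x => ∀ {q y}, HasParity q y → ∀ {r z}, HasParity r z →
    A.B (sh x y) z = sh x (A.B y z) + sg (q * r) • sh (A.B x z) y) ?_ ?_ ?_ ?_ ?_ hx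
  · intros; simp
  · intro p x x' h h' q y hy r z hz
    simp only [map_add, LinearMap.add_apply, h hy hz, h' hy hz]
    module
  · intro p c x h q y hy r z hz
    simp only [map_smul, LinearMap.smul_apply, h hy hz]
    module
  · intros; rw [one_sh, one_sh, one_B]; simp
  intro p p' a x ha hx ihx q y hy
  refine HasParity.induction (C := fun q y => ∀ {r z}, HasParity r z →
    A.B (sh (cons a x) y) z = sh (cons a x) (A.B y z) + sg (q * r) • sh (A.B (cons a x) z) y)
    ?_ ?_ ?_ ?_ ?_ hy
  · intros; simp
  · intro q y y' h h' r z hz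
    simp only [map_add, LinearMap.add_apply, h hz, h' hz]
    module
  · intro q c y h r z hz
    simp only [map_smul, LinearMap.smul_apply, h hz]
    module
  · intros; rw [sh_one, sh_one, one_B]; simp [sg_zero]
  intro q q' b y hb hy ihy r z hz
  refine HasParity.induction (C := fun r z =>
    A.B (sh (cons a x) (cons b y)) z = sh (cons a x) (A.B (cons b y) z) +
      sg ((q + q') * r) • sh (A.B (cons a x) z) (cons b y)) ?_ ?_ ?_ ?_ ?_ hz
  · intros; simp
  · intro r z z' h h'
    simp only [map_add, h, h', LinearMap.add_apply]
    module
  · intro r c z h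
    simp only [map_smul, h, LinearMap.smul_apply]
    module
  · simp [B_one]
  intro r r' c z hc hz ihz
  have h1 := congrArg (cons a) (ihx (hb.cons hy) (hc.cons hz))
  have h2 := congrArg (cons b) (ihy (hc.cons hz))
  have h3 := congrArg (cons c) ihz
  -- After an initial `[a,c]` or `[b,c]` there remain triple shuffles, parenthesized and ordered
  -- differently on the two sides; `h4`, `h5` and `h6` identify them.
  have h4 := congrArg (cons (A.br a c)) (sh_assoc hx (hb.cons hy) hz)
  have h5 := congrArg (cons (A.br b c)) (sh_assoc (ha.cons hx) hy hz)
  have h6 := congrArg (cons (A.br a c)) (sh_assoc hx hz (hb.cons hy))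
  rw [sh_comm (hb.cons hy) hz] at h4
  rw [A.B_cons hb hy hc] at h1
  rw [A.B_cons ha hx hc] at h2
  rw [cons_sh_cons ha hx hb] at h3
  rw [cons_sh_cons ha hx hb, A.B_cons hb hy hc, A.B_cons ha hx hc]
  simp only [map_add, map_smul, LinearMap.add_apply, LinearMap.smul_apply, cons_add, cons_smul]
    at h1 h2 h3 h4 ⊢
  have hbc := A.br_parity hb hc
  have hac := A.br_parity ha hc
  rw [A.B_cons ha (hx.sh (hb.cons hy)) hc, A.B_cons hb ((ha.cons hx).sh hy) hc,
    cons_sh_cons ha hx hbc, cons_sh_cons ha hx hb, cons_sh_cons ha hx hc,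
    cons_sh_cons hac (hx.sh hz) hb, cons_sh_cons ha (A.B_parity hx (hc.cons hz)) hb,
    cons_sh_cons hc (A.B_parity (ha.cons hx) hz) hb]
  linear_combination (norm := skip) h1 + sg (q * (p + p')) • h2 +
    sg (r * (p + p' + q + q')) • h3 + sg (r * (p' + q + q')) • h4 +
    (sg (q * (p + p')) * sg (r * (p + p' + q'))) • h5 -
    (sg (r * (p' + q + q')) * sg ((q + q') * r')) • h6
  match_scalars
  all_goals first
    | ring1
    | simp only [sg]; norm_cast; clear * - p p' q q' r r'; revert p p' q q' r r'; decide

end ShiftedOps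

end GInfinity

end

/-! ### The product as a derivation of shuffles; associativity and Jacobi on words -/

open scoped TensorProduct

noncomputable section

namespace GInfinity

open SuperModule TensorInstances

namespace ShiftedOps

variable {V : Type*} [AddCommGroup V] [Module ℝ V] [SuperModule V] (A : ShiftedOps V)

/-- The letter `a` is contracted with the first letter of a shuffle of `x` and `by`. If that letter
comes from `x`, the result is a term of the shuffle of `A.phi a x` with `by` not starting with `b`,
whence the subtraction; otherwise `a` meets `b`. -/
theorem phi_sh_cons {p q r : ZMod 2} {a b : V} {x y : TensorAlgebra ℝ V} (ha : HasParity p a)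
    (hx : HasParity q x) (hb : HasParity r b) :
    A.phi a (sh x (cons b y)) = sh (A.phi a x) (cons b y)
      - sg (r * (p + q + 1)) • cons b (sh (A.phi a x) y)
      + sg (r * q) • cons (A.mm a b) (sh x y) := by
  refine HasParity.induction (C := fun q x => A.phi a (sh x (cons b y)) =
      sh (A.phi a x) (cons b y) - sg (r * (p + q + 1)) • cons b (sh (A.phi a x) y)
      + sg (r * q) • cons (A.mm a b) (sh x y)) ?_ ?_ ?_ ?_ ?_ hx
  · intros; simp [cons_zero]
  · intro q x x' h h'
    simp only [map_add, LinearMap.add_apply, h, h', cons_add]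
    module
  · intro q c x h
    simp only [map_smul, LinearMap.smul_apply, h, cons_smul]
    module
  · simp [one_sh, phi_one, phi_cons, cons_zero, sg_zero]
  · intro q q' c x hc hx _
    have hac := A.mm_parity ha hc
    rw [cons_sh_cons hc hx hb, map_add, map_smul, phi_cons, phi_cons, phi_cons,
      cons_sh_cons hac hx hb]
    match_scalars
    all_goals first
      | ring1
      | simp only [sg]; norm_cast; clear * - p q q' r; revert p q q' r; decide

/-- Contractions of two letters of the same word give the right side. A letter `a` of `x` and a
letter `b` of `y` are contracted once as `m(a,b)` and once as `m(b,a)`, and these cancel by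
antisymmetry of the shifted product. -/
theorem M_sh {p q : ZMod 2} {x y : TensorAlgebra ℝ V} (hx : HasParity p x)
    (hy : HasParity q y) : A.M (sh x y) = sh (A.M x) y + sg p • sh x (A.M y) := by
  revert q y
  refine HasParity.induction (C := fun p x => ∀ {q y}, HasParity q y →
    A.M (sh x y) = sh (A.M x) y + sg p • sh x (A.M y)) ?_ ?_ ?_ ?_ ?_ hx
  · intros; simp
  · intro p x x' h h' q y hy
    simp only [map_add, LinearMap.add_apply, h hy, h' hy]
    module
  · intro p c x h q y hy
    simp only [map_smul, LinearMap.smul_apply, h hy]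
    module
  · intro q y hy
    simp [one_sh, M_one, sg_zero]
  intro p p' a x ha hx ihx q y hy
  refine HasParity.induction (C := fun q y =>
    A.M (sh (cons a x) y) = sh (A.M (cons a x)) y + sg (p + p') • sh (cons a x) (A.M y))
    ?_ ?_ ?_ ?_ ?_ hy
  · intros; simp
  · intro r y y' h h'
    simp only [map_add, h, h']
    module
  · intro p c x h
    simp only [map_smul, h]
    module
  · simp [sh_one, M_one]
  intro q q' b y hb hy ihy
  have h1 := congrArg (cons a) (ihx (hb.cons hy))
  have h2 := congrArg (cons b) ihy
  have h3 := A.phi_sh_cons (y := y) ha hx hb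
  -- The same formula with the two words exchanged, then rewritten in the order `x`, `y`. Here
  -- `m(b,a)` turns into a multiple of `m(a,b)` and cancels the corresponding term of `h3`.
  have h4 := A.phi_sh_cons (y := x) hb hy ha
  rw [sh_comm hy (ha.cons hx), sh_comm (A.phi_parity hb hy) (ha.cons hx),
    sh_comm (A.phi_parity hb hy) hx, sh_comm hy hx, A.mm_anti hb ha,
    ← neg_one_smul ℝ (sg (q * p) • _), smul_smul] at h4
  rw [A.M_cons hb] at h1
  rw [A.M_cons ha] at h2
  rw [cons_sh_cons ha hx hb, A.M_cons ha, A.M_cons hb, map_add, map_smul, A.M_cons ha, A.M_cons hb]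
  simp only [map_add, map_smul, LinearMap.add_apply, LinearMap.smul_apply, cons_add, cons_smul,
    smul_cons] at h1 h2 h3 h4 ⊢
  rw [cons_sh_cons ha (A.M_parity hx) hb, cons_sh_cons ha hx hb]
  linear_combination (norm := skip) sg p • h1 + (sg (q * (p + p')) * sg q) • h2 + h3 +
    (sg (q * (p + p')) * sg ((p + p') * q')) • h4
  match_scalars
  all_goals first
    | ring1
    | simp only [sg]; norm_cast; clear * - p p' q q'; revert p p' q q'; decide

/-- Associativity concerns only overlapping contractions, that is, the first three letters (`key`);
the contraction of `a` with its neighbour and the contractions further to the right cancel by sign.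
-/
theorem M_phi (h : ∀ {p q r : ZMod 2} {a b c : V}, HasParity p a → HasParity q b → HasParity r c →
    A.mm (A.mm a b) c + sg p • A.mm a (A.mm b c) = 0) {p q : ZMod 2} {a : V}
    {x : TensorAlgebra ℝ V} (ha : HasParity p a) (hx : HasParity q x) :
    A.M (A.phi a x) + sg p • A.phi a (A.M x) = 0 := by
  refine HasParity.induction (C := fun q x => A.M (A.phi a x) + sg p • A.phi a (A.M x) = 0)
    ?_ ?_ ?_ ?_ ?_ hx
  · intros; simp
  · intro q x y h h'
    simp only [map_add]
    linear_combination (norm := module) h + h'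
  · intro q c x h
    simp only [map_smul]
    linear_combination (norm := module) c • h
  · simp [phi_one, M_one]
  intro q r b y hb hy _
  rw [phi_cons, A.M_cons hb, A.M_cons (A.mm_parity ha hb), map_add, map_smul, phi_cons]
  have key : A.phi (A.mm a b) y + sg p • A.phi a (A.phi b y) = 0 := by
    refine HasParity.induction (C := fun _ y =>
      A.phi (A.mm a b) y + sg p • A.phi a (A.phi b y) = 0) ?_ ?_ ?_ ?_ ?_ hy
    · intros; simp
    · intro q x y h h'
      simp only [map_add]
      linear_combination (norm := module) h + h'
    · intro q c x h
      simp only [map_smul]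
      linear_combination (norm := module) c • h
    · simp [phi_one]
    · intro r s c z hc _ _
      rw [phi_cons, phi_cons, phi_cons, ← smul_cons, ← add_cons, h ha hb hc, zero_cons]
  linear_combination (norm := skip) key
  match_scalars
  all_goals first
    | ring1
    | simp only [sg]; norm_cast; clear * - p q; revert p q; decide

theorem M_sq (h : ∀ {p q r : ZMod 2} {a b c : V}, HasParity p a → HasParity q b → HasParity r c →
    A.mm (A.mm a b) c + sg p • A.mm a (A.mm b c) = 0) {q : ZMod 2}
    {x : TensorAlgebra ℝ V} (hx : HasParity q x) : A.M (A.M x) = 0 := by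
  refine HasParity.induction (C := fun _ x => A.M (A.M x) = 0) ?_ ?_ ?_ ?_ ?_ hx
  · intros; simp
  · intro q x y h h'
    simp only [map_add, h, h', add_zero]
  · intro q c x h
    simp only [map_smul, h, smul_zero]
  · simp [M_one]
  · intro q r a y ha hy ih
    rw [A.M_cons ha, map_add, map_smul, A.M_cons ha, ih, cons_zero, smul_zero, add_zero]
    exact A.M_phi h ha hy

/-- Sort the terms by their beginning. Those with an unbracketed first letter vanish by induction.
Those with a double bracket in front share one triple shuffle as remainder, so they vanish by Jacobi
for letters. Those with a simple bracket in front cancel because `B` is a derivation of shuffles. -/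
theorem B_jacobi (h : ∀ {p q r : ZMod 2} {a b c : V}, HasParity p a → HasParity q b →
    HasParity r c → sg (p * r) • A.br (A.br a b) c + sg (q * p) • A.br (A.br b c) a
      + sg (r * q) • A.br (A.br c a) b = 0) {p q r : ZMod 2}
    {x y z : TensorAlgebra ℝ V} (hx : HasParity p x) (hy : HasParity q y) (hz : HasParity r z) :
    sg (p * r) • A.B (A.B x y) z + sg (q * p) • A.B (A.B y z) x
      + sg (r * q) • A.B (A.B z x) y = 0 := by
  revert r z
  revert q y
  refine HasParity.induction (C := fun p x => ∀ {q y}, HasParity q y → ∀ {r z}, HasParity r z →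
    sg (p * r) • A.B (A.B x y) z + sg (q * p) • A.B (A.B y z) x
      + sg (r * q) • A.B (A.B z x) y = 0) ?_ ?_ ?_ ?_ ?_ hx
  · intros; simp
  · intro p x x' h h' q y hy r z hz
    simp only [map_add, LinearMap.add_apply]
    linear_combination (norm := module) h hy hz + h' hy hz
  · intro p c x h q y hy r z hz
    simp only [map_smul, LinearMap.smul_apply]
    linear_combination (norm := module) c • h hy hz
  · intros; simp [one_B, B_one]
  intro p p' a x ha hx ihx q y hy
  refine HasParity.induction (C := fun q y => ∀ {r z}, HasParity r z →
    sg ((p + p') * r) • A.B (A.B (cons a x) y) z + sg (q * (p + p')) • A.B (A.B y z) (cons a x)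
      + sg (r * q) • A.B (A.B z (cons a x)) y = 0) ?_ ?_ ?_ ?_ ?_ hy
  · intros; simp
  · intro q y y' h h' r z hz
    simp only [map_add, LinearMap.add_apply]
    linear_combination (norm := module) h hz + h' hz
  · intro q c y h r z hz
    simp only [map_smul, LinearMap.smul_apply]
    linear_combination (norm := module) c • h hz
  · intros; simp [one_B, B_one]
  intro q q' b y hb hy ihy r z hz
  refine HasParity.induction (C := fun r z =>
    sg ((p + p') * r) • A.B (A.B (cons a x) (cons b y)) z
      + sg ((q + q') * (p + p')) • A.B (A.B (cons b y) z) (cons a x)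
      + sg (r * (q + q')) • A.B (A.B z (cons a x)) (cons b y) = 0) ?_ ?_ ?_ ?_ ?_ hz
  · intros; simp
  · intro r z z' h h'
    simp only [map_add, LinearMap.add_apply]
    linear_combination (norm := module) h + h'
  · intro r c z h
    simp only [map_smul, LinearMap.smul_apply]
    linear_combination (norm := module) c • h
  · simp [one_B, B_one]
  intro r r' c z hc hz ihz
  have hax := ha.cons hx
  have hby := hb.cons hy
  have hcz := hc.cons hz
  have hab := A.br_parity ha hb
  have hbc := A.br_parity hb hc
  have hca := A.br_parity hc ha
  have h1 := congrArg (cons a) (ihx hby hcz)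
  have h2 := congrArg (cons b) (ihy hcz)
  have h3 := congrArg (cons c) ihz
  have h4 := congrArg (cons (A.br a b)) (A.B_sh hx hy hcz)
  have h5 := congrArg (cons (A.br b c)) (A.B_sh hy hz hax)
  have h6 := congrArg (cons (A.br c a)) (A.B_sh hz hx hby)
  have h7 := congrArg (fun v => cons v (sh (sh x y) z)) (h ha hb hc)
  -- The three cyclic orders of the triple shuffle are brought to the single order used in `h7`.
  have s1 : sh (sh y z) x = sg (p' * (q' + r')) • sh (sh x y) z := by
    rw [sh_assoc hx hy hz, sh_comm hx (hy.sh hz), sg_smul_sg_smul]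
  have s2 : sh (sh z x) y = sg (r' * (p' + q')) • sh (sh x y) z := by
    rw [sh_assoc hz hx hy, sh_comm hz (hx.sh hy)]
  have t4 : sh (A.B y (cons c z)) x = _ := sh_comm (A.B_parity hy hcz) hx
  have t5 : sh (A.B z (cons a x)) y = _ := sh_comm (A.B_parity hz hax) hy
  have t6 : sh (A.B x (cons b y)) z = _ := sh_comm (A.B_parity hx hby) hz
  have u4 : sh (A.B (cons c z) x) y = -(sg ((r + r') * p') • sh (A.B x (cons c z)) y) := by
    rw [A.B_anti hcz hx]; simp
  have u5 : sh (A.B (cons a x) y) z = -(sg ((p + p') * q') • sh (A.B y (cons a x)) z) := by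
    rw [A.B_anti hax hy]; simp
  have u6 : sh (A.B (cons b y) z) x = -(sg ((q + q') * r') • sh (A.B z (cons b y)) x) := by
    rw [A.B_anti hby hz]; simp
  rw [A.B_cons hb hy hc] at h1
  rw [A.B_cons hc hz ha] at h2
  rw [A.B_cons ha hx hb] at h3
  rw [A.B_cons ha hx hb, A.B_cons hb hy hc, A.B_cons hc hz ha]
  simp only [map_add, map_smul, LinearMap.add_apply, LinearMap.smul_apply, cons_add, cons_smul,
    smul_cons, add_cons, zero_cons, cons_zero] at h1 h2 h3 h4 h5 h6 h7 ⊢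
  rw [A.B_cons hab (hx.sh hy) hc, A.B_cons ha (A.B_parity hx hby) hc,
    A.B_cons hb (A.B_parity hax hy) hc,
    A.B_cons hbc (hy.sh hz) ha, A.B_cons hb (A.B_parity hy hcz) ha,
    A.B_cons hc (A.B_parity hby hz) ha,
    A.B_cons hca (hz.sh hx) hb, A.B_cons hc (A.B_parity hz hax) hb,
    A.B_cons ha (A.B_parity hcz hx) hb,
    u4, u5, u6, t4, t5, t6, s1, s2, A.br_anti hb ha, A.br_anti hc hb, A.br_anti ha hc]
  simp only [← neg_one_smul ℝ (_ : TensorAlgebra ℝ V), ← neg_one_smul ℝ (_ : V), cons_smul,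
    smul_cons]
  linear_combination (norm := skip)
    (sg ((p + p') * (r + r')) * sg (p' * (r + r'))) • h1 +
    (sg ((q + q') * (p + p')) * sg (q' * (p + p'))) • h2 +
    (sg ((r + r') * (q + q')) * sg (r' * (q + q'))) • h3 +
    (sg ((p + p') * (r + r')) * sg (q * p')) • h4 +
    (sg ((q + q') * (p + p')) * sg (r * q')) • h5 +
    (sg ((r + r') * (q + q')) * sg (p * r')) • h6 +
    (sg ((p + p') * (r + r')) * sg (q * p') * sg (r * (p' + q')) * sg (p * r)) • h7
  match_scalars
  all_goals first
    | ring1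
    | simp only [sg]; norm_cast; clear * - p p' q q' r r'; revert p p' q q' r r'; decide

end ShiftedOps

end GInfinity

end

/-! ### The Leibniz rule on words -/

open scoped TensorProduct

noncomputable section

namespace GInfinity

open SuperModule TensorInstances

namespace ShiftedOps

variable {V : Type*} [AddCommGroup V] [Module ℝ V] [SuperModule V] (A : ShiftedOps V)

/-- The part of `M_B` concerning the first two letters. The left side contracts them after
bracketing; the right side contracts `a` or `b` with its successor before bracketing, and the
subtracted terms are those in which the letter of the other word stays in front. Contractions of `a`
with `b` cancel by antisymmetry, and the rest is the Leibniz rule for letters. -/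
theorem phi_B (h : ∀ {p q r : ZMod 2} {a b c : V}, HasParity p a → HasParity q b → HasParity r c →
    A.br (A.mm a b) c = A.mm a (A.br b c) + sg (q * r) • A.mm (A.br a c) b) {p p' q q' : ZMod 2}
    {a b : V} {x y : TensorAlgebra ℝ V} (ha : HasParity p a) (hx : HasParity p' x)
    (hb : HasParity q b) (hy : HasParity q' y) :
    sg (q * p') • A.phi (A.br a b) (sh x y) + A.phi a (A.B x (cons b y))
      + sg (q * (p + p')) • A.phi b (A.B (cons a x) y)
    = A.B (A.phi a x) (cons b y) - sg (q * (p + p' + 1)) • cons b (A.B (A.phi a x) y)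
      + sg (p + p') • A.B (cons a x) (A.phi b y) - sg (p + p') • cons a (A.B x (A.phi b y)) := by
  -- The Leibniz rule in the second argument of the bracket, obtained from the hypothesis by
  -- antisymmetry; it is needed when the contracted pair lies in the right word.
  have key : ∀ {t : ZMod 2} {d : V}, HasParity t d → A.br a (A.mm b d) =
      sg (p * (q + 1)) • (A.mm b (A.br a d)) + sg p • A.mm (A.br a b) d := by
    intro t d hd
    rw [A.br_anti ha (A.mm_parity hb hd), h hb hd ha, A.br_anti hd ha, A.br_anti hb ha,
      ← neg_one_smul ℝ (_ : V), ← neg_one_smul ℝ (_ : V), ← neg_one_smul ℝ (_ : V)]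
    simp only [map_smul, LinearMap.smul_apply]
    match_scalars
    all_goals first
      | ring1
      | simp only [sg]; norm_cast; clear * - p q t; revert p q t; decide
  -- Contraction looks one letter ahead, so it matters whether `x` and `y` are empty. Only this case
  -- distinction is needed: the hypotheses for shorter words are not used.
  refine HasParity.induction (C := fun p' x =>
    sg (q * p') • A.phi (A.br a b) (sh x y) + A.phi a (A.B x (cons b y))
      + sg (q * (p + p')) • A.phi b (A.B (cons a x) y)
    = A.B (A.phi a x) (cons b y) - sg (q * (p + p' + 1)) • cons b (A.B (A.phi a x) y)
      + sg (p + p') • A.B (cons a x) (A.phi b y) - sg (p + p') • cons a (A.B x (A.phi b y)))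
    ?_ ?_ ?_ ?_ ?_ hx
  · intros; simp [cons_zero]
  · intro r x x' h h'
    simp only [map_add, LinearMap.add_apply, cons_add]
    linear_combination (norm := module) h + h'
  · intro r c x h
    simp only [map_smul, LinearMap.smul_apply, cons_smul]
    linear_combination (norm := module) c • h
  · refine HasParity.induction (C := fun _ y =>
      sg (q * 0) • A.phi (A.br a b) (sh 1 y) + A.phi a (A.B 1 (cons b y))
        + sg (q * (p + 0)) • A.phi b (A.B (cons a 1) y)
      = A.B (A.phi a 1) (cons b y) - sg (q * (p + 0 + 1)) • cons b (A.B (A.phi a 1) y)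
        + sg (p + 0) • A.B (cons a 1) (A.phi b y) - sg (p + 0) • cons a (A.B 1 (A.phi b y)))
      ?_ ?_ ?_ ?_ ?_ hy
    · intros; simp [cons_zero]
    · intro r x x' h h'
      simp only [map_add, cons_add]
      linear_combination (norm := module) h + h'
    · intro r c x h
      simp only [map_smul, cons_smul]
      linear_combination (norm := module) c • h
    · simp [one_B, B_one, phi_one, sh_one, cons_zero]
    · intro t t' d y hd hy _
      rw [A.B_cons ha HasParity.one hd]
      simp only [phi_one, map_zero, LinearMap.zero_apply, one_sh, one_B, cons_zero, phi_cons,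
        map_add, map_smul, smul_zero]
      rw [A.B_cons ha HasParity.one (A.mm_parity hb hd), key hd, A.mm_anti hb hd]
      simp only [one_B, cons_zero, one_sh, add_cons, smul_cons, ← neg_one_smul ℝ (_ : V)]
      match_scalars
      all_goals first
        | ring1
        | simp only [sg]; norm_cast; clear * - p q t; revert p q t; decide
  intro s s' c x hc hx _
  have key2 := h ha hc hb
  refine HasParity.induction (C := fun _ y =>
    sg (q * (s + s')) • A.phi (A.br a b) (sh (cons c x) y) + A.phi a (A.B (cons c x) (cons b y))
      + sg (q * (p + (s + s'))) • A.phi b (A.B (cons a (cons c x)) y)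
    = A.B (A.phi a (cons c x)) (cons b y)
      - sg (q * (p + (s + s') + 1)) • cons b (A.B (A.phi a (cons c x)) y)
      + sg (p + (s + s')) • A.B (cons a (cons c x)) (A.phi b y)
      - sg (p + (s + s')) • cons a (A.B (cons c x) (A.phi b y)))
    ?_ ?_ ?_ ?_ ?_ hy
  · intros; simp [cons_zero]
  · intro r x x' h h'
    simp only [map_add, cons_add]
    linear_combination (norm := module) h + h'
  · intro r c x h
    simp only [map_smul, cons_smul]
    linear_combination (norm := module) c • h
  · rw [A.B_cons hc hx hb]
    simp only [B_one, phi_one, sh_one, map_zero, phi_cons, map_add, map_smul, cons_zero, smul_zero]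
    rw [A.B_cons (A.mm_parity ha hc) hx hb, key2]
    simp only [B_one, sh_one, add_cons, smul_cons, cons_zero]
    match_scalars
    all_goals first
      | ring1
      | simp only [sg]; norm_cast; clear * - p q s s'; revert p q s s'; decide
  · intro t t' d y hd hy _
    rw [A.B_cons hc hx hb, A.B_cons ha (hc.cons hx) hd, cons_sh_cons hc hx hd]
    simp only [phi_cons, map_add, map_smul]
    rw [A.B_cons (A.mm_parity ha hc) hx hb, key2, A.B_cons ha (hc.cons hx) (A.mm_parity hb hd),
      key hd, A.mm_anti hb ha]
    simp only [add_cons, smul_cons, ← neg_one_smul ℝ (_ : V)]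
    match_scalars
    all_goals first
      | ring1
      | simp only [sg]; norm_cast; clear * - p q s s' t; revert p q s s' t; decide

/-- Terms in which `a` or `b` stays in front follow by induction, terms with `[a,b]` kept in front
from `M_sh` for the remainders, and contractions of the first two letters are `phi_B`. -/
theorem M_B (h : ∀ {p q r : ZMod 2} {a b c : V}, HasParity p a → HasParity q b → HasParity r c →
    A.br (A.mm a b) c = A.mm a (A.br b c) + sg (q * r) • A.mm (A.br a c) b) {p q : ZMod 2}
    {x y : TensorAlgebra ℝ V} (hx : HasParity p x) (hy : HasParity q y) :
    A.M (A.B x y) = A.B (A.M x) y + sg p • A.B x (A.M y) := by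
  revert q y
  refine HasParity.induction (C := fun p x => ∀ {q y}, HasParity q y →
    A.M (A.B x y) = A.B (A.M x) y + sg p • A.B x (A.M y)) ?_ ?_ ?_ ?_ ?_ hx
  · intros; simp
  · intro p x x' h h' q y hy
    simp only [map_add, LinearMap.add_apply, h hy, h' hy]
    module
  · intro p c x h q y hy
    simp only [map_smul, LinearMap.smul_apply, h hy]
    module
  · intro q y hy
    simp [one_B, M_one]
  intro p p' a x ha hx ihx q y hy
  refine HasParity.induction (C := fun q y =>
    A.M (A.B (cons a x) y) = A.B (A.M (cons a x)) y + sg (p + p') • A.B (cons a x) (A.M y))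
    ?_ ?_ ?_ ?_ ?_ hy
  · intros; simp
  · intro r y y' h h'
    simp only [map_add, h, h']
    module
  · intro p c x h
    simp only [map_smul, h]
    module
  · simp [B_one, M_one]
  intro q q' b y hb hy ihy
  have hab := A.br_parity ha hb
  have h1 := congrArg (cons a) (ihx (hb.cons hy))
  have h2 := congrArg (cons b) ihy
  have h3 := A.phi_B h ha hx hb hy
  have h4 := congrArg (cons (A.br a b)) (A.M_sh hx hy)
  rw [A.M_cons hb] at h1
  rw [A.M_cons ha] at h2
  rw [A.B_cons ha hx hb, map_add, map_add, map_smul, map_smul, A.M_cons ha, A.M_cons hb,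
    A.M_cons hab, A.M_cons ha, A.M_cons hb]
  simp only [map_add, map_smul, LinearMap.add_apply, LinearMap.smul_apply, cons_add, cons_smul] at h1 h2 h3 h4 ⊢
  rw [A.B_cons ha (A.M_parity hx) hb, A.B_cons ha hx hb]
  linear_combination (norm := skip) sg p • h1 + (sg (q * (p + p')) * sg q) • h2 + h3 +
    (sg (q * p') * sg (p + q)) • h4
  match_scalars
  all_goals first
    | ring1
    | simp only [sg]; norm_cast; clear * - p p' q q'; revert p p' q q'; decide

end ShiftedOps

end GInfinity

end

/-! ### Quotients by shuffles and deconcatenation -/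

open scoped TensorProduct

noncomputable section

namespace GInfinity

open SuperModule TensorInstances

set_option linter.unusedSectionVars false

section KoszulExtension

variable {W : Type*} [AddCommGroup W] [Module ℝ W] [SuperModule W]

/-- `D ⊗ id + id ⊗ D` for `D` of parity `e`. -/
def kext (e : ZMod 2) (D : W →ₗ[ℝ] W) : W ⊗[ℝ] W →ₗ[ℝ] W ⊗[ℝ] W :=
  TensorProduct.map D LinearMap.id + TensorProduct.map (parPow e) D

theorem kext_tmul (e : ZMod 2) (D : W →ₗ[ℝ] W) {p : ZMod 2} {v : W} (hv : HasParity p v) (w : W) :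
    kext e D (v ⊗ₜ w) = D v ⊗ₜ w + sg (e * p) • v ⊗ₜ D w := by
  rw [kext, LinearMap.add_apply, TensorProduct.map_tmul, TensorProduct.map_tmul, hv.parPow,
    TensorProduct.smul_tmul', LinearMap.id_apply]

/-- The exchange of the factors with the Koszul sign. -/
def koszulSwap : W ⊗[ℝ] W →ₗ[ℝ] W ⊗[ℝ] W :=
  TensorProduct.lift (koszul (TensorProduct.mk ℝ W W).flip)

theorem koszulSwap_tmul {p q : ZMod 2} {v w : W} (hv : HasParity p v) (hw : HasParity q w) :
    koszulSwap (v ⊗ₜ[ℝ] w) = sg (p * q) • w ⊗ₜ[ℝ] v := by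
  rw [koszulSwap, TensorProduct.lift.tmul, koszul_apply _ hv hw]
  rfl

theorem HasParity.koszulSwap {p : ZMod 2} {z : W ⊗[ℝ] W} (hz : HasParity p z) :
    HasParity p (koszulSwap z) := by
  refine hz.tmul_induction (C := fun z => HasParity p (GInfinity.koszulSwap z)) ?_ ?_ ?_
  · rw [map_zero]; exact HasParity.zero _
  · intro x y hx hy; rw [map_add]; exact hx.add hy
  · intro r s v w hv hw h
    rw [koszulSwap_tmul hv hw]
    exact ((hw.tmul hv).smul _).congr (by rw [add_comm, h])

theorem kext_koszulSwap {e : ZMod 2} {D : W →ₗ[ℝ] W}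
    (hD : ∀ {p v}, HasParity p v → HasParity (p + e) (D v)) (z : W ⊗[ℝ] W) :
    kext e D (koszulSwap z) = koszulSwap (kext e D z) := by
  revert z
  refine LinearMap.congr_fun (f := kext e D ∘ₗ koszulSwap) (g := koszulSwap ∘ₗ kext e D)
    (tensor_ext_parity ?_)
  intro p q v w hv hw
  simp only [LinearMap.comp_apply]
  rw [koszulSwap_tmul hv hw, map_smul, kext_tmul _ _ hw, kext_tmul _ _ hv, map_add, map_smul,
    koszulSwap_tmul (hD hv) hw, koszulSwap_tmul hv (hD hw)]
  match_scalars
  all_goals first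
    | ring1
    | simp only [sg]; norm_cast; clear * - p q e; revert p q e; decide

end KoszulExtension

/-- A quotient of the space of words by the shuffles, with the degree shifted by one, and the maps
induced by the product and the bracket. -/
structure ShuffleQuotient {V : Type*} [AddCommGroup V] [Module ℝ V] [SuperModule V]
    (A : ShiftedOps V) (H : Type*) [AddCommGroup H] [Module ℝ H] [SuperModule H] where
  pr : TensorAlgebra ℝ V →ₗ[ℝ] H
  pr_one : pr 1 = 0
  pr_par : ∀ t, pr (par t) = -par (pr t)
  pr_sh : ∀ {p q r s : ZMod 2} {a b : V} {x y : TensorAlgebra ℝ V}, HasParity p a →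
    HasParity q x → HasParity r b → HasParity s y → pr (sh (cons a x) (cons b y)) = 0
  surj : Function.Surjective pr
  mH : H →ₗ[ℝ] H
  bH : H →ₗ[ℝ] H →ₗ[ℝ] H
  mH_pr : ∀ t, mH (pr t) = pr (A.M t)
  bH_pr : ∀ x y, bH (pr x) (pr y) = pr (A.B x y)

namespace ShuffleQuotient

variable {V : Type*} [AddCommGroup V] [Module ℝ V] [SuperModule V] {A : ShiftedOps V}
  {H : Type*} [AddCommGroup H] [Module ℝ H] [SuperModule H] (S : ShuffleQuotient A H)

local notation "T" => TensorAlgebra ℝ V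

theorem pr_parity {p : ZMod 2} {t : T} (ht : HasParity p t) : HasParity (p + 1) (S.pr t) := by
  have h := S.pr_par t
  rw [ht.par_eq, map_smul] at h
  rw [HasParity, sg_add, sg_one, mul_neg_one, neg_smul, h, neg_neg]

/-- The projection commutes with the sign operators up to the sign of the degree shift, so the
component of the right parity of any preimage is again a preimage. -/
theorem exists_pr {p : ZMod 2} {h : H} (hh : HasParity p h) :
    ∃ t : T, HasParity (p + 1) t ∧ S.pr t = h := by
  obtain ⟨t, rfl⟩ := S.surj h
  refine ⟨proj (p + 1) t, hasParity_proj _ _, ?_⟩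
  rw [proj_apply, map_smul, map_add, map_smul, S.pr_par, hh.par_eq, sg_add, sg_one, mul_neg_one,
    neg_smul, smul_neg, neg_neg, sg_smul_sg_smul]
  module

/-- Left concatenation on the first factor. -/
def consT : V →ₗ[ℝ] Module.End ℝ (T ⊗[ℝ] H) := LinearMap.rTensorHom H ∘ₗ consL

theorem consT_tmul (a : V) (t : T) (h : H) : consT a (t ⊗ₜ[ℝ] h) = cons a t ⊗ₜ h := rfl

/-- Deconcatenation, with the second factor in the quotient. -/
def delta : T →ₗ[ℝ] T ⊗[ℝ] H :=
  recT consT 0 (consL.compr₂ (TensorProduct.mk ℝ T H 1 ∘ₗ S.pr))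

theorem delta_one : S.delta 1 = 0 := recT_one _ _ _

/-- The first factor is kept as a word: prefixing a letter does not respect shuffles, but the
recursion requires it. -/
theorem delta_cons (a : V) (t : T) :
    S.delta (cons a t) = 1 ⊗ₜ S.pr (cons a t) + consT a (S.delta t) := by
  rw [delta, recT_cons, add_comm]
  rfl

theorem consT_parity {p q : ZMod 2} {a : V} (ha : HasParity p a) {z : T ⊗[ℝ] H}
    (hz : HasParity q z) : HasParity (p + q) (consT a z) := by
  refine hz.tmul_induction (C := fun z => HasParity (p + q) (consT a z)) ?_ ?_ ?_
  · rw [map_zero]; exact HasParity.zero _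
  · intro x y hx hy; rw [map_add]; exact hx.add hy
  · intro r s t h ht hh e
    rw [consT_tmul, ← e]
    exact ((ha.cons ht).tmul hh).congr (by ring)

theorem delta_parity {p : ZMod 2} {t : T} (ht : HasParity p t) :
    HasParity (p + 1) (S.delta t) := by
  refine HasParity.induction (C := fun p t => HasParity (p + 1) (S.delta t)) ?_ ?_ ?_ ?_ ?_ ht
  · intro p; rw [map_zero]; exact HasParity.zero _
  · intro p x y hx hy; rw [map_add]; exact hx.add hy
  · intro p c x hx; rw [map_smul]; exact hx.smul c
  · rw [delta_one]; exact HasParity.zero _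
  · intro p q a x ha hx ih
    rw [delta_cons]
    exact ((HasParity.one.tmul (S.pr_parity (ha.cons hx))).congr (by ring)).add
      ((consT_parity ha ih).congr (by ring))

/-- `t ⊗ h ↦ F t ⊗ h` with the sign of the exchange of a word of parity `q` with `h`. -/
def extR (q : ZMod 2) (F : T →ₗ[ℝ] T) : T ⊗[ℝ] H →ₗ[ℝ] T ⊗[ℝ] H :=
  sg q • TensorProduct.map F (parPow q)

theorem extR_tmul (q : ZMod 2) (F : T →ₗ[ℝ] T) (t : T) {r : ZMod 2} {h : H} (hh : HasParity r h) :
    extR q F (t ⊗ₜ h) = sg (q * (r + 1)) • F t ⊗ₜ[ℝ] h := by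
  rw [extR, LinearMap.smul_apply, TensorProduct.map_tmul, hh.parPow, TensorProduct.tmul_smul,
    smul_smul, ← sg_add]
  congr 2
  ring

theorem extR_sh {p p' q q' : ZMod 2} {a b : V} {y : T} (ha : HasParity p a) (hb : HasParity q b)
    {z : T ⊗[ℝ] H} (hz : HasParity (p' + 1) z) :
    extR (q + q') (sh.flip (cons b y)) (consT a z) =
      consT a (extR (q + q') (sh.flip (cons b y)) z)
        + sg (q * (p + p')) • consT b (extR q' (sh.flip y) (consT a z)) := by
  refine HasParity.tmul_induction ?_ ?_ ?_ hz
  · simp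
  · intro x y h h'
    simp only [map_add, h, h']
    module
  · intro s r t h ht hh e
    have e' : p' = s + r + 1 := by rw [e]; clear * -; revert p'; decide
    rw [consT_tmul, extR_tmul _ _ _ hh, extR_tmul _ _ _ hh, extR_tmul _ _ _ hh, map_smul, map_smul,
      consT_tmul, consT_tmul, LinearMap.flip_apply, LinearMap.flip_apply, LinearMap.flip_apply,
      cons_sh_cons ha ht hb, TensorProduct.add_tmul, ← TensorProduct.smul_tmul', e']
    match_scalars
    all_goals first
      | ring1
      | simp only [sg]; norm_cast; clear * - p q q' r s; revert p q q' r s; decide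

theorem rTensor_sh {p p' q : ZMod 2} {a b : V} {x : T} (ha : HasParity p a) (hx : HasParity p' x)
    (hb : HasParity q b) (z : T ⊗[ℝ] H) :
    (sh (cons a x)).rTensor H (consT b z) = consT a ((sh x).rTensor H (consT b z))
      + sg (q * (p + p')) • consT b ((sh (cons a x)).rTensor H z) := by
  induction z with
  | zero => simp
  | add z z' h h' =>
    simp only [map_add, h, h']
    module
  | tmul t h =>
    simp only [consT_tmul, LinearMap.rTensor_tmul]
    rw [cons_sh_cons ha hx hb, TensorProduct.add_tmul, ← TensorProduct.smul_tmul']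

/-- A cut of a shuffle cuts both words and shuffles left pieces with left pieces and right pieces
with right pieces. The right factor lies in the quotient, so it survives only if one right piece is
empty; hence just one of the words is really cut. -/
theorem delta_sh {p q : ZMod 2} {x y : T} (hx : HasParity p x) (hy : HasParity q y) :
    S.delta (sh x y) = extR q (sh.flip y) (S.delta x) + (sh x).rTensor H (S.delta y) := by
  revert q y
  refine HasParity.induction (C := fun p x => ∀ {q y}, HasParity q y →
    S.delta (sh x y) = extR q (sh.flip y) (S.delta x) + (sh x).rTensor H (S.delta y))
    ?_ ?_ ?_ ?_ ?_ hx
  · intros; simp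
  · intro p x x' h h' q y hy
    simp only [map_add, LinearMap.add_apply, h hy, h' hy, LinearMap.rTensor_add]
    module
  · intro p c x h q y hy
    simp only [map_smul, LinearMap.smul_apply, h hy, LinearMap.rTensor_smul]
    module
  · intro q y hy
    have : (sh (1 : T)).rTensor H = LinearMap.id := by
      rw [← LinearMap.rTensor_id]; congr 1; ext1; exact one_sh _
    rw [one_sh, delta_one, map_zero, zero_add, this, LinearMap.id_apply]
  intro p p' a x ha hx ihx q y hy
  refine HasParity.induction (C := fun q y => S.delta (sh (cons a x) y) =
    extR q (sh.flip y) (S.delta (cons a x)) + (sh (cons a x)).rTensor H (S.delta y))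
    ?_ ?_ ?_ ?_ ?_ hy
  · intros; simp [extR]
  · intro r y y' h h'
    simp only [map_add, h, h', extR, TensorProduct.map_add_left, LinearMap.add_apply, smul_add]
    module
  · intro r c y h
    simp only [map_smul, h, extR, TensorProduct.map_smul_left, LinearMap.smul_apply]
    module
  · have : extR (H := H) 0 (sh.flip (1 : T)) = LinearMap.id := by
      ext t h
      simp [extR, sg_zero, parPow, sh_one]
    rw [sh_one, delta_one, map_zero, add_zero, this, LinearMap.id_apply]
  intro q q' b y hb hy ihy
  have h1 := congrArg (consT (H := H) a) (ihx (hb.cons hy))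
  have h2 := congrArg (consT (H := H) b) ihy
  have h3 := congrArg (fun h => (1 : T) ⊗ₜ[ℝ] h) (S.pr_sh ha hx hb hy)
  have h4 := extR_sh (H := H) (q' := q') (y := y) ha hb (S.delta_parity hx)
  have h5 := rTensor_sh ha hx hb (S.delta y)
  rw [S.delta_cons b] at h1
  rw [S.delta_cons a] at h2
  rw [cons_sh_cons ha hx hb] at h3
  rw [cons_sh_cons ha hx hb, map_add, map_smul, delta_cons, delta_cons, S.delta_cons a x,
    S.delta_cons b y]
  simp only [map_add, map_smul, extR_tmul _ _ _ (S.pr_parity (ha.cons hx)), consT_tmul,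
    LinearMap.rTensor_tmul, LinearMap.flip_apply, one_sh, sh_one, TensorProduct.tmul_add,
    TensorProduct.tmul_smul, TensorProduct.tmul_zero] at h1 h2 h3 h4 h5 ⊢
  linear_combination (norm := skip) h1 + sg (q * (p + p')) • h2 + h3 - h4 - h5
  match_scalars
  all_goals first
    | ring1
    | simp only [sg]; norm_cast; clear * - p p' q q'; revert p p' q q'; decide

/-- `(t ⊗ h, t' ⊗ h') ↦ ± (t ⧢ t') ⊗ [h, h']`. -/
def shBr : T ⊗[ℝ] H →ₗ[ℝ] T ⊗[ℝ] H →ₗ[ℝ] T ⊗[ℝ] H :=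
  TensorProduct.map₂ (σ₁₃ := RingHom.id ℝ) (σ₂₃ := RingHom.id ℝ) sh (S.bH ∘ₗ proj 1) +
    TensorProduct.map₂ (σ₁₃ := RingHom.id ℝ) (σ₂₃ := RingHom.id ℝ) (sh.compl₂ par)
      (S.bH ∘ₗ proj 0)

theorem shBr_tmul (t : T) {r s : ZMod 2} {h h' : H} {t' : T} (hh : HasParity r h)
    (ht' : HasParity s t') :
    S.shBr (t ⊗ₜ h) (t' ⊗ₜ h') = sg ((r + 1) * s) • sh t t' ⊗ₜ[ℝ] S.bH h h' := by
  have h2 : ∀ p : ZMod 2, p = 0 ∨ p = 1 := by decide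
  rw [shBr, LinearMap.add_apply, LinearMap.add_apply, TensorProduct.map₂_apply_tmul,
    TensorProduct.map₂_apply_tmul, TensorProduct.map_tmul, TensorProduct.map_tmul,
    LinearMap.comp_apply, LinearMap.comp_apply]
  rcases h2 r with rfl | rfl
  · rw [hh.proj_self, hh.proj_of_ne (q := 1) (by decide), LinearMap.compl₂_apply, ht'.par_eq]
    simp [TensorProduct.smul_tmul']
  · rw [hh.proj_self, hh.proj_of_ne (q := 0) (by decide), show (1 : ZMod 2) + 1 = 0 from rfl]
    simp [sg_zero]

end ShuffleQuotient

end GInfinity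

end

/-! ### Deconcatenation of extended brackets and products -/

open scoped TensorProduct

noncomputable section

namespace GInfinity

open SuperModule TensorInstances

set_option linter.unusedSectionVars false

namespace ShuffleQuotient

variable {V : Type*} [AddCommGroup V] [Module ℝ V] [SuperModule V] {A : ShiftedOps V}
  {H : Type*} [AddCommGroup H] [Module ℝ H] [SuperModule H] (S : ShuffleQuotient A H)

local notation "T" => TensorAlgebra ℝ V

/-- The shuffle recursion for the first factors, carried along with the bracket of the second ones.
-/
theorem shBr_parity {p q : ZMod 2} {z z' : T ⊗[ℝ] H} (a b : V) (ha : HasParity p a)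
    (hb : HasParity q b) {p' q' : ZMod 2} (hz : HasParity (p' + 1) z) (hz' : HasParity (q' + 1) z') :
    S.shBr (consT a z) (consT b z') = consT a (S.shBr z (consT b z'))
      + sg (q * (p + p')) • consT b (S.shBr (consT a z) z') := by
  refine HasParity.tmul_induction ?_ ?_ ?_ hz
  · simp
  · intro x y h h'
    simp only [map_add, LinearMap.add_apply, h, h']
    module
  intro s r t h ht hh e
  have e' : p' = s + r + 1 := by rw [e]; clear * -; revert p'; decide
  refine HasParity.tmul_induction ?_ ?_ ?_ hz'
  · simp
  · intro x y h h'
    simp only [map_add, h, h']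
    module
  intro s' r' t' h' ht' hh' _
  simp only [consT_tmul]
  rw [S.shBr_tmul _ hh (hb.cons ht'), S.shBr_tmul _ hh (hb.cons ht'), S.shBr_tmul _ hh ht',
    cons_sh_cons ha ht hb, TensorProduct.add_tmul, ← TensorProduct.smul_tmul', map_smul, map_smul,
    consT_tmul, consT_tmul, e']
  match_scalars
  all_goals first
    | ring1
    | simp only [sg]; norm_cast; clear * - p q s r s'; revert p q s r s'; decide

theorem extR_B {p p' q q' : ZMod 2} {a b : V} {y : T} (ha : HasParity p a) (hb : HasParity q b)
    {z : T ⊗[ℝ] H} (hz : HasParity (p' + 1) z) :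
    extR (q + q') (A.B.flip (cons b y)) (consT a z) =
      sg (q * p') • consT (A.br a b) (extR q' (sh.flip y) z)
        + consT a (extR (q + q') (A.B.flip (cons b y)) z)
        + sg (q * (p + p')) • consT b (extR q' (A.B.flip y) (consT a z)) := by
  refine HasParity.tmul_induction ?_ ?_ ?_ hz
  · simp
  · intro x y h h'
    simp only [map_add, h, h']
    module
  · intro s r t h ht hh e
    have e' : p' = s + r + 1 := by rw [e]; clear * -; revert p'; decide
    rw [consT_tmul, extR_tmul _ _ _ hh, extR_tmul _ _ _ hh, extR_tmul _ _ _ hh, extR_tmul _ _ _ hh,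
      map_smul, map_smul, map_smul, consT_tmul, consT_tmul, consT_tmul, LinearMap.flip_apply,
      LinearMap.flip_apply, LinearMap.flip_apply, LinearMap.flip_apply,
      A.B_cons ha ht hb, TensorProduct.add_tmul, TensorProduct.add_tmul,
      ← TensorProduct.smul_tmul', ← TensorProduct.smul_tmul', e']
    match_scalars
    all_goals first
      | ring1
      | simp only [sg]; norm_cast; clear * - p q q' r s; revert p q q' r s; decide

theorem rTensor_B {p p' q : ZMod 2} {a b : V} {x : T} (ha : HasParity p a) (hx : HasParity p' x)
    (hb : HasParity q b) (z : T ⊗[ℝ] H) :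
    (A.B (cons a x)).rTensor H (consT b z) =
      sg (q * p') • consT (A.br a b) ((sh x).rTensor H z)
      + consT a ((A.B x).rTensor H (consT b z))
      + sg (q * (p + p')) • consT b ((A.B (cons a x)).rTensor H z) := by
  induction z with
  | zero => simp
  | add z z' h h' =>
    simp only [map_add, h, h']
    module
  | tmul t h =>
    simp only [consT_tmul, LinearMap.rTensor_tmul]
    rw [A.B_cons ha hx hb, TensorProduct.add_tmul, TensorProduct.add_tmul,
      ← TensorProduct.smul_tmul', ← TensorProduct.smul_tmul']

theorem shBr_one_tmul {p q : ZMod 2} {b : V} (hb : HasParity q b) {h : H}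
    (hh : HasParity (p + 1) h) (z : T ⊗[ℝ] H) :
    S.shBr ((1 : T) ⊗ₜ h) (consT b z) = sg (p * q) • consT b (S.shBr ((1 : T) ⊗ₜ h) z) := by
  refine tmul_parity_induction (C := fun z : T ⊗[ℝ] H => S.shBr ((1 : T) ⊗ₜ h) (consT b z) =
    sg (p * q) • consT b (S.shBr ((1 : T) ⊗ₜ h) z)) ?_ ?_ ?_ z
  · simp
  · intro x y h h'
    simp only [map_add, h, h']
    module
  · intro s r t h' ht _
    rw [consT_tmul, S.shBr_tmul _ hh (hb.cons ht), S.shBr_tmul _ hh ht, one_sh, one_sh, map_smul,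
      consT_tmul]
    match_scalars
    all_goals
      simp only [sg]; norm_cast; clear * -; revert p q s; decide

theorem shBr_tmul_one {a : V} (z : T ⊗[ℝ] H) (h : H) :
    S.shBr (consT a z) ((1 : T) ⊗ₜ h) = consT a (S.shBr z ((1 : T) ⊗ₜ h)) := by
  refine tmul_parity_induction (C := fun z : T ⊗[ℝ] H => S.shBr (consT a z) ((1 : T) ⊗ₜ h) =
    consT a (S.shBr z ((1 : T) ⊗ₜ h))) ?_ ?_ ?_ z
  · simp
  · intro x y h h'
    simp only [map_add, LinearMap.add_apply, h, h']
  · intro s r t h' ht hh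
    rw [consT_tmul, S.shBr_tmul _ hh HasParity.one, S.shBr_tmul _ hh HasParity.one, sh_one, sh_one,
      map_smul, consT_tmul]

/-- If the bracketed pair lies left of the cut, the right pieces are shuffled and one of them must
be empty, which gives the first two sums. If it lies right of the cut, the left pieces are shuffled
and the right pieces bracketed, which is `shBr`. -/
theorem delta_B {p q : ZMod 2} {x y : T} (hx : HasParity p x) (hy : HasParity q y) :
    S.delta (A.B x y) = extR q (A.B.flip y) (S.delta x) + (A.B x).rTensor H (S.delta y)
      + S.shBr (S.delta x) (S.delta y) := by
  revert q y
  refine HasParity.induction (C := fun p x => ∀ {q y}, HasParity q y →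
    S.delta (A.B x y) = extR q (A.B.flip y) (S.delta x) + (A.B x).rTensor H (S.delta y)
      + S.shBr (S.delta x) (S.delta y)) ?_ ?_ ?_ ?_ ?_ hx
  · intros; simp
  · intro p x x' h h' q y hy
    simp only [map_add, LinearMap.add_apply, h hy, h' hy, LinearMap.rTensor_add]
    module
  · intro p c x h q y hy
    simp only [map_smul, LinearMap.smul_apply, h hy, LinearMap.rTensor_smul]
    module
  · intro q y hy
    have : A.B (1 : T) = 0 := by ext1; exact A.one_B _
    rw [this, delta_one]
    simp
  intro p p' a x ha hx ihx q y hy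
  refine HasParity.induction (C := fun q y => S.delta (A.B (cons a x) y) =
    extR q (A.B.flip y) (S.delta (cons a x)) + (A.B (cons a x)).rTensor H (S.delta y)
      + S.shBr (S.delta (cons a x)) (S.delta y)) ?_ ?_ ?_ ?_ ?_ hy
  · intros; simp [extR]
  · intro r y y' h h'
    simp only [map_add, h, h', extR, TensorProduct.map_add_left, LinearMap.add_apply, smul_add]
    module
  · intro r c y h
    simp only [map_smul, h, extR, TensorProduct.map_smul_left, LinearMap.smul_apply]
    module
  · have : A.B.flip (1 : T) = 0 := by ext1; exact A.B_one _
    rw [A.B_one, delta_one, this, extR]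
    simp
  intro q q' b y hb hy ihy
  have h1 := congrArg (consT (H := H) a) (ihx (hb.cons hy))
  have h2 := congrArg (consT (H := H) b) ihy
  have h3 := congrArg (fun h => (1 : T) ⊗ₜ[ℝ] h) (S.bH_pr (cons a x) (cons b y))
  have h4 := extR_B (A := A) (H := H) (q' := q') (y := y) ha hb (S.delta_parity hx)
  have h5 := rTensor_B (A := A) ha hx hb (S.delta y)
  have h6 := congrArg (consT (H := H) (A.br a b)) (S.delta_sh hx hy)
  have h7 := S.shBr_parity a b ha hb (S.delta_parity hx) (S.delta_parity hy)
  have h8 := S.shBr_one_tmul hb (S.pr_parity (ha.cons hx)) (S.delta y)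
  have h9 := S.shBr_tmul_one (a := a) (S.delta x) (S.pr (cons b y))
  rw [S.delta_cons b] at h1
  rw [S.delta_cons a] at h2
  rw [A.B_cons ha hx hb] at h3
  rw [A.B_cons ha hx hb, map_add, map_add, map_smul, map_smul, delta_cons, delta_cons, delta_cons,
    S.delta_cons a x, S.delta_cons b y]
  simp only [map_add, map_smul, extR_tmul _ _ _ (S.pr_parity (ha.cons hx)),
    LinearMap.rTensor_tmul, LinearMap.flip_apply, sh_one, TensorProduct.tmul_add,
    TensorProduct.tmul_smul, TensorProduct.zero_tmul, LinearMap.add_apply, A.one_B, A.B_one,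
    smul_zero, zero_add,
    S.shBr_tmul _ (S.pr_parity (ha.cons hx)) HasParity.one, mul_zero, sg_zero, one_smul]
    at h1 h2 h3 h4 h5 h6 h7 h8 h9 ⊢
  linear_combination (norm := skip) h1 + sg (q * (p + p')) • h2 - h3 - h4 - h5 + sg (q * p') • h6
    - h7 - h8 - h9
  match_scalars
  all_goals first
    | ring1
    | simp only [sg]; norm_cast; clear * - p p' q q'; revert p p' q q'; decide

/-- The contracted letter cannot be cut: the cut in front of it is the first term, and all other
cuts lie to its right. -/
theorem delta_phi {a : V} (x : T) :
    S.delta (A.phi a x) = 1 ⊗ₜ S.pr (A.phi a x) + (A.phi a).rTensor H (S.delta x) := by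
  induction x using tensor_induction with
  | hadd x y hx hy =>
    simp only [map_add, hx, hy, TensorProduct.tmul_add]
    abel
  | hsmul c x hx => simp only [map_smul, hx, TensorProduct.tmul_smul, smul_add]
  | h1 => simp [delta_one, ShiftedOps.phi_one]
  | hcons b x _ =>
    have : (A.phi a).rTensor H (consT b (S.delta x)) = consT (A.mm a b) (S.delta x) := by
      generalize S.delta x = z
      induction z with
      | zero => simp
      | add z z' h h' => simp only [map_add, h, h']
      | tmul t h => simp [consT_tmul, ShiftedOps.phi_cons]
    rw [ShiftedOps.phi_cons, delta_cons, delta_cons, map_add, this, LinearMap.rTensor_tmul,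
      ShiftedOps.phi_one, TensorProduct.zero_tmul, zero_add]

/-- Each contracted pair lies entirely on one side of the cut; on the right side the operator first
passes the left piece, hence `par`. -/
theorem delta_M {p : ZMod 2} {x : T} (hx : HasParity p x) :
    S.delta (A.M x) = A.M.rTensor H (S.delta x) + TensorProduct.map par S.mH (S.delta x) := by
  refine HasParity.induction (C := fun p x => S.delta (A.M x) =
    A.M.rTensor H (S.delta x) + TensorProduct.map par S.mH (S.delta x)) ?_ ?_ ?_ ?_ ?_ hx
  · intros; simp
  · intro p x y h h'
    simp only [map_add, h, h']
    abel
  · intro p c x h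
    simp only [map_smul, h, smul_add]
  · simp [ShiftedOps.M_one, delta_one]
  · intro p q a x ha hx ih
    have h1 : ∀ z : T ⊗[ℝ] H, A.M.rTensor H (consT a z) =
        (A.phi a).rTensor H z + sg p • consT a (A.M.rTensor H z) := by
      intro z
      induction z with
      | zero => simp
      | add z z' h h' =>
        simp only [map_add, h, h']
        module
      | tmul t h =>
        rw [consT_tmul, LinearMap.rTensor_tmul, A.M_cons ha, TensorProduct.add_tmul,
          ← TensorProduct.smul_tmul']
        rfl
    have h2 : ∀ z : T ⊗[ℝ] H, TensorProduct.map par S.mH (consT a z) =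
        sg p • consT a (TensorProduct.map par S.mH z) := by
      intro z
      induction z with
      | zero => simp
      | add z z' h h' =>
        simp only [map_add, h, h']
        module
      | tmul t h =>
        rw [consT_tmul, TensorProduct.map_tmul, par_cons, ha.par_eq, smul_cons,
          ← TensorProduct.smul_tmul']
        rfl
    have h3 := S.delta_phi (a := a) x
    have h4 := congrArg (fun h => (1 : T) ⊗ₜ[ℝ] h) (S.mH_pr (cons a x))
    rw [A.M_cons ha] at h4
    rw [A.M_cons ha, map_add, map_smul, delta_cons, delta_cons, map_add, map_add, h1, h2, h3, ih,
      LinearMap.rTensor_tmul, TensorProduct.map_tmul, par_one, ShiftedOps.M_one]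
    simp only [map_add, map_smul, TensorProduct.tmul_add, TensorProduct.tmul_smul,
      TensorProduct.zero_tmul] at h4 ⊢
    linear_combination (norm := module) -h4

end ShuffleQuotient

end GInfinity

end

/-! ### The cobracket and its compatibilities -/

open scoped TensorProduct

noncomputable section

namespace GInfinity

open SuperModule TensorInstances

set_option linter.unusedSectionVars false

namespace ShuffleQuotient

variable {V : Type*} [AddCommGroup V] [Module ℝ V] [SuperModule V] {A : ShiftedOps V}
  {H : Type*} [AddCommGroup H] [Module ℝ H] [SuperModule H] (S : ShuffleQuotient A H)

local notation "T" => TensorAlgebra ℝ V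

/-- The coefficient of the empty word. -/
def counit : T →ₗ[ℝ] ℝ := TensorAlgebra.algebraMapInv.toLinearMap

theorem counit_one : counit (1 : T) = 1 := by simp [counit]

theorem counit_cons (a : V) (t : T) : counit (cons a t) = 0 := by
  simp [counit, cons, TensorAlgebra.algebraMapInv]

/-- Modulo shuffles, shuffling with a nonempty word sees only the scalar part of the other factor.
-/
theorem pr_sh_cons {p q r : ZMod 2} {t : T} (ht : HasParity p t) {b : V} {y : T}
    (hb : HasParity q b) (hy : HasParity r y) :
    S.pr (sh t (cons b y)) = counit t • S.pr (cons b y) := by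
  refine HasParity.induction (C := fun _ t => S.pr (sh t (cons b y)) =
    counit t • S.pr (cons b y)) ?_ ?_ ?_ ?_ ?_ ht
  · intros; simp
  · intro p x y h h'
    simp only [map_add, LinearMap.add_apply, h, h', add_smul]
  · intro p c x h
    simp only [map_smul, LinearMap.smul_apply, h, smul_assoc]
  · rw [one_sh, counit_one, one_smul]
  · intro p q a x ha hx _
    rw [S.pr_sh ha hx hb hy, counit_cons, zero_smul]

theorem pr_cons_sh {p q r : ZMod 2} {t : T} (ht : HasParity p t) {b : V} {y : T}
    (hb : HasParity q b) (hy : HasParity r y) :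
    S.pr (sh (cons b y) t) = counit t • S.pr (cons b y) := by
  refine HasParity.induction (C := fun _ t => S.pr (sh (cons b y) t) =
    counit t • S.pr (cons b y)) ?_ ?_ ?_ ?_ ?_ ht
  · intros; simp
  · intro p x y h h'
    simp only [map_add, h, h', add_smul]
  · intro p c x h
    simp only [map_smul, h, smul_assoc]
  · rw [sh_one, counit_one, one_smul]
  · intro p q a x ha hx _
    rw [S.pr_sh hb hy ha hx, counit_cons, zero_smul]

/-- The counit applied to the first factor. -/
def counitL : T ⊗[ℝ] H →ₗ[ℝ] H := (TensorProduct.lid ℝ H).toLinearMap ∘ₗ counit.rTensor H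

theorem counitL_tmul (t : T) (h : H) : counitL (t ⊗ₜ[ℝ] h) = counit t • h := by
  simp [counitL]

theorem counitL_consT (a : V) (z : T ⊗[ℝ] H) : counitL (consT a z) = 0 := by
  induction z with
  | zero => simp
  | add z z' h h' => simp only [map_add, h, h', add_zero]
  | tmul t h => rw [consT_tmul, counitL_tmul, counit_cons, zero_smul]

theorem counitL_delta (t : T) : counitL (S.delta t) = S.pr t := by
  induction t using tensor_induction with
  | hadd x y hx hy => simp only [map_add, hx, hy]
  | hsmul c x hx => simp only [map_smul, hx]
  | h1 => rw [delta_one, map_zero, S.pr_one]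
  | hcons a t _ =>
    rw [delta_cons, map_add, counitL_consT, counitL_tmul, counit_one, one_smul, add_zero]

/-- Reduced deconcatenation, with both factors in the quotient. -/
def deltaH : T →ₗ[ℝ] H ⊗[ℝ] H := S.pr.rTensor H ∘ₗ S.delta

theorem deltaH_apply (t : T) : S.deltaH t = S.pr.rTensor H (S.delta t) := rfl

theorem deltaH_cons (a : V) (t : T) :
    S.deltaH (cons a t) = S.pr.rTensor H (consT a (S.delta t)) := by
  rw [deltaH_apply, delta_cons, map_add, LinearMap.rTensor_tmul, S.pr_one, TensorProduct.zero_tmul,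
    zero_add]

theorem rTensor_pr_parity {p : ZMod 2} {z : T ⊗[ℝ] H} (hz : HasParity p z) :
    HasParity (p + 1) (S.pr.rTensor H z) := by
  refine HasParity.tmul_induction ?_ ?_ ?_ hz
  · rw [map_zero]; exact HasParity.zero _
  · intro x y hx hy; rw [map_add]; exact hx.add hy
  · intro r s t h ht hh e
    rw [LinearMap.rTensor_tmul, ← e]
    exact ((S.pr_parity ht).tmul hh).congr (by ring)

theorem deltaH_parity {p : ZMod 2} {t : T} (ht : HasParity p t) : HasParity p (S.deltaH t) :=
  (S.rTensor_pr_parity (S.delta_parity ht)).congr (by clear * -; revert p; decide)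

/-- By `delta_sh` only one word is cut, and its left piece is shuffled with the whole other word. In
the quotient this vanishes unless the left piece is empty, so exactly one term remains for each of
the two words. -/
theorem deltaH_sh {p p' q q' : ZMod 2} {a b : V} {x y : T} (ha : HasParity p a)
    (hx : HasParity p' x) (hb : HasParity q b) (hy : HasParity q' y) :
    S.deltaH (sh (cons a x) (cons b y)) = S.pr (cons a x) ⊗ₜ S.pr (cons b y)
      + sg ((p + p') * (q + q')) • S.pr (cons b y) ⊗ₜ S.pr (cons a x) := by
  have h1 : ∀ z : T ⊗[ℝ] H, S.pr.rTensor H (extR (q + q') (sh.flip (cons b y)) z) =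
      sg (q + q') • S.pr (cons b y) ⊗ₜ parPow (q + q') (counitL z) := by
    intro z
    refine tmul_parity_induction (C := fun z : T ⊗[ℝ] H =>
      S.pr.rTensor H (extR (q + q') (sh.flip (cons b y)) z) =
        sg (q + q') • S.pr (cons b y) ⊗ₜ parPow (q + q') (counitL z)) ?_ ?_ ?_ z
    · simp
    · intro z z' h h'
      simp only [map_add, h, h', TensorProduct.tmul_add, smul_add]
    · intro r s t h ht hh
      rw [extR, LinearMap.smul_apply, TensorProduct.map_tmul, map_smul, LinearMap.rTensor_tmul,
        LinearMap.flip_apply, S.pr_sh_cons ht hb hy, counitL_tmul, map_smul,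
        TensorProduct.smul_tmul]
  have h2 : ∀ z : T ⊗[ℝ] H, S.pr.rTensor H ((sh (cons a x)).rTensor H z) =
      S.pr (cons a x) ⊗ₜ counitL z := by
    intro z
    refine tmul_parity_induction (C := fun z : T ⊗[ℝ] H =>
      S.pr.rTensor H ((sh (cons a x)).rTensor H z) = S.pr (cons a x) ⊗ₜ counitL z) ?_ ?_ ?_ z
    · simp
    · intro z z' h h'
      simp only [map_add, h, h', TensorProduct.tmul_add]
    · intro r s t h ht hh
      rw [LinearMap.rTensor_tmul, LinearMap.rTensor_tmul, S.pr_cons_sh ht ha hx, counitL_tmul,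
        TensorProduct.smul_tmul]
  rw [deltaH_apply, S.delta_sh (ha.cons hx) (hb.cons hy), map_add, h1, h2, counitL_delta,
    counitL_delta, (S.pr_parity (ha.cons hx)).parPow, TensorProduct.tmul_smul]
  match_scalars
  all_goals first
    | ring1
    | simp only [sg]; norm_cast; clear * - p p' q q'; revert p p' q q'; decide

theorem bH_parity {p q : ZMod 2} {h h' : H} (hh : HasParity p h) (hh' : HasParity q h') :
    HasParity (p + q + 1) (S.bH h h') := by
  obtain ⟨t, ht, rfl⟩ := S.exists_pr hh
  obtain ⟨t', ht', rfl⟩ := S.exists_pr hh'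
  rw [S.bH_pr]
  exact (S.pr_parity (A.B_parity ht ht')).congr (by clear * -; revert p q; decide)

theorem mH_parity {p : ZMod 2} {h : H} (hh : HasParity p h) : HasParity (p + 1) (S.mH h) := by
  obtain ⟨t, ht, rfl⟩ := S.exists_pr hh
  rw [S.mH_pr]
  exact S.pr_parity ((A.M_parity ht).congr (by clear * -; revert p; decide))

theorem bH_anti {p q : ZMod 2} {h h' : H} (hh : HasParity p h) (hh' : HasParity q h') :
    S.bH h h' = -(sg ((p + 1) * (q + 1)) • S.bH h' h) := by
  obtain ⟨t, ht, rfl⟩ := S.exists_pr hh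
  obtain ⟨t', ht', rfl⟩ := S.exists_pr hh'
  rw [S.bH_pr, S.bH_pr, A.B_anti ht ht', map_neg, map_smul]

/-- `[h, ·]` as a derivation of `H ⊗ H`, for `h` of unshifted parity `p`. -/
def brDer (p : ZMod 2) (h : H) : H ⊗[ℝ] H →ₗ[ℝ] H ⊗[ℝ] H :=
  TensorProduct.map (S.bH h) LinearMap.id + sg p • TensorProduct.map (parPow p) (S.bH h)

theorem brDer_tmul (p : ZMod 2) (h : H) {r : ZMod 2} {v : H} (hv : HasParity r v) (w : H) :
    S.brDer p h (v ⊗ₜ w) = S.bH h v ⊗ₜ w + sg (p + p * r) • v ⊗ₜ S.bH h w := by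
  rw [brDer, LinearMap.add_apply, LinearMap.smul_apply, TensorProduct.map_tmul,
    TensorProduct.map_tmul, hv.parPow, ← TensorProduct.smul_tmul', smul_smul, ← sg_add]
  rfl

/-- Project `delta_B` to the quotient. In its last sum only the terms with an empty left piece
survive; together with the first two sums they assemble into the actions of the two words on both
factors of the deconcatenation of the other. -/
theorem deltaH_B_cons {p p' q q' : ZMod 2} {a b : V} {x y : T} (ha : HasParity p a)
    (hx : HasParity p' x) (hb : HasParity q b) (hy : HasParity q' y) :
    S.deltaH (A.B (cons a x) (cons b y)) =
      S.brDer (p + p') (S.pr (cons a x)) (S.deltaH (cons b y))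
      - sg ((p + p') * (q + q')) •
        S.brDer (q + q') (S.pr (cons b y)) (S.deltaH (cons a x)) := by
  have hax := ha.cons hx
  have hby := hb.cons hy
  have h1 : ∀ z : T ⊗[ℝ] H, S.pr.rTensor H (extR (q + q') (A.B.flip (cons b y)) z) =
      sg (q + q') • TensorProduct.map (S.bH.flip (S.pr (cons b y))) (parPow (q + q'))
        (S.pr.rTensor H z) := by
    intro z
    induction z with
    | zero => simp
    | add z z' h h' => simp only [map_add, h, h', smul_add]
    | tmul t h =>
      rw [extR, LinearMap.smul_apply, TensorProduct.map_tmul, map_smul, LinearMap.rTensor_tmul,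
        LinearMap.rTensor_tmul, TensorProduct.map_tmul, LinearMap.flip_apply, LinearMap.flip_apply,
        S.bH_pr]
  have h2 : ∀ z : T ⊗[ℝ] H, S.pr.rTensor H ((A.B (cons a x)).rTensor H z) =
      TensorProduct.map (S.bH (S.pr (cons a x))) LinearMap.id (S.pr.rTensor H z) := by
    intro z
    induction z with
    | zero => simp
    | add z z' h h' => simp only [map_add, h, h']
    | tmul t h =>
      rw [LinearMap.rTensor_tmul, LinearMap.rTensor_tmul, LinearMap.rTensor_tmul,
        TensorProduct.map_tmul, S.bH_pr, LinearMap.id_apply]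
  have h3 : ∀ z : T ⊗[ℝ] H, S.pr.rTensor H (S.shBr ((1 : T) ⊗ₜ S.pr (cons a x)) z) =
      sg (p + p') • TensorProduct.map (parPow (p + p')) (S.bH (S.pr (cons a x)))
        (S.pr.rTensor H z) := by
    intro z
    refine tmul_parity_induction (C := fun z : T ⊗[ℝ] H =>
      S.pr.rTensor H (S.shBr ((1 : T) ⊗ₜ S.pr (cons a x)) z) =
      sg (p + p') • TensorProduct.map (parPow (p + p')) (S.bH (S.pr (cons a x)))
        (S.pr.rTensor H z)) ?_ ?_ ?_ z
    · simp
    · intro z z' h h'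
      simp only [map_add, h, h', smul_add]
    · intro r s t h ht _
      rw [S.shBr_tmul _ (S.pr_parity hax) ht, map_smul, LinearMap.rTensor_tmul,
        LinearMap.rTensor_tmul, TensorProduct.map_tmul, one_sh, (S.pr_parity ht).parPow,
        ← TensorProduct.smul_tmul']
      match_scalars
      all_goals
        simp only [sg]; norm_cast; clear * -; revert p p' r; decide
  have h4 : ∀ z : T ⊗[ℝ] H, S.pr.rTensor H (S.shBr z ((1 : T) ⊗ₜ S.pr (cons b y))) =
      TensorProduct.map LinearMap.id (S.bH.flip (S.pr (cons b y))) (S.pr.rTensor H z) := by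
    intro z
    refine tmul_parity_induction (C := fun z : T ⊗[ℝ] H =>
      S.pr.rTensor H (S.shBr z ((1 : T) ⊗ₜ S.pr (cons b y))) =
      TensorProduct.map LinearMap.id (S.bH.flip (S.pr (cons b y))) (S.pr.rTensor H z)) ?_ ?_ ?_ z
    · simp
    · intro z z' h h'
      simp only [map_add, LinearMap.add_apply, h, h']
    · intro r s t h _ hh
      rw [S.shBr_tmul _ hh HasParity.one, map_smul, LinearMap.rTensor_tmul,
        LinearMap.rTensor_tmul, TensorProduct.map_tmul, sh_one, mul_zero, sg_zero, one_smul]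
      rfl
  -- With both left pieces nonempty the first factor is a shuffle of nonempty words and vanishes.
  have h5 : ∀ z z' : T ⊗[ℝ] H, S.pr.rTensor H (S.shBr (consT a z) (consT b z')) = 0 := by
    intro z z'
    refine tmul_parity_induction (C := fun z : T ⊗[ℝ] H =>
      S.pr.rTensor H (S.shBr (consT a z) (consT b z')) = 0) ?_ ?_ ?_ z
    · simp
    · intro z z' h h'
      simp only [map_add, LinearMap.add_apply, h, h', add_zero]
    intro r s t h ht hh
    refine tmul_parity_induction (C := fun z' : T ⊗[ℝ] H =>
      S.pr.rTensor H (S.shBr (consT a (t ⊗ₜ h)) (consT b z')) = 0) ?_ ?_ ?_ z'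
    · simp
    · intro z z' h h'
      simp only [map_add, h, h', add_zero]
    · intro r' s' t' h' ht' _
      rw [consT_tmul, consT_tmul, S.shBr_tmul _ hh (hb.cons ht'), map_smul, LinearMap.rTensor_tmul,
        S.pr_sh ha ht hb ht', TensorProduct.zero_tmul, smul_zero]
  -- Here `Y` stands to the right in the brackets; antisymmetry turns the two terms into the left
  -- action of `Y` on both factors.
  have h6 : ∀ w : H ⊗[ℝ] H, HasParity (p + p') w →
      sg (q + q') • TensorProduct.map (S.bH.flip (S.pr (cons b y))) (parPow (q + q')) w
      + TensorProduct.map LinearMap.id (S.bH.flip (S.pr (cons b y))) w =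
      -(sg ((p + p') * (q + q')) • S.brDer (q + q') (S.pr (cons b y)) w) := by
    intro w hw
    generalize hP : p + p' = P at hw ⊢
    refine HasParity.tmul_induction ?_ ?_ ?_ hw
    · simp
    · intro z z' h h'
      simp only [map_add]
      linear_combination (norm := module) h + h'
    · intro r s v w hv hw e
      rw [TensorProduct.map_tmul, TensorProduct.map_tmul, S.brDer_tmul _ _ hv, hw.parPow,
        TensorProduct.tmul_smul, LinearMap.flip_apply, LinearMap.flip_apply, LinearMap.id_apply,
        S.bH_anti hv (S.pr_parity hby), S.bH_anti hw (S.pr_parity hby), TensorProduct.neg_tmul,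
        TensorProduct.tmul_neg, ← TensorProduct.smul_tmul', TensorProduct.tmul_smul, ← e]
      match_scalars
      all_goals
        simp only [sg]; norm_cast; clear * -; revert q q' r s; decide
  have h7 := h6 _ (S.deltaH_parity hax)
  have e1 : S.shBr (S.delta (cons a x)) (S.delta (cons b y)) =
      S.shBr ((1 : T) ⊗ₜ S.pr (cons a x)) (S.delta (cons b y))
      + S.shBr (consT a (S.delta x)) ((1 : T) ⊗ₜ S.pr (cons b y))
      + S.shBr (consT a (S.delta x)) (consT b (S.delta y)) := by
    rw [S.delta_cons a, map_add, LinearMap.add_apply, add_assoc, ← map_add, ← S.delta_cons b]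
  rw [deltaH_apply, S.delta_B hax hby, e1, map_add, map_add, map_add, map_add, h1, h2, h3, h4, h5,
    ← deltaH_apply, ← deltaH_apply, ← deltaH_cons]
  rw [brDer, LinearMap.add_apply, LinearMap.smul_apply]
  linear_combination (norm := module) h7

theorem brDer_zero (p : ZMod 2) : S.brDer p 0 = 0 := by
  simp [brDer]

theorem deltaH_one : S.deltaH 1 = 0 := by rw [deltaH_apply, delta_one, map_zero]

theorem deltaH_B {p q : ZMod 2} {x y : T} (hx : HasParity p x) (hy : HasParity q y) :
    S.deltaH (A.B x y) = S.brDer p (S.pr x) (S.deltaH y)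
      - sg (p * q) • S.brDer q (S.pr y) (S.deltaH x) := by
  have hadd : ∀ p (h h' : H), S.brDer p (h + h') = S.brDer p h + S.brDer p h' := by
    intro p h h'
    simp only [brDer, map_add, TensorProduct.map_add_left, TensorProduct.map_add_right]
    module
  have hsmul : ∀ p (c : ℝ) (h : H), S.brDer p (c • h) = c • S.brDer p h := by
    intro p c h
    simp only [brDer, map_smul, TensorProduct.map_smul_left, TensorProduct.map_smul_right]
    module
  refine HasParity.induction (C := fun p x => S.deltaH (A.B x y) =
    S.brDer p (S.pr x) (S.deltaH y) - sg (p * q) • S.brDer q (S.pr y) (S.deltaH x))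
    ?_ ?_ ?_ ?_ ?_ hx
  · intros; simp [brDer_zero]
  · intro p x x' h h'
    simp only [map_add, LinearMap.add_apply, h, h', hadd]
    module
  · intro p c x h
    simp only [map_smul, LinearMap.smul_apply, h, hsmul]
    module
  · rw [A.one_B, S.pr_one, brDer_zero, deltaH_one]
    simp
  intro p p' a x ha hx _
  refine HasParity.induction (C := fun q y => S.deltaH (A.B (cons a x) y) =
    S.brDer (p + p') (S.pr (cons a x)) (S.deltaH y)
      - sg ((p + p') * q) • S.brDer q (S.pr y) (S.deltaH (cons a x))) ?_ ?_ ?_ ?_ ?_ hy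
  · intros; simp [brDer_zero]
  · intro p x x' h h'
    simp only [map_add, LinearMap.add_apply, h, h', hadd]
    module
  · intro p c x h
    simp only [map_smul, LinearMap.smul_apply, h, hsmul]
    module
  · rw [A.B_one, S.pr_one, brDer_zero, deltaH_one]
    simp
  · intro q q' b y hb hy _
    exact S.deltaH_B_cons ha hx hb hy

/-- The cobracket of `H`, on words. -/
def cobr : T →ₗ[ℝ] H ⊗[ℝ] H :=
  -((LinearMap.id + koszulSwap) ∘ₗ TensorProduct.map par LinearMap.id ∘ₗ S.deltaH)

theorem cobr_apply (t : T) : S.cobr t = -(TensorProduct.map par LinearMap.id (S.deltaH t) +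
    koszulSwap (TensorProduct.map par LinearMap.id (S.deltaH t))) := rfl

theorem cobr_one : S.cobr 1 = 0 := by rw [cobr_apply, deltaH_one]; simp

theorem map_par_parity {p : ZMod 2} {z : H ⊗[ℝ] H} (hz : HasParity p z) :
    HasParity p (TensorProduct.map par LinearMap.id z) := by
  refine HasParity.tmul_induction ?_ ?_ ?_ hz
  · rw [map_zero]; exact HasParity.zero _
  · intro x y hx hy; rw [map_add]; exact hx.add hy
  · intro r s t h ht hh e
    rw [TensorProduct.map_tmul, ← e]
    exact ht.par.tmul hh

theorem cobr_parity {p : ZMod 2} {t : T} (ht : HasParity p t) : HasParity p (S.cobr t) := by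
  rw [cobr_apply]
  exact ((map_par_parity (S.deltaH_parity ht)).add
    (map_par_parity (S.deltaH_parity ht)).koszulSwap).neg

/-- The two terms of `deltaH_sh` are exchanged by the swap. Its Koszul sign uses shifted parities,
and together with the sign of the first factor this makes everything cancel. -/
theorem cobr_sh {p p' q q' : ZMod 2} {a b : V} {x y : T} (ha : HasParity p a)
    (hx : HasParity p' x) (hb : HasParity q b) (hy : HasParity q' y) :
    S.cobr (sh (cons a x) (cons b y)) = 0 := by
  have hX := S.pr_parity (ha.cons hx)
  have hY := S.pr_parity (hb.cons hy)
  rw [cobr_apply, S.deltaH_sh ha hx hb hy, map_add, map_smul, TensorProduct.map_tmul,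
    TensorProduct.map_tmul, hX.par_eq, hY.par_eq, ← TensorProduct.smul_tmul',
    ← TensorProduct.smul_tmul', map_add, map_smul, map_smul, map_smul, LinearMap.id_apply,
    LinearMap.id_apply, koszulSwap_tmul hX hY, koszulSwap_tmul hY hX]
  match_scalars
  all_goals first
    | ring1
    | simp only [sg]; norm_cast; clear * - p p' q q'; revert p p' q q'; decide

/-- By `delta_M` the product acts on the two pieces of a cut as a derivation, and such an action
commutes with the swap (`kext_koszulSwap`); the remaining work is the passage to shifted signs. -/
theorem cobr_M {p : ZMod 2} {x : T} (hx : HasParity p x) :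
    S.cobr (A.M x) = -kext 1 S.mH (S.cobr x) := by
  have h1 : ∀ z : T ⊗[ℝ] H, S.pr.rTensor H (A.M.rTensor H z) =
      S.mH.rTensor H (S.pr.rTensor H z) := by
    intro z
    induction z with
    | zero => simp
    | add z z' h h' => simp only [map_add, h, h']
    | tmul t h => simp only [LinearMap.rTensor_tmul, S.mH_pr]
  have h2 : ∀ z : T ⊗[ℝ] H, S.pr.rTensor H (TensorProduct.map par S.mH z) =
      -TensorProduct.map par S.mH (S.pr.rTensor H z) := by
    intro z
    induction z with
    | zero => simp
    | add z z' h h' =>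
      simp only [map_add, h, h']
      module
    | tmul t h =>
      rw [TensorProduct.map_tmul, LinearMap.rTensor_tmul, LinearMap.rTensor_tmul,
        TensorProduct.map_tmul, S.pr_par, TensorProduct.neg_tmul]
  have h3 : ∀ w : H ⊗[ℝ] H, TensorProduct.map par LinearMap.id
      (S.mH.rTensor H w - TensorProduct.map par S.mH w) =
      -kext 1 S.mH (TensorProduct.map par LinearMap.id w) := by
    intro w
    refine tmul_parity_induction (C := fun w => TensorProduct.map par LinearMap.id
      (S.mH.rTensor H w - TensorProduct.map par S.mH w) =
      -kext 1 S.mH (TensorProduct.map par LinearMap.id w)) ?_ ?_ ?_ w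
    · simp
    · intro w w' h h'
      simp only [map_add, map_sub] at h h' ⊢
      linear_combination (norm := module) h + h'
    · intro r s v w hv _
      rw [LinearMap.rTensor_tmul, TensorProduct.map_tmul, TensorProduct.map_tmul, map_sub,
        TensorProduct.map_tmul, TensorProduct.map_tmul, kext_tmul _ _ hv.par,
        (S.mH_parity hv).par_eq, hv.par_eq, map_smul, hv.par_eq, map_smul]
      simp only [← TensorProduct.smul_tmul', LinearMap.id_apply]
      match_scalars
      all_goals
        simp only [sg]; norm_cast; clear * -; revert r; decide
  have h4 : S.deltaH (A.M x) = S.mH.rTensor H (S.deltaH x)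
      - TensorProduct.map par S.mH (S.deltaH x) := by
    rw [deltaH_apply, S.delta_M hx, map_add, h1, h2, ← deltaH_apply, sub_eq_add_neg]
  rw [cobr_apply, cobr_apply, h4, h3, map_neg, ← kext_koszulSwap S.mH_parity, map_neg, map_add]
  module

/-- `ℓ(h h') = (-1)^|h| [h, h']`. -/
def ell : H →ₗ[ℝ] H →ₗ[ℝ] H := S.bH ∘ₗ par

theorem ell_apply {p : ZMod 2} {h : H} (hh : HasParity p h) (h' : H) :
    S.ell h h' = sg p • S.bH h h' := by
  rw [ell, LinearMap.comp_apply, hh.par_eq, map_smul, LinearMap.smul_apply]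

theorem ell_parity {p q : ZMod 2} {h h' : H} (hh : HasParity p h) (hh' : HasParity q h') :
    HasParity (p + q + 1) (S.ell h h') := by
  rw [S.ell_apply hh]
  exact (S.bH_parity hh hh').smul _

theorem ell_symm {p q : ZMod 2} {h h' : H} (hh : HasParity p h) (hh' : HasParity q h') :
    S.ell h h' = sg (p * q) • S.ell h' h := by
  rw [S.ell_apply hh, S.ell_apply hh', S.bH_anti hh hh']
  match_scalars
  all_goals first
    | ring1
    | simp only [sg]; norm_cast; clear * - p q; revert p q; decide

/-- This is `deltaH_B` rewritten in terms of `ell` and shifted parities; the actions of the two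
words commute with the swap. -/
theorem cobr_B {p q : ZMod 2} {x y : T} (hx : HasParity p x) (hy : HasParity q y) :
    S.cobr (A.B x y) = -kext p (S.ell (S.pr x)) (S.cobr y)
      + sg (p * q) • kext q (S.ell (S.pr y)) (S.cobr x) := by
  have h3 : ∀ {p : ZMod 2} {h : H}, HasParity (p + 1) h → ∀ w : H ⊗[ℝ] H,
      TensorProduct.map par LinearMap.id (S.brDer p h w) =
      -kext p (S.ell h) (TensorProduct.map par LinearMap.id w) := by
    intro p h hh w
    refine tmul_parity_induction (C := fun w =>
      TensorProduct.map par LinearMap.id (S.brDer p h w) =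
      -kext p (S.ell h) (TensorProduct.map par LinearMap.id w)) ?_ ?_ ?_ w
    · simp
    · intro w w' h h'
      simp only [map_add, h, h']
      module
    · intro r s v w hv _
      rw [S.brDer_tmul _ _ hv, map_add, map_smul, TensorProduct.map_tmul, TensorProduct.map_tmul,
        TensorProduct.map_tmul, kext_tmul _ _ hv.par, S.ell_apply hh, S.ell_apply hh,
        (S.bH_parity hh hv).par_eq, hv.par_eq, map_smul]
      simp only [← TensorProduct.smul_tmul', TensorProduct.tmul_smul, LinearMap.id_apply]
      match_scalars
      all_goals
        simp only [sg]; norm_cast; clear * -; revert p r; decide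
  have hpar : ∀ {p : ZMod 2} {h : H}, HasParity (p + 1) h →
      ∀ {r v}, HasParity r v → HasParity (r + p) (S.ell h v) := by
    intro p h hh r v hv
    exact (S.ell_parity hh hv).congr (by clear * -; revert p r; decide)
  rw [cobr_apply, cobr_apply, cobr_apply, S.deltaH_B hx hy, map_sub, map_smul,
    h3 (S.pr_parity hx), h3 (S.pr_parity hy), map_sub, map_smul, map_neg, map_neg,
    ← kext_koszulSwap (hpar (S.pr_parity hx)), ← kext_koszulSwap (hpar (S.pr_parity hy)), map_neg,
    map_add, map_neg, map_add]
  module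

end ShuffleQuotient

end GInfinity

end

open scoped TensorProduct

noncomputable section

namespace GInfinity

open SuperModule TensorInstances

set_option linter.unusedSectionVars false

/-! ### The graded symmetric algebra -/

section Sym

variable (W : Type*) [AddCommGroup W] [Module ℝ W] [SuperModule W]

/-- The ideal generated by the graded commutators of letters. -/
def symIdeal : Submodule ℝ (TensorAlgebra ℝ W) :=
  Submodule.span ℝ {x | ∃ (P R : TensorAlgebra ℝ W) (p q : ZMod 2) (X Y : W),
    HasParity p X ∧ HasParity q Y ∧
      x = P * (cons X (cons Y R) - sg (p * q) • cons Y (cons X R))}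

/-- The graded symmetric algebra. -/
def Sym : Type _ := TensorAlgebra ℝ W ⧸ symIdeal W

instance : AddCommGroup (Sym W) := inferInstanceAs (AddCommGroup (TensorAlgebra ℝ W ⧸ symIdeal W))

instance : Module ℝ (Sym W) := inferInstanceAs (Module ℝ (TensorAlgebra ℝ W ⧸ symIdeal W))

variable {W}

namespace Sym

/-- The class of a tensor. -/
def mk : TensorAlgebra ℝ W →ₗ[ℝ] Sym W := (symIdeal W).mkQ

theorem mk_surjective : Function.Surjective (mk : TensorAlgebra ℝ W →ₗ[ℝ] Sym W) :=
  (symIdeal W).mkQ_surjective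

theorem mk_eq_zero {x : TensorAlgebra ℝ W} (hx : x ∈ symIdeal W) : (mk x : Sym W) = 0 :=
  (Submodule.Quotient.mk_eq_zero _).2 hx

/-- The descent of a linear map to the symmetric algebra. -/
def lift {M : Type*} [AddCommGroup M] [Module ℝ M] (f : TensorAlgebra ℝ W →ₗ[ℝ] M)
    (h : symIdeal W ≤ LinearMap.ker f) : Sym W →ₗ[ℝ] M := (symIdeal W).liftQ f h

theorem lift_mk {M : Type*} [AddCommGroup M] [Module ℝ M] (f : TensorAlgebra ℝ W →ₗ[ℝ] M)
    (h : symIdeal W ≤ LinearMap.ker f) (t : TensorAlgebra ℝ W) : lift f h (mk t) = f t :=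
  Submodule.liftQ_apply _ _ _

instance : One (Sym W) := ⟨mk 1⟩

theorem cons_mem (X : W) {x : TensorAlgebra ℝ W} (hx : x ∈ symIdeal W) :
    cons X x ∈ symIdeal W := by
  refine Submodule.span_induction (p := fun x _ => cons X x ∈ symIdeal W) ?_ ?_ ?_ ?_ hx
  · rintro x ⟨P, R, p, q, Y, Z, hY, hZ, rfl⟩
    refine Submodule.subset_span ⟨cons X P, R, p, q, Y, Z, hY, hZ, ?_⟩
    simp only [cons, mul_assoc]
  · rw [cons_zero]; exact Submodule.zero_mem _
  · intro x y _ _ hx hy; rw [cons_add]; exact Submodule.add_mem _ hx hy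
  · intro c x _ hx; rw [cons_smul]; exact Submodule.smul_mem _ _ hx

theorem le_ker_mk_consL (X : W) : symIdeal W ≤ LinearMap.ker (mk ∘ₗ consL X) :=
  fun _ hx => mk_eq_zero (cons_mem X hx)

/-- Left multiplication by a letter. -/
def mul : W →ₗ[ℝ] Sym W →ₗ[ℝ] Sym W where
  toFun X := lift (mk ∘ₗ consL X) (le_ker_mk_consL X)
  map_add' X Y := by
    ext r
    obtain ⟨t, rfl⟩ := mk_surjective r
    rw [LinearMap.add_apply, lift_mk, lift_mk, lift_mk]
    simp
  map_smul' c X := by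
    ext r
    obtain ⟨t, rfl⟩ := mk_surjective r
    rw [RingHom.id_apply, LinearMap.smul_apply, lift_mk, lift_mk]
    simp

theorem mul_mk (X : W) (t : TensorAlgebra ℝ W) : mul X (mk t) = mk (cons X t) := lift_mk _ _ _

theorem mul_comm {p q : ZMod 2} {X Y : W} (hX : HasParity p X) (hY : HasParity q Y) (r : Sym W) :
    mul X (mul Y r) = sg (p * q) • mul Y (mul X r) := by
  obtain ⟨t, rfl⟩ := mk_surjective r
  rw [← sub_eq_zero, mul_mk, mul_mk, mul_mk, mul_mk, ← map_smul, ← map_sub]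
  exact mk_eq_zero (Submodule.subset_span ⟨1, t, p, q, X, Y, hX, hY, (one_mul _).symm⟩)

theorem par_mul_tensor (x y : TensorAlgebra ℝ W) : par (x * y) = par x * par y :=
  map_mul (TensorAlgebra.lift ℝ (TensorAlgebra.ι ℝ ∘ₗ par)) x y

theorem par_mem {x : TensorAlgebra ℝ W} (hx : x ∈ symIdeal W) : par x ∈ symIdeal W := by
  refine Submodule.span_induction (p := fun x _ => par x ∈ symIdeal W) ?_ ?_ ?_ ?_ hx
  · rintro x ⟨P, R, p, q, Y, Z, hY, hZ, rfl⟩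
    rw [par_mul_tensor, map_sub, map_smul, par_cons, par_cons, par_cons, par_cons]
    exact Submodule.subset_span ⟨par P, par R, p, q, par Y, par Z, hY.par, hZ.par, rfl⟩
  · rw [map_zero]; exact Submodule.zero_mem _
  · intro x y _ _ hx hy; rw [map_add]; exact Submodule.add_mem _ hx hy
  · intro c x _ hx; rw [map_smul]; exact Submodule.smul_mem _ _ hx

theorem le_ker_mk_par : symIdeal W ≤ LinearMap.ker (mk ∘ₗ (par : TensorAlgebra ℝ W →ₗ[ℝ] _)) :=
  fun _ hx => mk_eq_zero (par_mem hx)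

instance : SuperModule (Sym W) where
  par := lift (mk ∘ₗ par) le_ker_mk_par
  par_par r := by
    obtain ⟨t, rfl⟩ := mk_surjective r
    rw [lift_mk, LinearMap.comp_apply, lift_mk, LinearMap.comp_apply, par_par]

theorem par_mk (t : TensorAlgebra ℝ W) : par (mk t : Sym W) = mk (par t) := lift_mk _ _ _

theorem HasParity.mk {p : ZMod 2} {t : TensorAlgebra ℝ W} (ht : HasParity p t) :
    HasParity p (mk t : Sym W) := by
  rw [HasParity, par_mk, ht.par_eq, map_smul]

theorem one_parity : HasParity 0 (1 : Sym W) := HasParity.mk HasParity.one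

theorem mul_parity {p q : ZMod 2} {X : W} {r : Sym W} (hX : HasParity p X) (hr : HasParity q r) :
    HasParity (p + q) (mul X r) := by
  obtain ⟨t, rfl⟩ := mk_surjective r
  rw [HasParity, mul_mk, par_mk, par_cons, hX.par_eq, ← mul_mk, ← par_mk, hr.par_eq, map_smul,
    map_smul, LinearMap.smul_apply, smul_smul, sg_add, _root_.mul_comm (sg q), mul_mk]

theorem induction {C : ZMod 2 → Sym W → Prop} (h0 : ∀ p, C p 0)
    (hadd : ∀ p x y, C p x → C p y → C p (x + y)) (hsmul : ∀ p (c : ℝ) x, C p x → C p (c • x))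
    (h1 : C 0 1)
    (hmul : ∀ p q X r, HasParity p X → HasParity q r → C q r → C (p + q) (mul X r))
    {p : ZMod 2} {r : Sym W} (hr : HasParity p r) : C p r := by
  obtain ⟨t, rfl⟩ := mk_surjective r
  -- The representative need not be homogeneous, but its component of parity `p` represents the same
  -- element.
  have h2 : (mk t : Sym W) = mk (proj p t) := by
    rw [← hr.proj_self, proj_apply, proj_apply, par_mk]
    simp only [map_add, map_smul]
  rw [h2]
  refine HasParity.induction (C := fun p t => C p (mk t)) ?_ ?_ ?_ ?_ ?_ (hasParity_proj p t)
  · intro p; rw [map_zero]; exact h0 p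
  · intro p x y hx hy; rw [map_add]; exact hadd _ _ _ hx hy
  · intro p c x hx; rw [map_smul]; exact hsmul _ _ _ hx
  · exact h1
  · intro p q X t hX ht ih
    rw [← mul_mk]
    exact hmul _ _ _ _ hX (HasParity.mk ht) ih

theorem induction_mul {C : Sym W → Prop} (hadd : ∀ x y, C x → C y → C (x + y))
    (hsmul : ∀ (c : ℝ) x, C x → C (c • x)) (h1 : C 1)
    (hmul : ∀ p X r, HasParity p X → C r → C (mul X r)) (r : Sym W) : C r := by
  obtain ⟨t, rfl⟩ := mk_surjective r
  induction t using tensor_induction with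
  | hadd x y hx hy => rw [map_add]; exact hadd _ _ hx hy
  | hsmul c x hx => rw [map_smul]; exact hsmul _ _ hx
  | h1 => exact h1
  | hcons X t ih =>
    rw [← mul_mk, ← proj_add_proj X, map_add, LinearMap.add_apply]
    exact hadd _ _ (hmul 0 _ _ (hasParity_proj _ _) ih) (hmul 1 _ _ (hasParity_proj _ _) ih)

theorem hom_ext {M : Type*} [AddCommGroup M] [Module ℝ M] {f g : Sym W →ₗ[ℝ] M} (h1 : f 1 = g 1)
    (hmul : ∀ p X r, HasParity p X → f r = g r → f (mul X r) = g (mul X r)) : f = g := by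
  refine LinearMap.ext (induction_mul ?_ ?_ h1 hmul)
  · intro x y hx hy; rw [map_add, map_add, hx, hy]
  · intro c x hx; rw [map_smul, map_smul, hx]

section Rec

variable {M : Type*} [AddCommGroup M] [Module ℝ M]

/-- The conditions under which a primitive recursion descends to the symmetric algebra. -/
structure RecData (c : W →ₗ[ℝ] Module.End ℝ M) (d : W →ₗ[ℝ] Sym W →ₗ[ℝ] M) : Prop where
  comm : ∀ {p q : ZMod 2} {X Y : W}, HasParity p X → HasParity q Y → ∀ m,
    c X (c Y m) = sg (p * q) • c Y (c X m)
  mixed : ∀ {p q : ZMod 2} {X Y : W}, HasParity p X → HasParity q Y → ∀ r,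
    c X (d Y r) + d X (mul Y r) = sg (p * q) • (c Y (d X r) + d Y (mul X r))

variable {c : W →ₗ[ℝ] Module.End ℝ M} {d : W →ₗ[ℝ] Sym W →ₗ[ℝ] M}

/-- The two conditions say that the recursion agrees on `X Y R` and on its signed exchange.
Prefixing further letters preserves this: the inhomogeneous term takes its argument in the symmetric
algebra, where the difference is already `0`. -/
theorem RecData.le_ker (h : RecData c d) (m₀ : M) :
    symIdeal W ≤ LinearMap.ker (recT c m₀ (d.compl₂ Sym.mk)) := by
  refine Submodule.span_le.2 ?_
  rintro x ⟨P, R, p, q, X, Y, hX, hY, rfl⟩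
  have key : ∀ P : TensorAlgebra ℝ W, recT c m₀ (d.compl₂ Sym.mk)
      (P * (cons X (cons Y R) - sg (p * q) • cons Y (cons X R))) = 0 := by
    intro P
    induction P using tensor_induction with
    | hadd x y hx hy => rw [add_mul, map_add, hx, hy, add_zero]
    | hsmul r x hx => rw [smul_mul_assoc, map_smul, hx, smul_zero]
    | h1 =>
      have h2 := h.comm hX hY (recT c m₀ (d.compl₂ Sym.mk) R)
      have h3 := h.mixed hX hY (Sym.mk R)
      rw [mul_mk, mul_mk] at h3
      rw [one_mul, map_sub, map_smul]
      simp only [recT_cons, LinearMap.compl₂_apply, map_add]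
      linear_combination (norm := module) h2 + h3
    | hcons Z P ih =>
      have h2 : (Sym.mk (P * (cons X (cons Y R) - sg (p * q) • cons Y (cons X R))) : Sym W) = 0 :=
        mk_eq_zero (Submodule.subset_span ⟨P, R, p, q, X, Y, hX, hY, rfl⟩)
      have h3 : cons Z P * (cons X (cons Y R) - sg (p * q) • cons Y (cons X R)) =
          cons Z (P * (cons X (cons Y R) - sg (p * q) • cons Y (cons X R))) := mul_assoc _ _ _
      rw [h3, recT_cons, ih, LinearMap.compl₂_apply, h2, map_zero, map_zero, add_zero]
  exact key P

/-- Primitive recursion on the symmetric algebra. -/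
def recS (h : RecData c d) (m₀ : M) : Sym W →ₗ[ℝ] M := lift _ (h.le_ker m₀)

theorem recS_one (h : RecData c d) (m₀ : M) : recS h m₀ 1 = m₀ := by
  change recS h m₀ (Sym.mk 1) = m₀
  rw [recS, lift_mk, recT_one]

theorem recS_mul (h : RecData c d) (m₀ : M) (X : W) (r : Sym W) :
    recS h m₀ (mul X r) = c X (recS h m₀ r) + d X r := by
  obtain ⟨t, rfl⟩ := mk_surjective r
  rw [mul_mk, recS, lift_mk, lift_mk, recT_cons, LinearMap.compl₂_apply]

end Rec

/-! ### The tensor square -/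

/-- Multiplication of the first factor by a letter. -/
def lft : W →ₗ[ℝ] Module.End ℝ (Sym W ⊗[ℝ] Sym W) := LinearMap.rTensorHom (Sym W) ∘ₗ mul

/-- Multiplication of the second factor by a letter. -/
def rgt : W →ₗ[ℝ] Module.End ℝ (Sym W ⊗[ℝ] Sym W) :=
  LinearMap.lTensorHom (Sym W) ∘ₗ mul ∘ₗ proj 0 +
    (TensorProduct.mapBilinear (RingHom.id ℝ) (Sym W) (Sym W) (Sym W) (Sym W) par) ∘ₗ mul ∘ₗ proj 1

theorem lft_tmul (X : W) (r s : Sym W) : lft X (r ⊗ₜ s) = mul X r ⊗ₜ s := rfl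

theorem rgt_tmul {p q : ZMod 2} {X : W} {r : Sym W} (hX : HasParity p X) (hr : HasParity q r)
    (s : Sym W) : rgt X (r ⊗ₜ s) = sg (p * q) • r ⊗ₜ mul X s := by
  have h2 : ∀ p : ZMod 2, p = 0 ∨ p = 1 := by decide
  rw [rgt, LinearMap.add_apply, LinearMap.comp_apply, LinearMap.comp_apply, LinearMap.comp_apply,
    LinearMap.comp_apply]
  rcases h2 p with rfl | rfl
  · rw [hX.proj_self, hX.proj_of_ne (q := 1) (by decide)]
    simp [sg_zero]
  · rw [hX.proj_self, hX.proj_of_ne (q := 0) (by decide)]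
    simp [hr.par_eq, TensorProduct.smul_tmul']

theorem lft_lft {p q : ZMod 2} {X Y : W} (hX : HasParity p X) (hY : HasParity q Y)
    (z : Sym W ⊗[ℝ] Sym W) : lft X (lft Y z) = sg (p * q) • lft Y (lft X z) := by
  induction z with
  | zero => simp
  | add z z' h h' => simp only [map_add, h, h', smul_add]
  | tmul r s =>
    rw [lft_tmul, lft_tmul, lft_tmul, lft_tmul, mul_comm hX hY, TensorProduct.smul_tmul']

theorem lft_rgt {p q : ZMod 2} {X Y : W} (hX : HasParity p X) (hY : HasParity q Y)
    (z : Sym W ⊗[ℝ] Sym W) : rgt X (lft Y z) = sg (p * q) • lft Y (rgt X z) := by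
  refine tmul_parity_induction (C := fun z : Sym W ⊗[ℝ] Sym W =>
    rgt X (lft Y z) = sg (p * q) • lft Y (rgt X z)) ?_ ?_ ?_ z
  · simp
  · intro z z' h h'; simp only [map_add, h, h', smul_add]
  · intro a b r s hr _
    rw [lft_tmul, rgt_tmul hX (mul_parity hY hr), rgt_tmul hX hr, map_smul, lft_tmul]
    match_scalars
    all_goals
      simp only [sg]; norm_cast; clear * -; revert p q a; decide

theorem rgt_rgt {p q : ZMod 2} {X Y : W} (hX : HasParity p X) (hY : HasParity q Y)
    (z : Sym W ⊗[ℝ] Sym W) : rgt X (rgt Y z) = sg (p * q) • rgt Y (rgt X z) := by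
  refine tmul_parity_induction (C := fun z : Sym W ⊗[ℝ] Sym W =>
    rgt X (rgt Y z) = sg (p * q) • rgt Y (rgt X z)) ?_ ?_ ?_ z
  · simp
  · intro z z' h h'; simp only [map_add, h, h', smul_add]
  · intro a b r s hr _
    rw [rgt_tmul hY hr, rgt_tmul hX hr, map_smul, map_smul, rgt_tmul hX hr, rgt_tmul hY hr,
      mul_comm hX hY, TensorProduct.tmul_smul]
    match_scalars
    all_goals
      simp only [sg]; norm_cast; clear * -; revert p q a; decide

/-- Multiplication by `X ⊗ 1 + 1 ⊗ X`. -/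
def cop : W →ₗ[ℝ] Module.End ℝ (Sym W ⊗[ℝ] Sym W) := lft + rgt

theorem cop_apply (X : W) (z : Sym W ⊗[ℝ] Sym W) : cop X z = lft X z + rgt X z := rfl

theorem lft_cop {p q : ZMod 2} {X Y : W} (hX : HasParity p X) (hY : HasParity q Y)
    (z : Sym W ⊗[ℝ] Sym W) : lft X (cop Y z) = sg (p * q) • cop Y (lft X z) := by
  rw [cop_apply, cop_apply, map_add, lft_lft hX hY, lft_rgt hY hX]
  match_scalars
  all_goals first
    | ring1
    | simp only [sg]; norm_cast; clear * - p q; revert p q; decide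

theorem rgt_cop {p q : ZMod 2} {X Y : W} (hX : HasParity p X) (hY : HasParity q Y)
    (z : Sym W ⊗[ℝ] Sym W) : rgt X (cop Y z) = sg (p * q) • cop Y (rgt X z) := by
  rw [cop_apply, cop_apply, map_add, rgt_rgt hX hY, lft_rgt hX hY, smul_add]

theorem cop_cop {p q : ZMod 2} {X Y : W} (hX : HasParity p X) (hY : HasParity q Y)
    (z : Sym W ⊗[ℝ] Sym W) : cop X (cop Y z) = sg (p * q) • cop Y (cop X z) := by
  rw [cop_apply X, lft_cop hX hY, rgt_cop hX hY, ← smul_add, ← map_add]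
  rfl

/-- Multiplication by an element of `W ⊗ W`. -/
def mul₂ : W ⊗[ℝ] W →ₗ[ℝ] Module.End ℝ (Sym W ⊗[ℝ] Sym W) :=
  TensorProduct.lift ((LinearMap.mul ℝ (Module.End ℝ (Sym W ⊗[ℝ] Sym W))).compl₁₂ lft rgt)

theorem mul₂_tmul (U V : W) (z : Sym W ⊗[ℝ] Sym W) : mul₂ (U ⊗ₜ V) z = lft U (rgt V z) := by
  rw [mul₂, TensorProduct.lift.tmul]
  rfl

theorem mul₂_cop {e q : ZMod 2} {w : W ⊗[ℝ] W} {Y : W} (hw : HasParity e w) (hY : HasParity q Y)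
    (z : Sym W ⊗[ℝ] Sym W) : mul₂ w (cop Y z) = sg (e * q) • cop Y (mul₂ w z) := by
  refine HasParity.tmul_induction ?_ ?_ ?_ hw
  · simp
  · intro w w' h h'; simp only [map_add, LinearMap.add_apply, h, h', smul_add]
  · intro u v U V hU hV h
    rw [mul₂_tmul, mul₂_tmul, rgt_cop hV hY, map_smul, lft_cop hU hY, smul_smul, ← sg_add, ← h]
    congr 2
    ring

section KoszulExt

variable {e : ZMod 2} {D : Sym W →ₗ[ℝ] Sym W}

theorem kext_lft {p : ZMod 2} {X : W} (hX : HasParity p X) {D' : Sym W →ₗ[ℝ] Sym W}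
    (h : ∀ r, D (mul X r) = D' r + sg (e * p) • mul X (D r)) (z : Sym W ⊗[ℝ] Sym W) :
    kext e D (lft X z) = TensorProduct.map D' LinearMap.id z + sg (e * p) • lft X (kext e D z) := by
  refine tmul_parity_induction (C := fun z : Sym W ⊗[ℝ] Sym W => kext e D (lft X z) =
    TensorProduct.map D' LinearMap.id z + sg (e * p) • lft X (kext e D z)) ?_ ?_ ?_ z
  · simp
  · intro z z' h h'
    simp only [map_add, h, h']
    module
  · intro a b r s hr _
    rw [lft_tmul, kext_tmul _ _ (mul_parity hX hr), kext_tmul _ _ hr, map_add, map_smul, lft_tmul,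
      lft_tmul, TensorProduct.map_tmul, h, TensorProduct.add_tmul, ← TensorProduct.smul_tmul',
      LinearMap.id_apply]
    match_scalars
    all_goals first
      | ring1
      | simp only [sg]; norm_cast; clear * - p a e; revert p a e; decide

theorem kext_rgt (hD : ∀ {p r}, HasParity p r → HasParity (p + e) (D r)) {p : ZMod 2} {X : W}
    (hX : HasParity p X) {D' : Sym W →ₗ[ℝ] Sym W}
    (h : ∀ r, D (mul X r) = D' r + sg (e * p) • mul X (D r)) (z : Sym W ⊗[ℝ] Sym W) :
    kext e D (rgt X z) = TensorProduct.map (parPow (e + p)) D' z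
      + sg (e * p) • rgt X (kext e D z) := by
  refine tmul_parity_induction (C := fun z : Sym W ⊗[ℝ] Sym W => kext e D (rgt X z) =
    TensorProduct.map (parPow (e + p)) D' z + sg (e * p) • rgt X (kext e D z)) ?_ ?_ ?_ z
  · simp
  · intro z z' h h'
    simp only [map_add, h, h']
    module
  · intro a b r s hr _
    rw [rgt_tmul hX hr, map_smul, kext_tmul _ _ hr, kext_tmul _ _ hr, map_add, map_smul,
      rgt_tmul hX hr, rgt_tmul hX (hD hr), TensorProduct.map_tmul, h, TensorProduct.tmul_add,
      TensorProduct.tmul_smul, hr.parPow, ← TensorProduct.smul_tmul']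
    match_scalars
    all_goals first
      | ring1
      | simp only [sg]; norm_cast; clear * - p a e; revert p a e; decide

/-- Here `D'` is the graded commutator of `D` with multiplication by `X`. It is again a
multiplication by a letter when `D` is `mS` or `ad`, and it is `ad X` when `D` is the second order
operator `lS`. -/
theorem kext_cop (hD : ∀ {p r}, HasParity p r → HasParity (p + e) (D r)) {p : ZMod 2} {X : W}
    (hX : HasParity p X) {D' : Sym W →ₗ[ℝ] Sym W}
    (h : ∀ r, D (mul X r) = D' r + sg (e * p) • mul X (D r)) (z : Sym W ⊗[ℝ] Sym W) :
    kext e D (cop X z) = kext (e + p) D' z + sg (e * p) • cop X (kext e D z) := by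
  rw [cop_apply, map_add, kext_lft hX h, kext_rgt hD hX h, cop_apply, kext, kext,
    LinearMap.add_apply (TensorProduct.map D' _)]
  module

theorem kext_mul {p : ZMod 2} {X : W} (hX : HasParity p X) (z : Sym W ⊗[ℝ] Sym W) :
    kext p (mul X) z = cop X z := by
  refine tmul_parity_induction (C := fun z : Sym W ⊗[ℝ] Sym W => kext p (mul X) z = cop X z)
    ?_ ?_ ?_ z
  · simp
  · intro z z' h h'
    simp only [map_add, h, h']
  · intro a b r s hr _
    rw [kext_tmul _ _ hr, cop_apply, lft_tmul, rgt_tmul hX hr]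

theorem kext_mul₂ (hD : ∀ {p r}, HasParity p r → HasParity (p + e) (D r)) {f : W →ₗ[ℝ] W}
    (hf : ∀ {p X}, HasParity p X → HasParity (p + e) (f X))
    (h : ∀ {p X}, HasParity p X → ∀ r, D (mul X r) = mul (f X) r + sg (e * p) • mul X (D r))
    {p : ZMod 2} {w : W ⊗[ℝ] W} (hw : HasParity p w) (z : Sym W ⊗[ℝ] Sym W) :
    kext e D (mul₂ w z) = mul₂ (kext e f w) z + sg (e * p) • mul₂ w (kext e D z) := by
  refine HasParity.tmul_induction ?_ ?_ ?_ hw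
  · simp
  · intro w w' h h'
    simp only [map_add, LinearMap.add_apply, h, h', smul_add]
    abel
  · intro u v U V hU hV e'
    have h1 : ∀ z : Sym W ⊗[ℝ] Sym W, TensorProduct.map (mul (f U)) LinearMap.id z = lft (f U) z :=
      fun z => rfl
    have h2 : ∀ z : Sym W ⊗[ℝ] Sym W,
        TensorProduct.map (parPow (e + v)) (mul (f V)) z = rgt (f V) z := by
      intro z
      refine tmul_parity_induction (C := fun z : Sym W ⊗[ℝ] Sym W =>
        TensorProduct.map (parPow (e + v)) (mul (f V)) z = rgt (f V) z) ?_ ?_ ?_ z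
      · simp
      · intro z z' h h'
        simp only [map_add, h, h']
      · intro a b r s hr _
        rw [TensorProduct.map_tmul, hr.parPow, rgt_tmul (hf hV) hr, add_comm e v,
          ← TensorProduct.smul_tmul']
    rw [mul₂_tmul, mul₂_tmul, kext_lft hU (h hU), kext_rgt hD hV (h hV), h1, h2, map_add, map_smul,
      kext_tmul _ _ hU, map_add, map_smul, LinearMap.add_apply, LinearMap.smul_apply, mul₂_tmul,
      mul₂_tmul, ← e', mul_add, sg_add]
    module

end KoszulExt

end Sym

end Sym

end GInfinity

end

/-! ### Product, bracket and cobracket on the symmetric algebra -/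

open scoped TensorProduct

noncomputable section

namespace GInfinity

open SuperModule TensorInstances

set_option linter.unusedSectionVars false

/-- A shifted product, bracket and cobracket on a super vector space, where the bracket is
supersymmetric and the product and the bracket are compatible with the cobracket. -/
structure SymData (W : Type*) [AddCommGroup W] [Module ℝ W] [SuperModule W] where
  m0 : W →ₗ[ℝ] W
  l2 : W →ₗ[ℝ] W →ₗ[ℝ] W
  k0 : W →ₗ[ℝ] W ⊗[ℝ] W
  m0_parity : ∀ {p : ZMod 2} {X : W}, HasParity p X → HasParity (p + 1) (m0 X)
  l2_parity : ∀ {p q : ZMod 2} {X Y : W}, HasParity p X → HasParity q Y →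
    HasParity (p + q + 1) (l2 X Y)
  l2_symm : ∀ {p q : ZMod 2} {X Y : W}, HasParity p X → HasParity q Y →
    l2 X Y = sg (p * q) • l2 Y X
  k0_parity : ∀ {p : ZMod 2} {X : W}, HasParity p X → HasParity (p + 1) (k0 X)
  k0_m0 : ∀ X : W, kext 1 m0 (k0 X) = -k0 (m0 X)
  k0_l2 : ∀ {p q : ZMod 2} {X Y : W}, HasParity p X → HasParity q Y →
    k0 (l2 X Y) = -(sg p • kext (p + 1) (l2 X) (k0 Y))
      - sg ((p + 1) * q) • kext (q + 1) (l2 Y) (k0 X)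

namespace SymData

open _root_.GInfinity.Sym

variable {W : Type*} [AddCommGroup W] [Module ℝ W] [SuperModule W] (S : SymData W)

/-! ### The recursive definitions -/

theorem mS_rec : RecData (mul ∘ₗ par) (mul ∘ₗ S.m0) where
  comm hX hY _ := mul_comm hX.par hY.par _
  mixed {p q X Y} hX hY r := by
    simp only [LinearMap.comp_apply]
    rw [hX.par_eq, hY.par_eq, map_smul, map_smul, LinearMap.smul_apply, LinearMap.smul_apply,
      mul_comm hX (S.m0_parity hY), mul_comm (S.m0_parity hX) hY]
    match_scalars
    all_goals first
      | ring1
      | simp only [sg]; norm_cast; clear * - p q; revert p q; decide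

/-- The extension of the product to the symmetric algebra. -/
def mS : Sym W →ₗ[ℝ] Sym W := recS S.mS_rec 0

theorem mS_one : S.mS 1 = 0 := recS_one _ _

theorem mS_mul {p : ZMod 2} {X : W} (hX : HasParity p X) (r : Sym W) :
    S.mS (mul X r) = mul (S.m0 X) r + sg p • mul X (S.mS r) := by
  rw [mS, recS_mul, LinearMap.comp_apply, LinearMap.comp_apply, hX.par_eq, map_smul,
    LinearMap.smul_apply, add_comm]

/-- The recursion coefficient of `ad`. -/
def adC : W →ₗ[ℝ] Module.End ℝ (W →ₗ[ℝ] Sym W) :=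
  LinearMap.mk₂ ℝ (fun Y F => mul (proj 0 Y) ∘ₗ F - mul (proj 1 Y) ∘ₗ F ∘ₗ par)
    (by intro Y Y' F; ext X; simp; abel) (by intro c Y F; ext X; simp [smul_sub])
    (by intro Y F F'; ext X; simp; abel) (by intro c Y F; ext X; simp [smul_sub])

theorem adC_apply {p q : ZMod 2} {X Y : W} (hX : HasParity p X) (hY : HasParity q Y)
    (F : W →ₗ[ℝ] Sym W) : adC Y F X = sg ((p + 1) * q) • mul Y (F X) := by
  have h2 : ∀ p : ZMod 2, p = 0 ∨ p = 1 := by decide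
  change mul (proj 0 Y) (F X) - mul (proj 1 Y) (F (par X)) = _
  rcases h2 q with rfl | rfl
  · rw [hY.proj_self, hY.proj_of_ne (q := 1) (by decide)]
    simp [sg_zero]
  · rw [hY.proj_self, hY.proj_of_ne (q := 0) (by decide), hX.par_eq]
    simp [sg_add, sg_one]

/-- The inhomogeneous term of the recursion of `ad`. -/
def adD : W →ₗ[ℝ] Sym W →ₗ[ℝ] W →ₗ[ℝ] Sym W :=
  LinearMap.mk₂ ℝ (fun Y r => mul.flip r ∘ₗ S.l2.flip Y)
    (by intro Y Y' r; ext X; simp) (by intro c Y r; ext X; simp)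
    (by intro Y r r'; ext X; simp) (by intro c Y r; ext X; simp)

theorem adD_apply (X Y : W) (r : Sym W) : S.adD Y r X = mul (S.l2 X Y) r := rfl

/-- The recursion runs over the second argument of `ad` and takes values in linear maps from `W`, so
that linearity in the first argument comes for free. -/
theorem ad_rec : RecData adC S.adD where
  comm {p q Y Z} hY hZ F := by
    refine linearMap_ext_parity ?_
    intro x X hX
    rw [LinearMap.smul_apply, adC_apply hX hY, adC_apply hX hZ, adC_apply hX hZ, adC_apply hX hY,
      map_smul, map_smul, mul_comm hY hZ]
    match_scalars
    ring1
  mixed {p q Y Z} hY hZ r := by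
    refine linearMap_ext_parity ?_
    intro x X hX
    rw [LinearMap.smul_apply, LinearMap.add_apply, LinearMap.add_apply, adC_apply hX hY,
      adC_apply hX hZ, adD_apply, adD_apply, adD_apply, adD_apply,
      mul_comm hY (S.l2_parity hX hZ), mul_comm (S.l2_parity hX hY) hZ]
    match_scalars
    all_goals first
      | ring1
      | simp only [sg]; norm_cast; clear * - p q x; revert p q x; decide

/-- The extension of the bracket with an element to the symmetric algebra. -/
def ad : W →ₗ[ℝ] Sym W →ₗ[ℝ] Sym W := (recS S.ad_rec 0).flip

theorem ad_one (X : W) : S.ad X 1 = 0 := by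
  rw [ad, LinearMap.flip_apply, recS_one, LinearMap.zero_apply]

theorem ad_mul {p q : ZMod 2} {X Y : W} (hX : HasParity p X) (hY : HasParity q Y) (r : Sym W) :
    S.ad X (mul Y r) = mul (S.l2 X Y) r + sg ((p + 1) * q) • mul Y (S.ad X r) := by
  rw [ad, LinearMap.flip_apply, LinearMap.flip_apply, recS_mul, LinearMap.add_apply,
    adC_apply hX hY, adD_apply, add_comm]

/-- The mixed condition rests on the symmetry of `l2`, by which the bracket of `X` and `Y` is
counted once whichever comes first; the remaining terms match in pairs. -/
theorem lS_rec : RecData (mul ∘ₗ par) S.ad where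
  comm hX hY _ := mul_comm hX.par hY.par _
  mixed {p q X Y} hX hY r := by
    simp only [LinearMap.comp_apply]
    rw [hX.par_eq, hY.par_eq, map_smul, map_smul, LinearMap.smul_apply, LinearMap.smul_apply,
      S.ad_mul hX hY, S.ad_mul hY hX, S.l2_symm hX hY, map_smul, LinearMap.smul_apply]
    match_scalars
    all_goals first
      | ring1
      | simp only [sg]; norm_cast; clear * - p q; revert p q; decide

/-- The extension of the bracket to the symmetric algebra. -/
def lS : Sym W →ₗ[ℝ] Sym W := recS S.lS_rec 0

theorem lS_one : S.lS 1 = 0 := recS_one _ _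

theorem lS_mul {p : ZMod 2} {X : W} (hX : HasParity p X) (r : Sym W) :
    S.lS (mul X r) = S.ad X r + sg p • mul X (S.lS r) := by
  rw [lS, recS_mul, LinearMap.comp_apply, hX.par_eq, map_smul, LinearMap.smul_apply, add_comm]

end SymData

namespace Sym

variable {W : Type*} [AddCommGroup W] [Module ℝ W] [SuperModule W]

theorem coproduct_rec : RecData (cop : W →ₗ[ℝ] _) 0 where
  comm hX hY _ := cop_cop hX hY _
  mixed _ _ _ := by simp

/-- The unshuffle coproduct. -/
def coproduct : Sym W →ₗ[ℝ] Sym W ⊗[ℝ] Sym W := recS coproduct_rec (1 ⊗ₜ 1)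

theorem coproduct_one : coproduct (1 : Sym W) = 1 ⊗ₜ 1 := recS_one _ _

theorem coproduct_mul (X : W) (r : Sym W) : coproduct (mul X r) = cop X (coproduct r) := by
  rw [coproduct, recS_mul]
  simp

end Sym

namespace SymData

open _root_.GInfinity.Sym

variable {W : Type*} [AddCommGroup W] [Module ℝ W] [SuperModule W] (S : SymData W)

/-- Multiplications on the tensor square commute in the graded sense, in particular `mul₂ (S.k0 X)`
and `cop Y`. -/
theorem cobracket_rec : RecData (cop ∘ₗ par) ((LinearMap.lcomp ℝ _ coproduct) ∘ₗ mul₂ ∘ₗ S.k0) where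
  comm hX hY _ := cop_cop hX.par hY.par _
  mixed {p q X Y} hX hY r := by
    change cop (par X) (mul₂ (S.k0 Y) (coproduct r)) + mul₂ (S.k0 X) (coproduct (mul Y r)) =
      sg (p * q) • (cop (par Y) (mul₂ (S.k0 X) (coproduct r)) +
        mul₂ (S.k0 Y) (coproduct (mul X r)))
    rw [hX.par_eq, hY.par_eq, map_smul, map_smul, LinearMap.smul_apply, LinearMap.smul_apply,
      coproduct_mul, coproduct_mul, mul₂_cop (S.k0_parity hX) hY, mul₂_cop (S.k0_parity hY) hX]
    match_scalars
    all_goals first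
      | ring1
      | simp only [sg]; norm_cast; clear * - p q; revert p q; decide

/-- The extension of the cobracket to the symmetric algebra. -/
def cobracket : Sym W →ₗ[ℝ] Sym W ⊗[ℝ] Sym W := recS S.cobracket_rec 0

theorem cobracket_one : S.cobracket 1 = 0 := recS_one _ _

theorem cobracket_mul {p : ZMod 2} {X : W} (hX : HasParity p X) (r : Sym W) :
    S.cobracket (mul X r) = sg p • cop X (S.cobracket r) + mul₂ (S.k0 X) (coproduct r) := by
  rw [cobracket, recS_mul, LinearMap.comp_apply, hX.par_eq, map_smul, LinearMap.smul_apply]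
  rfl

theorem mS_parity {p : ZMod 2} {r : Sym W} (hr : HasParity p r) : HasParity (p + 1) (S.mS r) := by
  refine Sym.induction (C := fun p r => HasParity (p + 1) (S.mS r)) ?_ ?_ ?_ ?_ ?_ hr
  · intro p; rw [map_zero]; exact HasParity.zero _
  · intro p x y hx hy; rw [map_add]; exact hx.add hy
  · intro p c x hx; rw [map_smul]; exact hx.smul c
  · rw [mS_one]; exact HasParity.zero _
  · intro p q X r hX hr ih
    rw [S.mS_mul hX]
    exact ((mul_parity (S.m0_parity hX) hr).congr (by ring)).add
      (((mul_parity hX ih).smul _).congr (by ring))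

theorem ad_parity {p q : ZMod 2} {X : W} {r : Sym W} (hX : HasParity p X) (hr : HasParity q r) :
    HasParity (q + (p + 1)) (S.ad X r) := by
  refine Sym.induction (C := fun q r => HasParity (q + (p + 1)) (S.ad X r)) ?_ ?_ ?_ ?_ ?_ hr
  · intro p; rw [map_zero]; exact HasParity.zero _
  · intro p x y hx hy; rw [map_add]; exact hx.add hy
  · intro p c x hx; rw [map_smul]; exact hx.smul c
  · rw [ad_one]; exact HasParity.zero _
  · intro q q' Y r hY hr ih
    rw [S.ad_mul hX hY]
    exact ((mul_parity (S.l2_parity hX hY) hr).congr (by ring)).add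
      (((mul_parity hY ih).smul _).congr (by ring))

theorem lS_parity {p : ZMod 2} {r : Sym W} (hr : HasParity p r) : HasParity (p + 1) (S.lS r) := by
  refine Sym.induction (C := fun p r => HasParity (p + 1) (S.lS r)) ?_ ?_ ?_ ?_ ?_ hr
  · intro p; rw [map_zero]; exact HasParity.zero _
  · intro p x y hx hy; rw [map_add]; exact hx.add hy
  · intro p c x hx; rw [map_smul]; exact hx.smul c
  · rw [lS_one]; exact HasParity.zero _
  · intro p q X r hX hr ih
    rw [S.lS_mul hX]
    exact ((S.ad_parity hX hr).congr (by ring)).add (((mul_parity hX ih).smul _).congr (by ring))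

/-! ### Coderivations -/

/-- The commutator of `mS` with a letter is multiplication by a letter, on `Sym W` as well as on the
tensor square (`kext_mul`), so both sides obey the same recursion. -/
theorem mS_coproduct : kext 1 S.mS ∘ₗ coproduct = coproduct ∘ₗ S.mS := by
  refine hom_ext ?_ ?_
  · rw [LinearMap.comp_apply, LinearMap.comp_apply, mS_one, coproduct_one,
      kext_tmul _ _ one_parity, mS_one]
    simp
  · intro p X r hX ih
    simp only [LinearMap.comp_apply] at ih ⊢
    rw [S.mS_mul hX, map_add, map_smul, coproduct_mul, coproduct_mul, coproduct_mul,
      kext_cop S.mS_parity hX (D' := mul (S.m0 X)) (fun r => by rw [S.mS_mul hX, one_mul]),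
      add_comm 1 p, kext_mul (S.m0_parity hX), one_mul, ih]

theorem kext_ad_cop {p q : ZMod 2} {X Y : W} (hX : HasParity p X) (hY : HasParity q Y)
    (z : Sym W ⊗[ℝ] Sym W) : kext (p + 1) (S.ad X) (cop Y z) =
      cop (S.l2 X Y) z + sg ((p + 1) * q) • cop Y (kext (p + 1) (S.ad X) z) := by
  rw [kext_cop (fun hr => S.ad_parity hX hr) hY (S.ad_mul hX hY), add_right_comm p 1 q,
    kext_mul (S.l2_parity hX hY)]

theorem ad_coproduct {p : ZMod 2} {X : W} (hX : HasParity p X) (r : Sym W) :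
    kext (p + 1) (S.ad X) (coproduct r) = coproduct (S.ad X r) := by
  revert r
  refine LinearMap.congr_fun (f := kext (p + 1) (S.ad X) ∘ₗ coproduct)
    (g := coproduct ∘ₗ S.ad X) (hom_ext ?_ ?_)
  · rw [LinearMap.comp_apply, LinearMap.comp_apply, ad_one, coproduct_one,
      kext_tmul _ _ one_parity, ad_one]
    simp
  · intro q Y r hY ih
    simp only [LinearMap.comp_apply] at ih ⊢
    rw [S.ad_mul hX hY, map_add, map_smul, coproduct_mul, coproduct_mul, coproduct_mul,
      S.kext_ad_cop hX hY, ih]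

theorem kext_lS_cop {p : ZMod 2} {X : W} (hX : HasParity p X) (z : Sym W ⊗[ℝ] Sym W) :
    kext 1 S.lS (cop X z) = kext (p + 1) (S.ad X) z + sg p • cop X (kext 1 S.lS z) := by
  rw [kext_cop S.lS_parity hX (D' := S.ad X) (fun r => by rw [S.lS_mul hX, one_mul]),
    add_comm 1 p, one_mul]

theorem lS_coproduct : kext 1 S.lS ∘ₗ coproduct = coproduct ∘ₗ S.lS := by
  refine hom_ext ?_ ?_
  · rw [LinearMap.comp_apply, LinearMap.comp_apply, lS_one, coproduct_one,
      kext_tmul _ _ one_parity, lS_one]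
    simp
  · intro p X r hX ih
    simp only [LinearMap.comp_apply] at ih ⊢
    rw [S.lS_mul hX, map_add, map_smul, coproduct_mul, coproduct_mul, S.kext_lS_cop hX,
      S.ad_coproduct hX, ih]

theorem mS_cobracket : kext 1 S.mS ∘ₗ S.cobracket = -(S.cobracket ∘ₗ S.mS) := by
  refine hom_ext ?_ ?_
  · rw [LinearMap.neg_apply, LinearMap.comp_apply, LinearMap.comp_apply, mS_one, cobracket_one,
      map_zero, map_zero, neg_zero]
  · intro p X r hX ih
    simp only [LinearMap.comp_apply, LinearMap.neg_apply] at ih ⊢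
    have h1 := LinearMap.congr_fun S.mS_coproduct r
    simp only [LinearMap.comp_apply] at h1
    rw [S.mS_mul hX, map_add, map_smul, S.cobracket_mul hX, S.cobracket_mul hX,
      S.cobracket_mul (S.m0_parity hX), map_add, map_smul,
      kext_cop S.mS_parity hX (D' := mul (S.m0 X)) (fun r => by rw [S.mS_mul hX, one_mul]),
      add_comm 1 p, kext_mul (S.m0_parity hX), one_mul, ih,
      kext_mul₂ S.mS_parity S.m0_parity (fun hX r => by rw [S.mS_mul hX, one_mul])
        (S.k0_parity hX), h1, S.k0_m0, map_neg, map_neg, LinearMap.neg_apply]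
    match_scalars
    all_goals first
      | ring1
      | simp only [sg]; norm_cast; clear * - p; revert p; decide

/-- The commutator of `kext 1 S.lS` with multiplication by `w` is an operator of first order:
commuting it with `Y` leaves multiplication by the action of `Y` on `w`. This is the recursion which
`cobracket_ad` has to match. -/
theorem kext_lS_mul₂_cop {e q : ZMod 2} {w : W ⊗[ℝ] W} {Y : W} (hw : HasParity e w)
    (hY : HasParity q Y) (z : Sym W ⊗[ℝ] Sym W) :
    kext 1 S.lS (mul₂ w (cop Y z)) - sg e • mul₂ w (kext 1 S.lS (cop Y z)) =
      sg (e * q) • mul₂ (kext (q + 1) (S.l2 Y) w) z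
        + sg ((e + 1) * q) •
          cop Y (kext 1 S.lS (mul₂ w z) - sg e • mul₂ w (kext 1 S.lS z)) := by
  rw [mul₂_cop hw hY, map_smul, S.kext_lS_cop hY, S.kext_lS_cop hY,
    kext_mul₂ (fun hr => S.ad_parity hY hr) (fun hX => (S.l2_parity hY hX).congr (by ring))
      (fun hX r => S.ad_mul hY hX r) hw, map_add, map_smul (mul₂ w), mul₂_cop hw hY, map_sub,
    map_smul]
  match_scalars
  all_goals first
    | ring1
    | simp only [sg]; norm_cast; clear * - e q; revert e q; decide

/-- On letters, `k0_l2` has two terms. The action of `X` on the cobracket of `Y` makes up the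
derivation-like first term here. The action of `Y` on the cobracket of `X`, accumulated over the
letters `Y` of `r`, is the commutator of `kext 1 S.lS` with multiplication by `S.k0 X`. -/
theorem cobracket_ad {p : ZMod 2} {X : W} (hX : HasParity p X) (r : Sym W) :
    S.cobracket (S.ad X r) = -(sg p • kext (p + 1) (S.ad X) (S.cobracket r))
      - (kext 1 S.lS (mul₂ (S.k0 X) (coproduct r))
        - sg (p + 1) • mul₂ (S.k0 X) (kext 1 S.lS (coproduct r))) := by
  revert r
  refine LinearMap.congr_fun (f := S.cobracket ∘ₗ S.ad X)
    (g := -(sg p • (kext (p + 1) (S.ad X) ∘ₗ S.cobracket)) - (kext 1 S.lS ∘ₗ mul₂ (S.k0 X) ∘ₗ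
      coproduct - sg (p + 1) • (mul₂ (S.k0 X) ∘ₗ kext 1 S.lS ∘ₗ coproduct))) (hom_ext ?_ ?_)
  -- Each tensor factor contains at most one letter, so `lS` finds no pair to bracket.
  · have h1 : ∀ w : W ⊗[ℝ] W, kext 1 S.lS (mul₂ w (1 ⊗ₜ 1)) = 0 := by
      intro w
      refine tmul_parity_induction
        (C := fun w : W ⊗[ℝ] W => kext 1 S.lS (mul₂ w (1 ⊗ₜ 1)) = 0) ?_ ?_ ?_ w
      · simp
      · intro w w' h h'
        rw [map_add, LinearMap.add_apply, map_add, h, h', add_zero]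
      · intro a b U V hU hV
        rw [mul₂_tmul, rgt_tmul hV one_parity, map_smul, lft_tmul, map_smul,
          kext_tmul _ _ (mul_parity hU one_parity), S.lS_mul hU, S.lS_mul hV, ad_one, ad_one,
          lS_one]
        simp
    simp only [LinearMap.comp_apply, LinearMap.sub_apply, LinearMap.neg_apply,
      LinearMap.smul_apply]
    rw [ad_one, cobracket_one, coproduct_one, h1, kext_tmul _ _ one_parity, lS_one]
    simp
  · intro q Y r hY ih
    simp only [LinearMap.comp_apply, LinearMap.sub_apply, LinearMap.neg_apply,
      LinearMap.smul_apply] at ih ⊢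
    have h1 := S.kext_lS_mul₂_cop (S.k0_parity hX) hY (coproduct r)
    rw [S.ad_mul hX hY, map_add, map_smul, S.cobracket_mul hY, S.cobracket_mul hY,
      S.cobracket_mul (S.l2_parity hX hY), coproduct_mul, h1, map_add, map_smul,
      S.kext_ad_cop hX hY, kext_mul₂ (fun hr => S.ad_parity hX hr)
        (fun hY => (S.l2_parity hX hY).congr (by ring)) (fun hY r => S.ad_mul hX hY r)
        (S.k0_parity hY), ih, S.k0_l2 hX hY, ← S.ad_coproduct hX]
    simp only [map_sub, map_neg, map_smul, LinearMap.sub_apply, LinearMap.neg_apply,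
      LinearMap.smul_apply]
    match_scalars
    all_goals first
      | ring1
      | simp only [sg]; norm_cast; clear * - p q; revert p q; decide

/-- The commutator term of `cobracket_ad` is exactly what arises when `kext 1 S.lS` passes the term
`mul₂ (S.k0 X) (coproduct r)` of the cobracket; the other terms match by induction and
`lS_coproduct`. -/
theorem lS_cobracket : kext 1 S.lS ∘ₗ S.cobracket = -(S.cobracket ∘ₗ S.lS) := by
  refine hom_ext ?_ ?_
  · rw [LinearMap.neg_apply, LinearMap.comp_apply, LinearMap.comp_apply, lS_one, cobracket_one,
      map_zero, map_zero, neg_zero]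
  · intro p X r hX ih
    simp only [LinearMap.comp_apply, LinearMap.neg_apply] at ih ⊢
    have h1 := LinearMap.congr_fun S.lS_coproduct r
    simp only [LinearMap.comp_apply] at h1
    rw [S.lS_mul hX, map_add, map_smul, S.cobracket_mul hX, S.cobracket_mul hX, S.cobracket_ad hX,
      map_add, map_smul, S.kext_lS_cop hX, ih, h1, map_neg]
    match_scalars
    all_goals first
      | ring1
      | simp only [sg]; norm_cast; clear * - p; revert p; decide

/-! ### Squares -/

theorem mS_mS (h : ∀ X, S.m0 (S.m0 X) = 0) : S.mS ∘ₗ S.mS = 0 := by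
  refine hom_ext ?_ ?_
  · rw [LinearMap.comp_apply, mS_one, map_zero, LinearMap.zero_apply]
  · intro p X r hX ih
    simp only [LinearMap.comp_apply, LinearMap.zero_apply] at ih ⊢
    rw [S.mS_mul hX, map_add, map_smul, S.mS_mul hX, S.mS_mul (S.m0_parity hX), ih, h]
    simp only [map_zero, LinearMap.zero_apply]
    match_scalars
    all_goals first
      | ring1
      | simp only [sg]; norm_cast; clear * - p; revert p; decide

/-- The left side is a derivation in `r`, being a graded commutator of derivations plus a
derivation, so it vanishes once it vanishes on letters. -/
theorem mS_ad (h : ∀ {p q : ZMod 2} {X Y : W}, HasParity p X → HasParity q Y →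
      S.m0 (S.l2 X Y) + S.l2 (S.m0 X) Y + sg p • S.l2 X (S.m0 Y) = 0) {p : ZMod 2} {X : W}
    (hX : HasParity p X) (r : Sym W) :
    S.mS (S.ad X r) + S.ad (S.m0 X) r + sg p • S.ad X (S.mS r) = 0 := by
  revert r
  refine LinearMap.congr_fun (f := S.mS ∘ₗ S.ad X + S.ad (S.m0 X) + sg p • (S.ad X ∘ₗ S.mS))
    (g := 0) (hom_ext ?_ ?_)
  · simp [ad_one, mS_one]
  · intro q Y r hY ih
    simp only [LinearMap.comp_apply, LinearMap.zero_apply, LinearMap.add_apply,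
      LinearMap.smul_apply] at ih ⊢
    have h1 := congrArg (fun Z => mul Z r) (h hX hY)
    simp only [map_add, map_smul, LinearMap.add_apply, LinearMap.smul_apply, map_zero,
      LinearMap.zero_apply] at h1
    have h2 := congrArg (mul Y) ih
    simp only [map_add, map_smul, map_zero] at h2
    rw [S.ad_mul hX hY, S.ad_mul (S.m0_parity hX) hY, S.mS_mul hY]
    simp only [map_add, map_smul]
    rw [S.mS_mul hY, S.mS_mul (S.l2_parity hX hY), S.ad_mul hX (S.m0_parity hY), S.ad_mul hX hY]
    linear_combination (norm := skip) h1 + sg (p * q) • h2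
    match_scalars
    all_goals first
      | ring1
      | simp only [sg]; norm_cast; clear * - p q; revert p q; decide

/-- Commuting the anticommutator with a letter leaves the expression of `mS_ad`. -/
theorem mS_lS (h : ∀ {p q : ZMod 2} {X Y : W}, HasParity p X → HasParity q Y →
      S.m0 (S.l2 X Y) + S.l2 (S.m0 X) Y + sg p • S.l2 X (S.m0 Y) = 0) :
    S.mS ∘ₗ S.lS + S.lS ∘ₗ S.mS = 0 := by
  refine hom_ext ?_ ?_
  · simp [lS_one, mS_one]
  · intro p X r hX ih
    simp only [LinearMap.comp_apply, LinearMap.zero_apply, LinearMap.add_apply] at ih ⊢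
    have h1 := S.mS_ad h hX r
    have h2 := congrArg (mul X) ih
    simp only [map_add, map_zero] at h2
    rw [S.mS_mul hX, S.lS_mul hX]
    simp only [map_add, map_smul]
    rw [S.mS_mul hX, S.lS_mul hX, S.lS_mul (S.m0_parity hX)]
    linear_combination (norm := skip) h1 + h2
    match_scalars
    all_goals first
      | ring1
      | simp only [sg]; norm_cast; clear * - p; revert p; decide

theorem ad_ad (h : ∀ {p q r : ZMod 2} {X Y Z : W}, HasParity p X → HasParity q Y →
      HasParity r Z → S.l2 (S.l2 X Y) Z + sg ((p + 1) * q) • S.l2 Y (S.l2 X Z)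
        + sg p • S.l2 X (S.l2 Y Z) = 0) {p q : ZMod 2} {X Y : W}
    (hX : HasParity p X) (hY : HasParity q Y) (r : Sym W) :
    S.ad (S.l2 X Y) r + sg ((p + 1) * q) • S.ad Y (S.ad X r) + sg p • S.ad X (S.ad Y r) = 0 := by
  revert r
  refine LinearMap.congr_fun (f := S.ad (S.l2 X Y) + sg ((p + 1) * q) • (S.ad Y ∘ₗ S.ad X) +
    sg p • (S.ad X ∘ₗ S.ad Y)) (g := 0) (hom_ext ?_ ?_)
  · simp [ad_one]
  · intro z Z r hZ ih
    simp only [LinearMap.comp_apply, LinearMap.zero_apply, LinearMap.add_apply,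
      LinearMap.smul_apply] at ih ⊢
    have h1 := congrArg (fun Z => mul Z r) (h hX hY hZ)
    simp only [map_add, map_smul, LinearMap.add_apply, LinearMap.smul_apply, map_zero,
      LinearMap.zero_apply] at h1
    have h2 := congrArg (mul Z) ih
    simp only [map_add, map_smul, map_zero] at h2
    rw [S.ad_mul hX hZ, S.ad_mul (S.l2_parity hX hY) hZ, S.ad_mul hY hZ]
    simp only [map_add, map_smul]
    rw [S.ad_mul hX hZ, S.ad_mul hY hZ, S.ad_mul hY (S.l2_parity hX hZ),
      S.ad_mul hX (S.l2_parity hY hZ)]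
    linear_combination (norm := skip) h1 + sg ((p + q) * z) • h2
    match_scalars
    all_goals first
      | ring1
      | simp only [sg]; norm_cast; clear * - p q z; revert p q z; decide

theorem lS_ad (h : ∀ {p q r : ZMod 2} {X Y Z : W}, HasParity p X → HasParity q Y →
      HasParity r Z → S.l2 (S.l2 X Y) Z + sg ((p + 1) * q) • S.l2 Y (S.l2 X Z)
        + sg p • S.l2 X (S.l2 Y Z) = 0) {p : ZMod 2} {X : W}
    (hX : HasParity p X) (r : Sym W) : S.lS (S.ad X r) + sg p • S.ad X (S.lS r) = 0 := by
  revert r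
  refine LinearMap.congr_fun (f := S.lS ∘ₗ S.ad X + sg p • (S.ad X ∘ₗ S.lS))
    (g := 0) (hom_ext ?_ ?_)
  · simp [ad_one, lS_one]
  · intro q Y r hY ih
    simp only [LinearMap.comp_apply, LinearMap.zero_apply, LinearMap.add_apply,
      LinearMap.smul_apply] at ih ⊢
    have h1 := S.ad_ad h hX hY r
    have h2 := congrArg (mul Y) ih
    simp only [map_add, map_smul, map_zero] at h2
    rw [S.ad_mul hX hY, S.lS_mul hY]
    simp only [map_add, map_smul]
    rw [S.lS_mul hY, S.lS_mul (S.l2_parity hX hY), S.ad_mul hX hY]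
    linear_combination (norm := skip) h1 + sg (p * q) • h2
    match_scalars
    all_goals first
      | ring1
      | simp only [sg]; norm_cast; clear * - p q; revert p q; decide

/-- The order drops step by step: commuting `lS ∘ lS` with a letter leaves the expression of
`lS_ad`, commuting that with another letter leaves the one of `ad_ad`, and that one is a derivation
which on letters is the hypothesis. -/
theorem lS_lS (h : ∀ {p q r : ZMod 2} {X Y Z : W}, HasParity p X → HasParity q Y →
      HasParity r Z → S.l2 (S.l2 X Y) Z + sg ((p + 1) * q) • S.l2 Y (S.l2 X Z)
        + sg p • S.l2 X (S.l2 Y Z) = 0) : S.lS ∘ₗ S.lS = 0 := by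
  refine hom_ext ?_ ?_
  · simp [lS_one]
  · intro p X r hX ih
    simp only [LinearMap.comp_apply, LinearMap.zero_apply] at ih ⊢
    have h1 := S.lS_ad h hX r
    rw [S.lS_mul hX, map_add, map_smul, S.lS_mul hX, ih, map_zero]
    linear_combination (norm := module) h1

end SymData

/-! ### Projections to the scalars and to the letters -/

namespace Sym

variable {W : Type*} [AddCommGroup W] [Module ℝ W] [SuperModule W]

theorem augmentation_rec : RecData (0 : W →ₗ[ℝ] Module.End ℝ ℝ) (0 : W →ₗ[ℝ] Sym W →ₗ[ℝ] ℝ) where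
  comm _ _ _ := by simp
  mixed _ _ _ := by simp

/-- The projection to the scalars. -/
def augmentation : Sym W →ₗ[ℝ] ℝ := recS augmentation_rec 1

theorem augmentation_one : augmentation (1 : Sym W) = 1 := recS_one _ _

theorem augmentation_mul (X : W) (r : Sym W) : augmentation (mul X r) = 0 := by
  rw [augmentation, recS_mul]
  simp

theorem linearPart_rec : RecData (0 : W →ₗ[ℝ] Module.End ℝ W)
    ((LinearMap.lsmul ℝ W).flip.compl₂ augmentation) where
  comm _ _ _ := by simp
  mixed _ _ _ := by simp [augmentation_mul]

/-- The projection to the letters. -/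
def linearPart : Sym W →ₗ[ℝ] W := recS linearPart_rec 0

theorem linearPart_one : linearPart (1 : Sym W) = 0 := recS_one _ _

theorem linearPart_mul (X : W) (r : Sym W) : linearPart (mul X r) = augmentation r • X := by
  rw [linearPart, recS_mul]
  simp

theorem linearPart_mul_one (X : W) : linearPart (mul X 1) = X := by
  rw [linearPart_mul, augmentation_one, one_smul]

theorem linearPart_mul_mul (X Y : W) (r : Sym W) : linearPart (mul X (mul Y r)) = 0 := by
  rw [linearPart_mul, augmentation_mul, zero_smul]

end Sym

end GInfinity

end

/-! ### Identities of a shuffle quotient, and their converses on letters -/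

open scoped TensorProduct

noncomputable section

namespace GInfinity

open SuperModule TensorInstances

set_option linter.unusedSectionVars false

namespace ShuffleQuotient

variable {V : Type*} [AddCommGroup V] [Module ℝ V] [SuperModule V] {A : ShiftedOps V}
  {H : Type*} [AddCommGroup H] [Module ℝ H] [SuperModule H] (S : ShuffleQuotient A H)

/-- The structure maps of a quotient by shuffles to which the cobracket descends. -/
def toSymData (k : H →ₗ[ℝ] H ⊗[ℝ] H) (hk : ∀ t, k (S.pr t) = S.cobr t) : SymData H where
  m0 := S.mH
  l2 := S.ell
  k0 := k
  m0_parity := S.mH_parity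
  l2_parity := S.ell_parity
  l2_symm := S.ell_symm
  k0_parity hX := by
    obtain ⟨t, ht, rfl⟩ := S.exists_pr hX
    rw [hk]
    exact S.cobr_parity ht
  k0_m0 X := by
    refine LinearMap.congr_fun (f := kext 1 S.mH ∘ₗ k) (g := -(k ∘ₗ S.mH))
      (linearMap_ext_parity ?_) X
    intro p X hX
    obtain ⟨t, ht, rfl⟩ := S.exists_pr hX
    rw [LinearMap.neg_apply, LinearMap.comp_apply, LinearMap.comp_apply, S.mH_pr, hk, hk,
      S.cobr_M ht, neg_neg]
  k0_l2 {p q X Y} hX hY := by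
    rw [S.ell_apply hX]
    obtain ⟨x, hx, rfl⟩ := S.exists_pr hX
    obtain ⟨y, hy, rfl⟩ := S.exists_pr hY
    rw [S.bH_pr, map_smul, hk, hk, hk, S.cobr_B hx hy]
    match_scalars
    all_goals first
      | ring1
      | simp only [sg]; norm_cast; clear * - p q; revert p q; decide

theorem mH_mH (h : ∀ {p q r : ZMod 2} {a b c : V}, HasParity p a → HasParity q b →
    HasParity r c → A.mm (A.mm a b) c + sg p • A.mm a (A.mm b c) = 0) (X : H) :
    S.mH (S.mH X) = 0 := by
  refine LinearMap.congr_fun (f := S.mH ∘ₗ S.mH) (g := 0) (linearMap_ext_parity ?_) X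
  intro p X hX
  obtain ⟨t, ht, rfl⟩ := S.exists_pr hX
  rw [LinearMap.comp_apply, S.mH_pr, S.mH_pr, A.M_sq h ht, map_zero, LinearMap.zero_apply]

theorem mH_ell (h : ∀ {p q r : ZMod 2} {a b c : V}, HasParity p a → HasParity q b →
    HasParity r c → A.br (A.mm a b) c = A.mm a (A.br b c) + sg (q * r) • A.mm (A.br a c) b)
    {p q : ZMod 2} {X Y : H} (hX : HasParity p X) (hY : HasParity q Y) :
    S.mH (S.ell X Y) + S.ell (S.mH X) Y + sg p • S.ell X (S.mH Y) = 0 := by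
  rw [S.ell_apply hX, S.ell_apply hX, S.ell_apply (S.mH_parity hX)]
  obtain ⟨x, hx, rfl⟩ := S.exists_pr hX
  obtain ⟨y, hy, rfl⟩ := S.exists_pr hY
  rw [S.bH_pr, map_smul, S.mH_pr, S.mH_pr, S.mH_pr, S.bH_pr, S.bH_pr, A.M_B h hx hy, map_add,
    map_smul]
  match_scalars
  all_goals first
    | ring1
    | simp only [sg]; norm_cast; clear * - p; revert p; decide

theorem ell_ell (h : ∀ {p q r : ZMod 2} {a b c : V}, HasParity p a → HasParity q b →
    HasParity r c → sg (p * r) • A.br (A.br a b) c + sg (q * p) • A.br (A.br b c) a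
      + sg (r * q) • A.br (A.br c a) b = 0)
    {p q r : ZMod 2} {X Y Z : H} (hX : HasParity p X) (hY : HasParity q Y) (hZ : HasParity r Z) :
    S.ell (S.ell X Y) Z + sg ((p + 1) * q) • S.ell Y (S.ell X Z) + sg p • S.ell X (S.ell Y Z)
      = 0 := by
  rw [S.ell_apply (S.ell_parity hX hY), S.ell_apply hX, S.ell_apply hX, S.ell_apply hX,
    S.ell_apply hY, S.ell_apply hY]
  obtain ⟨x, hx, rfl⟩ := S.exists_pr hX
  obtain ⟨y, hy, rfl⟩ := S.exists_pr hY
  obtain ⟨z, hz, rfl⟩ := S.exists_pr hZ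
  have h1 := congrArg S.pr (A.B_jacobi h hx hy hz)
  simp only [map_smul, S.bH_pr, LinearMap.smul_apply]
  rw [A.B_anti hy (A.B_parity hx hz), A.B_anti hx (A.B_parity hy hz), A.B_anti hx hz]
  simp only [map_smul, map_neg, LinearMap.neg_apply, LinearMap.smul_apply]
  simp only [map_smul, map_add, map_zero] at h1
  linear_combination (norm := skip) (sg (q + 1) * sg ((p + 1) * (r + 1))) • h1
  match_scalars
  all_goals first
    | ring1
    | simp only [sg]; norm_cast; clear * - p q r; revert p q r; decide

/-- Evaluated on the class of the word `abc`: two contractions leave a single letter, and `pr` is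
injective on letters. -/
theorem mm_mm_of_mH (hinj : ∀ a : V, S.pr (cons a 1) = 0 → a = 0)
    (h : ∀ X, S.mH (S.mH X) = 0) {p q r : ZMod 2} {a b c : V} (ha : HasParity p a)
    (hb : HasParity q b) (hc : HasParity r c) :
    A.mm (A.mm a b) c + sg p • A.mm a (A.mm b c) = 0 := by
  refine hinj _ ?_
  have h1 := h (S.pr (cons a (cons b (cons c 1))))
  rw [S.mH_pr, S.mH_pr, A.M_cons ha, A.phi_cons, A.M_cons hb, A.phi_cons, A.M_cons hc, A.phi_one,
    A.M_one, cons_zero, smul_zero, add_zero, cons_zero, smul_zero, add_zero, map_add, map_smul,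
    A.M_cons (A.mm_parity ha hb), A.phi_cons, A.M_cons hc, A.phi_one, A.M_one, cons_zero,
    smul_zero, add_zero, cons_zero, smul_zero, add_zero, A.M_cons ha, A.phi_cons,
    A.M_cons (A.mm_parity hb hc), A.phi_one, A.M_one, cons_zero, smul_zero, add_zero, cons_zero,
    smul_zero, add_zero, ← smul_cons, ← add_cons] at h1
  exact h1

/-- Evaluated on the classes of `ab` and of `c`: one contraction and one bracket again leave a
single letter. -/
theorem br_mm_of_mH_ell (hinj : ∀ a : V, S.pr (cons a 1) = 0 → a = 0)
    (h : ∀ {p q : ZMod 2} {X Y : H}, HasParity p X → HasParity q Y →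
      S.mH (S.ell X Y) + S.ell (S.mH X) Y + sg p • S.ell X (S.mH Y) = 0)
    {p q r : ZMod 2} {a b c : V} (ha : HasParity p a) (hb : HasParity q b) (hc : HasParity r c) :
    A.br (A.mm a b) c = A.mm a (A.br b c) + sg (q * r) • A.mm (A.br a c) b := by
  rw [← sub_eq_zero]
  refine hinj _ ?_
  have hX := S.pr_parity (ha.cons (hb.cons HasParity.one))
  have h1 := h hX (S.pr_parity (hc.cons HasParity.one))
  have h2 : A.M (cons a (cons b 1)) = cons (A.mm a b) 1 := by
    rw [A.M_cons ha, A.phi_cons, A.M_cons hb, A.phi_one, A.M_one, cons_zero, smul_zero, add_zero,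
      cons_zero, smul_zero, add_zero]
  have h3 : A.M (cons c 1) = 0 := by
    rw [A.M_cons hc, A.phi_one, A.M_one, cons_zero, smul_zero, add_zero]
  have h4 : A.B (cons a (cons b 1)) (cons c 1) =
      sg (r * (q + 0)) • cons (A.br a c) (cons b 1) + cons a (cons (A.br b c) 1) := by
    rw [A.B_cons ha (hb.cons HasParity.one) hc, A.B_cons hb HasParity.one hc, A.one_B, A.B_one,
      A.B_one, sh_one, sh_one]
    simp [cons_zero, sg_zero]
  have h5 : A.B (cons (A.mm a b) 1) (cons c 1) = cons (A.br (A.mm a b) c) 1 := by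
    rw [A.B_cons (A.mm_parity ha hb) HasParity.one hc, A.one_B, A.B_one, sh_one]
    simp [cons_zero, sg_zero]
  have h6 : A.M (cons (A.br a c) (cons b 1)) = cons (A.mm (A.br a c) b) 1 := by
    rw [A.M_cons (A.br_parity ha hc), A.phi_cons, A.M_cons hb, A.phi_one, A.M_one, cons_zero,
      smul_zero, add_zero, cons_zero, smul_zero, add_zero]
  have h7 : A.M (cons a (cons (A.br b c) 1)) = cons (A.mm a (A.br b c)) 1 := by
    rw [A.M_cons ha, A.phi_cons, A.M_cons (A.br_parity hb hc), A.phi_one, A.M_one, cons_zero,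
      smul_zero, add_zero, cons_zero, smul_zero, add_zero]
  rw [S.ell_apply hX, S.ell_apply hX, S.ell_apply (S.mH_parity hX), S.bH_pr, map_smul, S.mH_pr,
    S.mH_pr, S.mH_pr, S.bH_pr, S.bH_pr, h2, h3, h4, h5, map_add, map_smul, h6, h7, map_add,
    map_smul, map_zero, map_zero] at h1
  have h8 : cons (A.br (A.mm a b) c - (A.mm a (A.br b c) + sg (q * r) • A.mm (A.br a c) b)) 1 =
      cons (A.br (A.mm a b) c) 1 - (cons (A.mm a (A.br b c)) 1
        + sg (q * r) • cons (A.mm (A.br a c) b) 1) := by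
    rw [sub_eq_add_neg, ← neg_one_smul ℝ, add_cons, smul_cons, add_cons, smul_cons]
    module
  rw [h8, map_sub, map_add, map_smul]
  linear_combination (norm := skip) (-sg (p + (q + 0) + 1)) • h1
  match_scalars
  all_goals first
    | ring1
    | simp only [sg]; norm_cast; clear * - p q r; revert p q r; decide

/-- On words of one letter, `ell` is the bracket of letters up to sign. -/
theorem br_br_of_ell_ell (hinj : ∀ a : V, S.pr (cons a 1) = 0 → a = 0)
    (h : ∀ {p q r : ZMod 2} {X Y Z : H}, HasParity p X → HasParity q Y → HasParity r Z →
      S.ell (S.ell X Y) Z + sg ((p + 1) * q) • S.ell Y (S.ell X Z) + sg p • S.ell X (S.ell Y Z)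
        = 0)
    {p q r : ZMod 2} {a b c : V} (ha : HasParity p a) (hb : HasParity q b) (hc : HasParity r c) :
    sg (p * r) • A.br (A.br a b) c + sg (q * p) • A.br (A.br b c) a
      + sg (r * q) • A.br (A.br c a) b = 0 := by
  refine hinj _ ?_
  have hB : ∀ {p q : ZMod 2} {a b : V}, HasParity p a → HasParity q b →
      S.ell (S.pr (cons a 1)) (S.pr (cons b 1)) = sg (p + 1) • S.pr (cons (A.br a b) 1) := by
    intro p q a b ha hb
    have h1 := S.pr_parity (ha.cons HasParity.one)
    rw [S.ell_apply h1, S.bH_pr, A.B_cons ha HasParity.one hb, A.one_B, A.B_one, sh_one, cons_zero,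
      cons_zero, smul_zero, add_zero, add_zero, mul_zero, sg_zero, one_smul, add_zero]
  have h1 := h (S.pr_parity (ha.cons HasParity.one)) (S.pr_parity (hb.cons HasParity.one))
    (S.pr_parity (hc.cons HasParity.one))
  rw [hB ha hb, hB ha hc, hB hb hc, map_smul, map_smul, map_smul, LinearMap.smul_apply,
    hB (A.br_parity ha hb) hc, hB hb (A.br_parity ha hc), hB ha (A.br_parity hb hc),
    A.br_anti hb (A.br_parity ha hc), A.br_anti ha (A.br_parity hb hc), A.br_anti ha hc] at h1
  rw [add_cons, add_cons, smul_cons, smul_cons, smul_cons, map_add, map_add, map_smul, map_smul,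
    map_smul]
  have hneg : ∀ a : V, cons (-a) 1 = -cons a 1 := fun a => by
    rw [← neg_one_smul ℝ, smul_cons, neg_one_smul]
  simp only [map_smul, map_neg, LinearMap.neg_apply, LinearMap.smul_apply, hneg, smul_cons] at h1
  linear_combination (norm := skip) (sg (q + p * r)) • h1
  match_scalars
  all_goals first
    | ring1
    | simp only [sg]; norm_cast; clear * - p q r; revert p q r; decide

end ShuffleQuotient

end GInfinity

end

/-! ### Homogeneous words as generators; the graded structure as shifted operations -/

open scoped TensorProduct

noncomputable section

namespace GInfinity

open SuperModule TensorInstances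

set_option linter.unusedSectionVars false

/-- Project a linear combination of generators to the component of parity `p`: generators of the
other parity disappear and the rest are unchanged. -/
theorem HasParity.mem_span {V ι : Type*} [AddCommGroup V] [Module ℝ V] [SuperModule V] {f : ι → V}
    {e : ι → ZMod 2} (hf : ∀ i, HasParity (e i) (f i)) (hspan : Submodule.span ℝ (Set.range f) = ⊤)
    {p : ZMod 2} {v : V} (hv : HasParity p v) : v ∈ Submodule.span ℝ (f '' {i | e i = p}) := by
  rw [← hv.proj_self]
  have h : v ∈ Submodule.span ℝ (Set.range f) := hspan ▸ Submodule.mem_top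
  clear hv
  induction h using Submodule.span_induction with
  | mem x hx =>
    obtain ⟨i, rfl⟩ := hx
    by_cases h : e i = p
    · rw [(h ▸ hf i : HasParity p (f i)).proj_self]
      exact Submodule.subset_span ⟨i, h, rfl⟩
    · rw [(hf i).proj_of_ne (Ne.symm h)]
      exact Submodule.zero_mem _
  | zero => rw [map_zero]; exact Submodule.zero_mem _
  | add x y _ _ hx hy => rw [map_add]; exact Submodule.add_mem _ hx hy
  | smul c x _ hx => rw [map_smul]; exact Submodule.smul_mem _ _ hx

/-- An identity which is linear in an element of given parity may be checked on generators. -/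
theorem HasParity.span_induction {V ι : Type*} [AddCommGroup V] [Module ℝ V] [SuperModule V]
    {f : ι → V} {e : ι → ZMod 2} (hf : ∀ i, HasParity (e i) (f i))
    (hspan : Submodule.span ℝ (Set.range f) = ⊤) {C : V → Prop} {p : ZMod 2} (h0 : C 0)
    (hadd : ∀ x y, C x → C y → C (x + y)) (hsmul : ∀ (c : ℝ) x, C x → C (c • x))
    (hgen : ∀ i, e i = p → C (f i)) {v : V} (hv : HasParity p v) : C v := by
  refine Submodule.span_induction (p := fun x _ => C x) ?_ h0 (fun x y _ _ => hadd x y)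
    (fun c x _ => hsmul c x) (hv.mem_span hf hspan)
  rintro x ⟨i, hi, rfl⟩
  exact hgen i hi

theorem span_cons {V ι κ : Type*} [AddCommGroup V] [Module ℝ V] {f : ι → V}
    {t : κ → TensorAlgebra ℝ V} (hf : Submodule.span ℝ (Set.range f) = ⊤)
    {P : Submodule ℝ (TensorAlgebra ℝ V)} (h : ∀ i k, cons (f i) (t k) ∈ P)
    {x : TensorAlgebra ℝ V} (hx : x ∈ Submodule.span ℝ (Set.range t)) (v : V) : cons v x ∈ P := by
  have hv : v ∈ Submodule.span ℝ (Set.range f) := hf ▸ Submodule.mem_top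
  induction hx using Submodule.span_induction with
  | mem x hx =>
    obtain ⟨k, rfl⟩ := hx
    induction hv using Submodule.span_induction with
    | mem v hv => obtain ⟨i, rfl⟩ := hv; exact h i k
    | zero => rw [zero_cons]; exact Submodule.zero_mem _
    | add v w _ _ hv hw => rw [add_cons]; exact Submodule.add_mem _ hv hw
    | smul c v _ hv => rw [smul_cons]; exact Submodule.smul_mem _ _ hv
  | zero => rw [cons_zero]; exact Submodule.zero_mem _
  | add x y _ _ hx hy => rw [cons_add]; exact Submodule.add_mem _ hx hy
  | smul c x _ hx => rw [cons_smul]; exact Submodule.smul_mem _ _ hx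

variable {G : Type*} [AddCommGroup G] [Module ℝ G] {𝒢 : ℤ → Submodule ℝ G}

theorem tens_cons (a : HomEl 𝒢) (w : List (HomEl 𝒢)) : tens (a :: w) = cons a.val (tens w) := by
  simp [tens, cons]

theorem tens_nil : tens ([] : List (HomEl 𝒢)) = 1 := rfl

theorem cls_nil : cls ([] : List (HomEl 𝒢)) = 0 :=
  (Submodule.Quotient.mk_eq_zero _).2 (Submodule.subset_span (Or.inl rfl))

variable [DirectSum.Decomposition 𝒢]

variable (𝒢) in
theorem span_val : Submodule.span ℝ (Set.range (HomEl.val : HomEl 𝒢 → G)) = ⊤ := by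
  refine Submodule.eq_top_iff'.2 fun x => ?_
  induction x using DirectSum.Decomposition.inductionOn 𝒢 with
  | zero => exact Submodule.zero_mem _
  | @homogeneous i m => exact Submodule.subset_span ⟨⟨i, m⟩, rfl⟩
  | add x y hx hy => exact Submodule.add_mem _ hx hy

variable (𝒢) in
theorem span_tens : Submodule.span ℝ (Set.range (tens : List (HomEl 𝒢) → _)) = ⊤ := by
  refine Submodule.eq_top_iff'.2 fun x => ?_
  induction x using tensor_induction with
  | hadd x y hx hy => exact Submodule.add_mem _ hx hy
  | hsmul c x hx => exact Submodule.smul_mem _ _ hx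
  | h1 => exact Submodule.subset_span ⟨[], rfl⟩
  | hcons v t ht =>
    exact span_cons (t := tens) (P := Submodule.span ℝ (Set.range tens)) (span_val 𝒢)
      (fun a w => Submodule.subset_span ⟨a :: w, tens_cons a w⟩) ht v

variable (𝒢) in
theorem span_cls : Submodule.span ℝ (Set.range (cls : List (HomEl 𝒢) → _)) = ⊤ := by
  have h : (cls : List (HomEl 𝒢) → Hsp 𝒢) = (shuffleRel 𝒢).mkQ ∘ tens := rfl
  rw [h, Set.range_comp, Submodule.span_image, span_tens, Submodule.map_top, Submodule.range_mkQ]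

theorem parityG_parityG (x : G) : parityG 𝒢 (parityG 𝒢 x) = x := by
  refine LinearMap.congr_fun (f := parityG 𝒢 ∘ₗ parityG 𝒢) (g := LinearMap.id)
    (LinearMap.ext_on_range (span_val 𝒢) fun a => ?_) x
  rw [LinearMap.comp_apply, parityG_val, map_smul, parityG_val, neg_one_zpow_eq_sg,
    sg_smul_sg_smul, LinearMap.id_apply]

theorem parityH_parityH (x : Hsp 𝒢) : parityH 𝒢 (parityH 𝒢 x) = x := by
  refine LinearMap.congr_fun (f := parityH 𝒢 ∘ₗ parityH 𝒢) (g := LinearMap.id)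
    (LinearMap.ext_on_range (span_cls 𝒢) fun a => ?_) x
  rw [LinearMap.comp_apply, parityH_cls, map_smul, parityH_cls, neg_one_zpow_eq_sg,
    sg_smul_sg_smul, LinearMap.id_apply]

instance : SuperModule (Hsp 𝒢) where
  par := parityH 𝒢
  par_par := parityH_parityH

theorem hasParity_cls (w : List (HomEl 𝒢)) : HasParity (hdeg w : ZMod 2) (cls w) := by
  rw [HasParity, ← neg_one_zpow_eq_sg]
  exact parityH_cls w

/-- The sign operator of the super vector space `G` is the one of the grading. -/
class GradedSuper (𝒢 : ℤ → Submodule ℝ G) [DirectSum.Decomposition 𝒢] [SuperModule G] : Prop where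
  par_eq : (par : G →ₗ[ℝ] G) = parityG 𝒢

section Letters

variable [SuperModule G] [GradedSuper 𝒢]

theorem hasParity_val (a : HomEl 𝒢) : HasParity (a.deg : ZMod 2) a.val := by
  rw [HasParity, GradedSuper.par_eq (𝒢 := 𝒢), parityG_val, neg_one_zpow_eq_sg]

theorem hasParity_tens (w : List (HomEl 𝒢)) : HasParity (wdeg w : ZMod 2) (tens w) := by
  induction w with
  | nil => simpa [wdeg, tens] using HasParity.one
  | cons a w ih =>
    rw [tens_cons, wdeg_cons, Int.cast_add]
    exact (hasParity_val a).cons ih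

theorem sh_tens (u v : List (HomEl 𝒢)) : sh (tens u) (tens v) = shuffle u v := by
  induction u, v using shuffle.induct with
  | case1 v => rw [tens_nil, one_sh, shuffle]
  | case2 a u => rw [tens_nil, sh_one, shuffle]
  | case3 a u b v ih1 ih2 =>
    rw [tens_cons, tens_cons, cons_sh_cons (hasParity_val a) (hasParity_tens u) (hasParity_val b),
      ← tens_cons, ← tens_cons, ih1, ih2, shuffle, wdeg_cons, neg_one_zpow_eq_sg]
    push_cast
    rfl

end Letters

namespace GradedProductBracket

variable (A : GradedProductBracket 𝒢)

/-- The homogeneous element `ab`. -/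
def mulEl (a b : HomEl 𝒢) : HomEl 𝒢 := ⟨a.1 + b.1, ⟨A.mul a.val b.val, A.mul_mem a b⟩⟩

theorem mulEl_val (a b : HomEl 𝒢) : (A.mulEl a b).val = A.mul a.val b.val := rfl

theorem mulEl_deg (a b : HomEl 𝒢) : (A.mulEl a b).deg = a.deg + b.deg + 1 := by
  simp only [mulEl, HomEl.deg]; ring

/-- The homogeneous element `[a, b]`. -/
def bracketEl (a b : HomEl 𝒢) : HomEl 𝒢 :=
  ⟨a.1 + b.1 - 1, ⟨A.bracket a.val b.val, A.bracket_mem a b⟩⟩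

theorem bracketEl_val (a b : HomEl 𝒢) : (A.bracketEl a b).val = A.bracket a.val b.val := rfl

theorem bracketEl_deg (a b : HomEl 𝒢) : (A.bracketEl a b).deg = a.deg + b.deg := by
  simp only [bracketEl, HomEl.deg]; ring

variable [SuperModule G] [GradedSuper 𝒢]

theorem par_val (a : HomEl 𝒢) : par a.val = sg (a.deg : ZMod 2) • a.val := hasParity_val a

theorem letter_induction {C : G → Prop} {p : ZMod 2} (h0 : C 0)
    (hadd : ∀ x y, C x → C y → C (x + y)) (hsmul : ∀ (c : ℝ) x, C x → C (c • x))
    (hgen : ∀ a : HomEl 𝒢, (a.deg : ZMod 2) = p → C a.val) {v : G} (hv : HasParity p v) : C v :=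
  HasParity.span_induction hasParity_val (span_val 𝒢) h0 hadd hsmul hgen hv

theorem parity_deg (a : HomEl 𝒢) : (a.1 : ZMod 2) = (a.deg : ZMod 2) + 1 := by
  simp [HomEl.deg]

/-- The product `m(a, b) = (-1)^(deg a) ab` and the bracket, on the super vector space `G[1]`. -/
def shiftedOps : ShiftedOps G where
  mm := A.mul ∘ₗ par
  br := A.bracket
  mm_parity {p q a b} ha hb := by
    refine letter_induction (𝒢 := 𝒢) (C := fun a => HasParity (p + q + 1) ((A.mul ∘ₗ par) a b))
      ?_ ?_ ?_ ?_ ha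
    · simpa using HasParity.zero _
    · intro x y hx hy; simpa using hx.add hy
    · intro c x hx; simpa using hx.smul c
    · intro a ha
      refine letter_induction (𝒢 := 𝒢)
        (C := fun b => HasParity (p + q + 1) ((A.mul ∘ₗ par) a.val b)) ?_ ?_ ?_ ?_ hb
      · simpa using HasParity.zero _
      · intro x y hx hy; rw [map_add]; exact hx.add hy
      · intro c x hx; rw [map_smul]; exact hx.smul c
      · intro b hb
        rw [LinearMap.comp_apply, par_val, map_smul, LinearMap.smul_apply, ← mulEl_val]
        refine ((hasParity_val _).congr ?_).smul _
        rw [mulEl_deg, ← ha, ← hb]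
        push_cast
        rfl
  br_parity {p q a b} ha hb := by
    refine letter_induction (𝒢 := 𝒢) (C := fun a => HasParity (p + q) (A.bracket a b))
      ?_ ?_ ?_ ?_ ha
    · simpa using HasParity.zero _
    · intro x y hx hy; simpa using hx.add hy
    · intro c x hx; simpa using hx.smul c
    · intro a ha
      refine letter_induction (𝒢 := 𝒢)
        (C := fun b => HasParity (p + q) (A.bracket a.val b)) ?_ ?_ ?_ ?_ hb
      · simpa using HasParity.zero _
      · intro x y hx hy; rw [map_add]; exact hx.add hy
      · intro c x hx; rw [map_smul]; exact hx.smul c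
      · intro b hb
        rw [← bracketEl_val]
        refine (hasParity_val _).congr ?_
        rw [bracketEl_deg, ← ha, ← hb]
        push_cast
        rfl
  mm_anti {p q a b} ha hb := by
    refine letter_induction (𝒢 := 𝒢)
      (C := fun a => (A.mul ∘ₗ par) a b = -(sg (p * q) • (A.mul ∘ₗ par) b a)) ?_ ?_ ?_ ?_ ha
    · simp
    · intro x y hx hy; rw [map_add, LinearMap.add_apply, hx, hy, map_add]; module
    · intro c x hx; rw [map_smul, LinearMap.smul_apply, hx, map_smul]; module
    · intro a ha
      refine letter_induction (𝒢 := 𝒢)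
        (C := fun b => (A.mul ∘ₗ par) a.val b = -(sg (p * q) • (A.mul ∘ₗ par) b a.val))
        ?_ ?_ ?_ ?_ hb
      · simp
      · intro x y hx hy; rw [map_add, hx, hy, map_add, LinearMap.add_apply]; module
      · intro c x hx; rw [map_smul, hx, map_smul, LinearMap.smul_apply]; module
      · intro b hb
        rw [LinearMap.comp_apply, LinearMap.comp_apply, par_val, par_val, map_smul, map_smul,
          LinearMap.smul_apply, LinearMap.smul_apply, A.mul_comm, neg_one_zpow_eq_sg, Int.cast_mul,
          parity_deg, parity_deg, ha, hb]
        match_scalars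
        all_goals first
          | ring1
          | simp only [sg]; norm_cast; clear * - p q; revert p q; decide
  br_anti {p q a b} ha hb := by
    refine letter_induction (𝒢 := 𝒢)
      (C := fun a => A.bracket a b = -(sg (p * q) • A.bracket b a)) ?_ ?_ ?_ ?_ ha
    · simp
    · intro x y hx hy; rw [map_add, LinearMap.add_apply, hx, hy, map_add]; module
    · intro c x hx; rw [map_smul, LinearMap.smul_apply, hx, map_smul]; module
    · intro a ha
      refine letter_induction (𝒢 := 𝒢)
        (C := fun b => A.bracket a.val b = -(sg (p * q) • A.bracket b a.val))
        ?_ ?_ ?_ ?_ hb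
      · simp
      · intro x y hx hy; rw [map_add, hx, hy, map_add, LinearMap.add_apply]; module
      · intro c x hx; rw [map_smul, hx, map_smul, LinearMap.smul_apply]; module
      · intro b hb
        rw [A.bracket_antisymm, neg_one_zpow_eq_sg, Int.cast_mul, ha, hb]

theorem shiftedOps_mm (a : HomEl 𝒢) (b : G) :
    A.shiftedOps.mm a.val b = (-1 : ℝ) ^ a.deg • A.mul a.val b := by
  change A.mul (par a.val) b = _
  rw [par_val, map_smul, LinearMap.smul_apply, neg_one_zpow_eq_sg]

theorem shiftedOps_br (a b : G) : A.shiftedOps.br a b = A.bracket a b := rfl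

theorem M_tens (w : List (HomEl 𝒢)) : A.shiftedOps.M (tens w) = A.mulTens w := by
  induction w using mulTens.induct with
  | case1 => rw [tens_nil, ShiftedOps.M_one, mulTens]
  | case2 a =>
    rw [tens_cons, ShiftedOps.M_cons _ (hasParity_val a), tens_nil, ShiftedOps.phi_one,
      ShiftedOps.M_one, cons_zero, smul_zero, add_zero, mulTens]
  | case3 a b w ih =>
    rw [tens_cons, ShiftedOps.M_cons _ (hasParity_val a), ih, tens_cons, ShiftedOps.phi_cons,
      shiftedOps_mm, smul_cons, mulTens, neg_one_zpow_eq_sg]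
    rfl

theorem B_tens (u v : List (HomEl 𝒢)) :
    A.shiftedOps.B (tens u) (tens v) = A.bracketTens u v := by
  induction u, v using bracketTens.induct with
  | case1 v => rw [tens_nil, ShiftedOps.one_B, bracketTens]
  | case2 a u => rw [tens_nil, ShiftedOps.B_one, bracketTens]
  | case3 a u b v ih1 ih2 =>
    rw [tens_cons, tens_cons,
      ShiftedOps.B_cons _ (hasParity_val a) (hasParity_tens u) (hasParity_val b), ← tens_cons,
      ← tens_cons, ih1, ih2, bracketTens, sh_tens, wdeg_cons, neg_one_zpow_eq_sg,
      neg_one_zpow_eq_sg]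
    push_cast
    rfl

end GradedProductBracket

end GInfinity

end

/-! ### Descent to `ℋ` -/

open scoped TensorProduct

noncomputable section

namespace GInfinity

open SuperModule TensorInstances

set_option linter.unusedSectionVars false

variable {G : Type*} [AddCommGroup G] [Module ℝ G] {𝒢 : ℤ → Submodule ℝ G}
  [DirectSum.Decomposition 𝒢]

variable (𝒢) in
/-- The span of the nonempty words. -/
def augIdeal : Submodule ℝ (TensorAlgebra ℝ G) :=
  Submodule.span ℝ (tens '' {w : List (HomEl 𝒢) | w ≠ []})

theorem cons_mem_augIdeal (v : G) (x : TensorAlgebra ℝ G) : cons v x ∈ augIdeal 𝒢 :=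
  span_cons (t := tens) (P := augIdeal 𝒢) (span_val 𝒢)
    (fun a w => Submodule.subset_span ⟨a :: w, by simp, tens_cons a w⟩)
    (span_tens 𝒢 ▸ Submodule.mem_top) v

section Letters

variable [SuperModule G] [GradedSuper 𝒢]

theorem sh_mem_shuffleRel {x y : TensorAlgebra ℝ G} (hx : x ∈ augIdeal 𝒢) (hy : y ∈ augIdeal 𝒢) :
    sh x y ∈ shuffleRel 𝒢 := by
  induction hx using Submodule.span_induction with
  | mem x hx =>
    obtain ⟨u, hu, rfl⟩ := hx
    induction hy using Submodule.span_induction with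
    | mem y hy =>
      obtain ⟨v, hv, rfl⟩ := hy
      exact Submodule.subset_span (Or.inr ⟨u, v, hu, hv, sh_tens u v⟩)
    | zero => rw [map_zero]; exact Submodule.zero_mem _
    | add x y _ _ hx hy => rw [map_add]; exact Submodule.add_mem _ hx hy
    | smul c x _ hx => rw [map_smul]; exact Submodule.smul_mem _ _ hx
  | zero => rw [map_zero]; exact Submodule.zero_mem _
  | add x y _ _ hx hy => rw [map_add]; exact Submodule.add_mem _ hx hy
  | smul c x _ hx => rw [map_smul]; exact Submodule.smul_mem _ _ hx

/-- A linear map which vanishes on `1` and on the shuffles of nonempty words vanishes on the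
relations of `ℋ`. -/
theorem shuffleRel_le_ker {M : Type*} [AddCommGroup M] [Module ℝ M] {f : TensorAlgebra ℝ G →ₗ[ℝ] M}
    (h1 : f 1 = 0)
    (hsh : ∀ (a b : HomEl 𝒢) (u v : List (HomEl 𝒢)),
      f (sh (cons a.val (tens u)) (cons b.val (tens v))) = 0) :
    shuffleRel 𝒢 ≤ LinearMap.ker f := by
  refine Submodule.span_le.2 ?_
  rintro x (rfl | ⟨u, v, hu, hv, rfl⟩)
  · exact h1
  · obtain ⟨a, u, rfl⟩ := List.exists_cons_of_ne_nil hu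
    obtain ⟨b, v, rfl⟩ := List.exists_cons_of_ne_nil hv
    change f _ = 0
    rw [← sh_tens, tens_cons, tens_cons, hsh]

end Letters

namespace GradedProductBracket

variable [SuperModule G] [GradedSuper 𝒢] (A : GradedProductBracket 𝒢)

theorem M_mem_augIdeal (x : TensorAlgebra ℝ G) : A.shiftedOps.M x ∈ augIdeal 𝒢 := by
  have h : ∀ x a, A.shiftedOps.phi a x ∈ augIdeal 𝒢 := by
    intro x a
    induction x using tensor_induction with
    | hadd x y hx hy => rw [map_add]; exact Submodule.add_mem _ hx hy
    | hsmul c x hx => rw [map_smul]; exact Submodule.smul_mem _ _ hx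
    | h1 => rw [ShiftedOps.phi_one]; exact Submodule.zero_mem _
    | hcons v t ht => rw [ShiftedOps.phi_cons]; exact cons_mem_augIdeal _ _
  induction x using tensor_induction with
  | hadd x y hx hy => rw [map_add]; exact Submodule.add_mem _ hx hy
  | hsmul c x hx => rw [map_smul]; exact Submodule.smul_mem _ _ hx
  | h1 => rw [ShiftedOps.M_one]; exact Submodule.zero_mem _
  | hcons v t ht =>
    rw [← proj_add_proj v, add_cons, map_add, ShiftedOps.M_cons _ (hasParity_proj _ _),
      ShiftedOps.M_cons _ (hasParity_proj _ _)]
    have h2 := fun (v : G) (x : TensorAlgebra ℝ G) => cons_mem_augIdeal (𝒢 := 𝒢) v x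
    exact Submodule.add_mem _ (Submodule.add_mem _ (h _ _) (Submodule.smul_mem _ _ (h2 _ _)))
      (Submodule.add_mem _ (h _ _) (Submodule.smul_mem _ _ (h2 _ _)))

theorem B_mem_augIdeal (u v : List (HomEl 𝒢)) :
    A.shiftedOps.B (tens u) (tens v) ∈ augIdeal 𝒢 := by
  rcases u with _ | ⟨a, u⟩
  · rw [tens_nil, ShiftedOps.one_B]; exact Submodule.zero_mem _
  rcases v with _ | ⟨b, v⟩
  · rw [tens_nil, ShiftedOps.B_one]; exact Submodule.zero_mem _
  rw [tens_cons, tens_cons,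
    ShiftedOps.B_cons _ (hasParity_val a) (hasParity_tens u) (hasParity_val b)]
  have h2 := fun (v : G) (x : TensorAlgebra ℝ G) => cons_mem_augIdeal (𝒢 := 𝒢) v x
  exact Submodule.add_mem _ (Submodule.add_mem _ (Submodule.smul_mem _ _ (h2 _ _)) (h2 _ _))
    (Submodule.smul_mem _ _ (h2 _ _))

/-- The derivation property `M_sh` turns a shuffle into a sum of shuffles. These are relations
because `M` produces no scalar part (`M_mem_augIdeal`). -/
theorem M_le : shuffleRel 𝒢 ≤ LinearMap.ker ((shuffleRel 𝒢).mkQ ∘ₗ A.shiftedOps.M) := by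
  have h2 := fun (v : G) (x : TensorAlgebra ℝ G) => cons_mem_augIdeal (𝒢 := 𝒢) v x
  refine shuffleRel_le_ker ?_ ?_
  · rw [LinearMap.comp_apply, ShiftedOps.M_one, map_zero]
  · intro a b u v
    refine (Submodule.Quotient.mk_eq_zero _).2 ?_
    rw [A.shiftedOps.M_sh ((hasParity_val a).cons (hasParity_tens u))
      ((hasParity_val b).cons (hasParity_tens v))]
    exact Submodule.add_mem _ (sh_mem_shuffleRel (A.M_mem_augIdeal _) (h2 _ _))
      (Submodule.smul_mem _ _ (sh_mem_shuffleRel (h2 _ _) (A.M_mem_augIdeal _)))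

theorem B_le (v : List (HomEl 𝒢)) :
    shuffleRel 𝒢 ≤ LinearMap.ker ((shuffleRel 𝒢).mkQ ∘ₗ A.shiftedOps.B.flip (tens v)) := by
  have h2 := fun (v : G) (x : TensorAlgebra ℝ G) => cons_mem_augIdeal (𝒢 := 𝒢) v x
  refine shuffleRel_le_ker ?_ ?_
  · rw [LinearMap.comp_apply, LinearMap.flip_apply, ShiftedOps.one_B, map_zero]
  · intro a b u w
    refine (Submodule.Quotient.mk_eq_zero _).2 ?_
    rw [LinearMap.flip_apply, A.shiftedOps.B_sh ((hasParity_val a).cons (hasParity_tens u))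
      ((hasParity_val b).cons (hasParity_tens w)) (hasParity_tens v), ← tens_cons, ← tens_cons]
    have h3 := fun (a : HomEl 𝒢) (w : List (HomEl 𝒢)) => tens_cons a w ▸ h2 a.val (tens w)
    exact Submodule.add_mem _ (sh_mem_shuffleRel (h3 _ _) (A.B_mem_augIdeal _ _))
      (Submodule.smul_mem _ _ (sh_mem_shuffleRel (A.B_mem_augIdeal _ _) (h3 _ _)))

theorem B_le_left : shuffleRel 𝒢 ≤ LinearMap.ker (A.shiftedOps.B.compr₂ (shuffleRel 𝒢).mkQ) := by
  intro x hx
  refine LinearMap.ext_on_range (span_tens 𝒢) fun v => ?_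
  exact A.B_le v hx

/-- Descent in the second argument reduces to the first one by antisymmetry of `B`. -/
theorem B_le_right : shuffleRel 𝒢 ≤
    LinearMap.ker ((shuffleRel 𝒢).liftQ _ A.B_le_left).flip := by
  intro x hx
  refine LinearMap.ext_on_range (span_cls 𝒢) fun u => ?_
  change ((shuffleRel 𝒢).mkQ ∘ₗ A.shiftedOps.B (tens u)) x = 0
  revert x
  refine shuffleRel_le_ker ?_ ?_
  · rw [LinearMap.comp_apply, ShiftedOps.B_one, map_zero]
  · intro a b v w
    have hv := (hasParity_val a).cons (hasParity_tens v)
    have hw := (hasParity_val b).cons (hasParity_tens w)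
    have h1 : sh (cons a.val (tens v)) (cons b.val (tens w)) ∈ shuffleRel 𝒢 :=
      sh_mem_shuffleRel (cons_mem_augIdeal _ _) (cons_mem_augIdeal _ _)
    have h2 := LinearMap.mem_ker.1 (A.B_le u h1)
    rw [LinearMap.comp_apply, LinearMap.flip_apply] at h2
    rw [LinearMap.comp_apply, A.shiftedOps.B_anti (hasParity_tens u) (hv.sh hw), map_neg, map_smul,
      h2, smul_zero, neg_zero]

theorem par_tensor (x : TensorAlgebra ℝ G) : par x = parityT 𝒢 x := by
  change TensorAlgebra.lift ℝ (TensorAlgebra.ι ℝ ∘ₗ par) x = _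
  rw [GradedSuper.par_eq (𝒢 := 𝒢)]
  rfl

/-- The space `ℋ` with the extensions of the product and of the bracket. -/
def quotient : ShuffleQuotient A.shiftedOps (Hsp 𝒢) where
  pr := (shuffleRel 𝒢).mkQ
  pr_one := (Submodule.Quotient.mk_eq_zero _).2 (Submodule.subset_span (Or.inl rfl))
  pr_par t := by
    rw [par_tensor (𝒢 := 𝒢)]
    change _ = -parityH 𝒢 ((shuffleRel 𝒢).mkQ t)
    rw [parityH, LinearMap.neg_apply, neg_neg]
    rfl
  pr_sh _ _ _ _ := (Submodule.Quotient.mk_eq_zero _).2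
    (sh_mem_shuffleRel (cons_mem_augIdeal _ _) (cons_mem_augIdeal _ _))
  surj := Submodule.mkQ_surjective _
  mH := (shuffleRel 𝒢).liftQ _ A.M_le
  bH := ((shuffleRel 𝒢).liftQ _ A.B_le_right).flip
  mH_pr _ := rfl
  bH_pr _ _ := rfl

theorem cobr_le : shuffleRel 𝒢 ≤ LinearMap.ker A.quotient.cobr := by
  refine shuffleRel_le_ker A.quotient.cobr_one fun a b u v => ?_
  exact A.quotient.cobr_sh (hasParity_val a) (hasParity_tens u) (hasParity_val b) (hasParity_tens v)

/-- The space `ℋ` with its structure maps. -/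
def symData : SymData (Hsp 𝒢) :=
  A.quotient.toSymData ((shuffleRel 𝒢).liftQ _ A.cobr_le) fun _ => rfl

theorem symData_m0 (X : List (HomEl 𝒢)) : A.symData.m0 (cls X) = A.mulWord X := by
  change A.quotient.mH (A.quotient.pr (tens X)) = _
  rw [A.quotient.mH_pr, M_tens]
  rfl

theorem bH_cls (X Y : List (HomEl 𝒢)) : A.quotient.bH (cls X) (cls Y) = A.bracketWord X Y := by
  change A.quotient.bH (A.quotient.pr (tens X)) (A.quotient.pr (tens Y)) = _
  rw [A.quotient.bH_pr, B_tens]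
  rfl

theorem symData_l2 (X Y : List (HomEl 𝒢)) :
    A.symData.l2 (cls X) (cls Y) = (-1 : ℝ) ^ hdeg X • A.bracketWord X Y := by
  change A.quotient.ell _ _ = _
  rw [A.quotient.ell_apply (hasParity_cls X), neg_one_zpow_eq_sg, bH_cls]

theorem delta_tens (X : List (HomEl 𝒢)) : A.quotient.delta (tens X) =
    ∑ j ∈ Finset.range X.length, tens (X.take j) ⊗ₜ[ℝ] cls (X.drop j) := by
  induction X with
  | nil => rw [tens_nil, ShuffleQuotient.delta_one]; simp
  | cons a X ih =>
    rw [tens_cons, ShuffleQuotient.delta_cons, ih, List.length_cons, Finset.sum_range_succ', map_sum,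
      ← tens_cons, add_comm]
    refine congrArg₂ _ (Finset.sum_congr rfl fun j _ => ?_) rfl
    rw [ShuffleQuotient.consT_tmul, List.take_succ_cons, List.drop_succ_cons, tens_cons]

theorem deltaH_tens (X : List (HomEl 𝒢)) : A.quotient.deltaH (tens X) =
    ∑ j ∈ Finset.Ico 1 X.length, cls (X.take j) ⊗ₜ[ℝ] cls (X.drop j) := by
  rw [ShuffleQuotient.deltaH_apply, delta_tens, map_sum]
  have h : ∀ j, A.quotient.pr.rTensor (Hsp 𝒢) (tens (X.take j) ⊗ₜ[ℝ] cls (X.drop j)) =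
      cls (X.take j) ⊗ₜ[ℝ] cls (X.drop j) := fun j => rfl
  simp only [h]
  rcases X with _ | ⟨a, X⟩
  · simp
  -- The cut at `0` has the empty word on the left, and the class of the empty word is `0`; so the
  -- sum starts at `1`.
  · rw [Finset.range_eq_Ico, ← Finset.sum_Ioo_add_eq_sum_Ico (by simp), List.take_zero, cls_nil,
      TensorProduct.zero_tmul, add_zero]
    rfl

theorem symData_k0 (X : List (HomEl 𝒢)) :
    A.symData.k0 (cls X) = ∑ j ∈ Finset.Ico 1 X.length,
      (-1 : ℝ) ^ (hdeg (X.take j) + 1) • (cls (X.take j) ⊗ₜ[ℝ] cls (X.drop j)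
        + (-1 : ℝ) ^ (hdeg (X.take j) * hdeg (X.drop j)) •
          cls (X.drop j) ⊗ₜ[ℝ] cls (X.take j)) := by
  change A.quotient.cobr (tens X) = _
  rw [ShuffleQuotient.cobr_apply, deltaH_tens, map_sum, map_sum, ← Finset.sum_add_distrib,
    ← Finset.sum_neg_distrib]
  refine Finset.sum_congr rfl fun j _ => ?_
  rw [TensorProduct.map_tmul, (hasParity_cls _).par_eq, ← TensorProduct.smul_tmul', map_smul,
    LinearMap.id_apply, koszulSwap_tmul (hasParity_cls _) (hasParity_cls _), neg_one_zpow_eq_sg,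
    neg_one_zpow_eq_sg]
  push_cast
  rw [sg_add, sg_one]
  module

end GradedProductBracket

end GInfinity

end

/-! ### `S⁺` as the symmetric algebra modulo scalars -/

open scoped TensorProduct

noncomputable section

namespace GInfinity

open SuperModule TensorInstances

set_option linter.unusedSectionVars false

theorem map_sum_map {α M N : Type*} [AddCommGroup M] [Module ℝ M] [AddCommGroup N] [Module ℝ N]
    (f : M →ₗ[ℝ] N) (g : α → M) (l : List α) : f (l.map g).sum = (l.map fun a => f (g a)).sum := by
  rw [map_list_sum, List.map_map]
  rfl

theorem sum_map_congr {α M : Type*} [AddCommGroup M] {f g : α → M} (h : ∀ a, f a = g a)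
    (l : List α) : (l.map f).sum = (l.map g).sum := by
  rw [funext h]

variable {G : Type*} [AddCommGroup G] [Module ℝ G] {𝒢 : ℤ → Submodule ℝ G}

theorem tensH_nil : tensH ([] : List (List (HomEl 𝒢))) = 1 := rfl

theorem tensH_cons (X : List (HomEl 𝒢)) (L : List (List (HomEl 𝒢))) :
    tensH (X :: L) = cons (cls X) (tensH L) := by
  simp [tensH, cons]

theorem tensH_append (L K : List (List (HomEl 𝒢))) : tensH (L ++ K) = tensH L * tensH K := by
  simp [tensH]

theorem sdeg_nil : sdeg ([] : List (List (HomEl 𝒢))) = 0 := rfl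

theorem sdeg_cons (X : List (HomEl 𝒢)) (L : List (List (HomEl 𝒢))) :
    sdeg (X :: L) = hdeg X + sdeg L := by
  simp [sdeg]

theorem sdeg_append (L K : List (List (HomEl 𝒢))) : sdeg (L ++ K) = sdeg L + sdeg K := by
  simp [sdeg]

variable [DirectSum.Decomposition 𝒢]

variable (𝒢) in
theorem span_tensH : Submodule.span ℝ (Set.range (tensH : List (List (HomEl 𝒢)) → _)) = ⊤ := by
  refine Submodule.eq_top_iff'.2 fun x => ?_
  induction x using tensor_induction with
  | hadd x y hx hy => exact Submodule.add_mem _ hx hy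
  | hsmul c x hx => exact Submodule.smul_mem _ _ hx
  | h1 => exact Submodule.subset_span ⟨[], rfl⟩
  | hcons v t ht =>
    exact span_cons (t := tensH) (P := Submodule.span ℝ (Set.range tensH)) (span_cls 𝒢)
      (fun a w => Submodule.subset_span ⟨a :: w, tensH_cons a w⟩) ht v

variable (𝒢) in
theorem span_mon : Submodule.span ℝ (Set.range (mon : List (List (HomEl 𝒢)) → _)) = ⊤ := by
  have h : (mon : List (List (HomEl 𝒢)) → SPlus 𝒢) = (symRel 𝒢).mkQ ∘ tensH := rfl
  rw [h, Set.range_comp, Submodule.span_image, span_tensH, Submodule.map_top, Submodule.range_mkQ]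

/-- The relations of `S⁺` list only commutators of classes of words. These classes span `ℋ` and are
homogeneous, so bilinearity gives the commutators of all homogeneous elements. -/
theorem symIdeal_le : symIdeal (Hsp 𝒢) ≤ LinearMap.ker (symRel 𝒢).mkQ := by
  refine Submodule.span_le.2 ?_
  rintro x ⟨P, R, p, q, X, Y, hX, hY, rfl⟩
  change (symRel 𝒢).mkQ _ = 0
  refine HasParity.span_induction (C := fun X => (symRel 𝒢).mkQ
    (P * (cons X (cons Y R) - sg (p * q) • cons Y (cons X R))) = 0) hasParity_cls (span_cls 𝒢)
    ?_ ?_ ?_ ?_ hX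
  · simp [zero_cons, cons_zero]
  · intro X X' h h'
    rw [← add_zero (0 : SPlus 𝒢)]
    nth_rw 1 [← h, ← h']
    rw [← map_add, ← mul_add, add_cons, add_cons, cons_add]
    congr 2
    module
  · intro c X h
    rw [← smul_zero c, ← h, ← map_smul, ← mul_smul_comm, smul_cons, smul_cons, cons_smul]
    congr 2
    module
  · intro X hX
    refine HasParity.span_induction (C := fun Y => (symRel 𝒢).mkQ
      (P * (cons (cls X) (cons Y R) - sg (p * q) • cons Y (cons (cls X) R))) = 0) hasParity_cls
      (span_cls 𝒢) ?_ ?_ ?_ ?_ hY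
    · simp [zero_cons, cons_zero]
    · intro X X' h h'
      rw [← add_zero (0 : SPlus 𝒢)]
      nth_rw 1 [← h, ← h']
      rw [← map_add, ← mul_add, add_cons, add_cons, cons_add]
      congr 2
      module
    · intro c X h
      rw [← smul_zero c, ← h, ← map_smul, ← mul_smul_comm, smul_cons, smul_cons, cons_smul]
      congr 2
      module
    · intro Y hY
      refine (Submodule.Quotient.mk_eq_zero _).2 (Submodule.subset_span (Or.inr ⟨P, R, X, Y, ?_⟩))
      rw [neg_one_zpow_eq_sg, Int.cast_mul, hX, hY]
      simp only [cons, mul_assoc, sub_mul, smul_mul_assoc]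

variable (𝒢) in
/-- The projection of the symmetric algebra to its quotient by the scalars. -/
def toSPlus : Sym (Hsp 𝒢) →ₗ[ℝ] SPlus 𝒢 := Sym.lift (symRel 𝒢).mkQ symIdeal_le

theorem toSPlus_mk (t : TensorAlgebra ℝ (Hsp 𝒢)) :
    toSPlus 𝒢 (Sym.mk t) = (symRel 𝒢).mkQ t := Sym.lift_mk _ _ _

theorem toSPlus_one : toSPlus 𝒢 1 = 0 :=
  (toSPlus_mk 1).trans ((Submodule.Quotient.mk_eq_zero _).2 (Submodule.subset_span (Or.inl rfl)))

theorem toSPlus_surjective : Function.Surjective (toSPlus 𝒢) := fun x => by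
  obtain ⟨t, rfl⟩ := (symRel 𝒢).mkQ_surjective x
  exact ⟨Sym.mk t, toSPlus_mk t⟩

/-- Beyond the relations of the symmetric algebra, `symRel` contains only the scalars, so vanishing
at `1` is the single condition for descent. -/
theorem symRel_le_ker {M : Type*} [AddCommGroup M] [Module ℝ M] (f : Sym (Hsp 𝒢) →ₗ[ℝ] M)
    (h : f 1 = 0) : symRel 𝒢 ≤ LinearMap.ker (f ∘ₗ Sym.mk) := by
  refine Submodule.span_le.2 ?_
  rintro x (rfl | ⟨P, Q, X, Y, rfl⟩)
  · exact h
  · change f (Sym.mk _) = 0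
    rw [Sym.mk_eq_zero, map_zero]
    refine Submodule.subset_span ⟨P, Q, _, _, cls X, cls Y, hasParity_cls X, hasParity_cls Y, ?_⟩
    rw [neg_one_zpow_eq_sg, Int.cast_mul]
    simp only [cons, mul_assoc, sub_mul, smul_mul_assoc]

/-- The descent to `S⁺` of a linear map which vanishes on the scalars. -/
def descend {M : Type*} [AddCommGroup M] [Module ℝ M] (f : Sym (Hsp 𝒢) →ₗ[ℝ] M)
    (h : f 1 = 0) : SPlus 𝒢 →ₗ[ℝ] M := (symRel 𝒢).liftQ _ (symRel_le_ker f h)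

theorem descend_toSPlus {M : Type*} [AddCommGroup M] [Module ℝ M] (f : Sym (Hsp 𝒢) →ₗ[ℝ] M)
    (h : f 1 = 0) (x : Sym (Hsp 𝒢)) : descend f h (toSPlus 𝒢 x) = f x := by
  obtain ⟨t, rfl⟩ := Sym.mk_surjective x
  rw [toSPlus_mk, descend, Submodule.mkQ_apply, Submodule.liftQ_apply, LinearMap.comp_apply]

/-- The product of classes of words in the symmetric algebra. -/
def sprod (L : List (List (HomEl 𝒢))) : Sym (Hsp 𝒢) := Sym.mk (tensH L)

theorem sprod_nil : sprod ([] : List (List (HomEl 𝒢))) = 1 := rfl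

theorem sprod_cons (X : List (HomEl 𝒢)) (L : List (List (HomEl 𝒢))) :
    sprod (X :: L) = Sym.mul (cls X) (sprod L) := by
  rw [sprod, tensH_cons, ← Sym.mul_mk, sprod]

theorem toSPlus_sprod (L : List (List (HomEl 𝒢))) : toSPlus 𝒢 (sprod L) = mon L := toSPlus_mk _

theorem hasParity_sprod (L : List (List (HomEl 𝒢))) : HasParity (sdeg L : ZMod 2) (sprod L) := by
  induction L with
  | nil => simpa [sdeg, sprod_nil] using Sym.one_parity
  | cons X L ih =>
    rw [sprod_cons, sdeg_cons, Int.cast_add]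
    exact Sym.mul_parity (hasParity_cls X) ih

/-- In the formula for the cobracket a piece of the cut word stands at the end of the first factor,
whereas `Sym.mul₂` puts it in front; this is the sign of the move. -/
theorem sprod_append_singleton (L : List (List (HomEl 𝒢))) (U : List (HomEl 𝒢)) :
    sprod (L ++ [U]) = sg ((sdeg L : ZMod 2) * (hdeg U : ZMod 2)) •
      Sym.mul (cls U) (sprod L) := by
  induction L with
  | nil => simp [sprod_nil, sprod_cons, sdeg_nil, sg_zero]
  | cons X L ih =>
    rw [List.cons_append, sprod_cons, ih, sprod_cons, map_smul,
      Sym.mul_comm (hasParity_cls X) (hasParity_cls U), smul_smul, ← sg_add, sdeg_cons]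
    congr 2
    push_cast
    ring

theorem coproduct_sprod (L : List (List (HomEl 𝒢))) : Sym.coproduct (sprod L) =
    ((splits L).map fun t => t.1 • (sprod t.2.1 ⊗ₜ[ℝ] sprod t.2.2)).sum := by
  induction L with
  | nil => simp [sprod_nil, Sym.coproduct_one, splits]
  | cons X L ih =>
    rw [sprod_cons, Sym.coproduct_mul, ih, Sym.cop_apply, splits, List.map_append, List.sum_append,
      List.map_map, List.map_map, map_sum_map, map_sum_map]
    refine congrArg₂ _ (sum_map_congr (fun t => ?_) _) (sum_map_congr (fun t => ?_) _)
    · rw [map_smul, Sym.lft_tmul, Function.comp_apply, sprod_cons]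
    · rw [map_smul, Sym.rgt_tmul (hasParity_cls X) (hasParity_sprod _), Function.comp_apply,
        sprod_cons, neg_one_zpow_eq_sg, Int.cast_mul, smul_smul, mul_comm t.1]

variable (𝒢) in
/-- The coproduct of `S⁺`. -/
def coproductSPlus : SPlus 𝒢 →ₗ[ℝ] SPlus 𝒢 ⊗[ℝ] SPlus 𝒢 :=
  descend (TensorProduct.map (toSPlus 𝒢) (toSPlus 𝒢) ∘ₗ Sym.coproduct) (by
    rw [LinearMap.comp_apply, Sym.coproduct_one, TensorProduct.map_tmul, toSPlus_one,
      TensorProduct.zero_tmul])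

theorem isCoproduct_coproductSPlus : IsCoproduct (coproductSPlus 𝒢) := by
  intro L
  rw [← toSPlus_sprod, coproductSPlus, descend_toSPlus, LinearMap.comp_apply, coproduct_sprod,
    map_sum_map]
  refine sum_map_congr (fun t => ?_) _
  rw [map_smul, TensorProduct.map_tmul, toSPlus_sprod, toSPlus_sprod]

theorem IsCoproduct.unique {Δ Δ' : SPlus 𝒢 →ₗ[ℝ] SPlus 𝒢 ⊗[ℝ] SPlus 𝒢} (h : IsCoproduct Δ)
    (h' : IsCoproduct Δ') : Δ = Δ' :=
  LinearMap.ext_on_range (span_mon 𝒢) fun L => (h L).trans (h' L).symm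

theorem IsCobracket.unique {κ κ' : SPlus 𝒢 →ₗ[ℝ] SPlus 𝒢 ⊗[ℝ] SPlus 𝒢} (h : IsCobracket κ)
    (h' : IsCobracket κ') : κ = κ' :=
  LinearMap.ext_on_range (span_mon 𝒢) fun L => (h L).trans (h' L).symm

/-! ### The terms of the cobracket -/

/-- The terms of the cobracket in the symmetric algebra. -/
def cobracketTermSym (P : List (List (HomEl 𝒢))) (U V : List (HomEl 𝒢))
    (Q : List (List (HomEl 𝒢))) : Sym (Hsp 𝒢) ⊗[ℝ] Sym (Hsp 𝒢) :=
  ((splits P).map fun p => ((splits Q).map fun q =>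
    ((-1 : ℝ) ^ sdeg P * (-1 : ℝ) ^ (hdeg U + 1) * p.1 * q.1 *
      (-1 : ℝ) ^ (sdeg q.2.1 * (hdeg U + hdeg V + sdeg p.2.2)
        + sdeg p.2.2 * (hdeg U + hdeg V))) •
    (sprod (p.2.1 ++ q.2.1 ++ [U]) ⊗ₜ[ℝ] sprod (V :: (p.2.2 ++ q.2.2))
      + (-1 : ℝ) ^ (hdeg U * hdeg V) •
        (sprod (p.2.1 ++ q.2.1 ++ [V]) ⊗ₜ[ℝ] sprod (U :: (p.2.2 ++ q.2.2))))).sum).sum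

theorem map_cobracketTermSym (P : List (List (HomEl 𝒢))) (U V : List (HomEl 𝒢))
    (Q : List (List (HomEl 𝒢))) :
    TensorProduct.map (toSPlus 𝒢) (toSPlus 𝒢) (cobracketTermSym P U V Q) =
      cobracketTerm P U V Q := by
  rw [cobracketTermSym, map_sum_map, cobracketTerm]
  refine sum_map_congr (fun p => ?_) _
  rw [map_sum_map]
  refine sum_map_congr (fun q => ?_) _
  rw [map_smul, map_add, map_smul, TensorProduct.map_tmul, TensorProduct.map_tmul]
  simp only [toSPlus_sprod]

/-- If the cut factor comes first, the sum over the splittings of `Q` is the coproduct of `Q`,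
multiplied by one summand of the cobracket of that factor. -/
theorem cobracketTermSym_nil (U V : List (HomEl 𝒢)) (Q : List (List (HomEl 𝒢))) :
    cobracketTermSym [] U V Q = Sym.mul₂ ((-1 : ℝ) ^ (hdeg U + 1) • (cls U ⊗ₜ[ℝ] cls V
      + (-1 : ℝ) ^ (hdeg U * hdeg V) • cls V ⊗ₜ[ℝ] cls U)) (Sym.coproduct (sprod Q)) := by
  rw [coproduct_sprod, map_sum_map, cobracketTermSym, splits, List.map_singleton,
    List.sum_singleton]
  refine sum_map_congr (fun q => ?_) _
  simp only [map_smul, map_add, LinearMap.smul_apply, LinearMap.add_apply, Sym.mul₂_tmul]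
  rw [Sym.rgt_tmul (hasParity_cls V) (hasParity_sprod _),
    Sym.rgt_tmul (hasParity_cls U) (hasParity_sprod _), List.nil_append, List.nil_append,
    sprod_append_singleton, sprod_append_singleton, sprod_cons, sprod_cons, map_smul, map_smul,
    Sym.lft_tmul, Sym.lft_tmul, sdeg_nil, ← TensorProduct.smul_tmul', ← TensorProduct.smul_tmul']
  simp only [neg_one_zpow_eq_sg]
  push_cast
  generalize (hdeg U : ZMod 2) = u, (hdeg V : ZMod 2) = v, (sdeg q.2.1 : ZMod 2) = r
  match_scalars
  all_goals
    simp only [sg_add, sg_zero, mul_one, one_mul, add_zero, zero_mul, mul_add]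
    -- The coefficient `q.1` is an arbitrary real number, so the identity is not a finite check; it
    -- follows since the signs of moving `U` or `V` past the first factor occur twice.
    have h1 := sg_mul_self (r * u)
    have h2 := sg_mul_self (r * v)
    simp only [mul_comm u r, mul_comm v r]
    first
      | linear_combination (sg u * sg 1 * q.1 * sg (r * v)) * h1
      | linear_combination (sg u * sg 1 * q.1 * sg (r * u) * sg (u * v)) * h2

/-- A further factor in front joins the left or the right side of the splitting, which is `Sym.cop`;
the extra sign is its contribution to `sdeg P`. -/
theorem cobracketTermSym_cons (X : List (HomEl 𝒢)) (P : List (List (HomEl 𝒢)))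
    (U V : List (HomEl 𝒢)) (Q : List (List (HomEl 𝒢))) :
    cobracketTermSym (X :: P) U V Q =
      (-1 : ℝ) ^ hdeg X • Sym.cop (cls X) (cobracketTermSym P U V Q) := by
  rw [Sym.cop_apply, cobracketTermSym, cobracketTermSym, splits, List.map_append, List.sum_append,
    List.map_map, List.map_map, map_sum_map, map_sum_map, smul_add, List.smul_sum, List.smul_sum,
    List.map_map, List.map_map]
  refine congrArg₂ _ (sum_map_congr (fun p => ?_) _) (sum_map_congr (fun p => ?_) _)
  · simp only [Function.comp_apply]
    rw [map_sum_map, List.smul_sum, List.map_map]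
    refine sum_map_congr (fun q => ?_) _
    simp only [Function.comp_apply, map_smul, map_add, Sym.lft_tmul, List.cons_append, sprod_cons,
      sdeg_cons, neg_one_zpow_eq_sg]
    push_cast
    simp only [sg_add]
    module
  · simp only [Function.comp_apply]
    rw [map_sum_map, List.smul_sum, List.map_map]
    refine sum_map_congr (fun q => ?_) _
    simp only [Function.comp_apply, map_smul, map_add]
    rw [Sym.rgt_tmul (hasParity_cls X) (hasParity_sprod _),
      Sym.rgt_tmul (hasParity_cls X) (hasParity_sprod _), List.cons_append]
    simp only [sprod_cons, sdeg_append, sdeg_cons, sdeg_nil]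
    rw [Sym.mul_comm (hasParity_cls X) (hasParity_cls V),
      Sym.mul_comm (hasParity_cls X) (hasParity_cls U)]
    simp only [neg_one_zpow_eq_sg, TensorProduct.tmul_smul]
    push_cast
    generalize (hdeg U : ZMod 2) = u, (hdeg V : ZMod 2) = v, (sdeg q.2.1 : ZMod 2) = r,
      (hdeg X : ZMod 2) = x, (sdeg p.2.1 : ZMod 2) = s
    simp only [sg_add, mul_add, add_mul, mul_comm r x, mul_zero, sg_zero, mul_one]
    module

end GInfinity

end

/-! ### Explicit formulas for the operators and transfer to `S⁺` -/

open scoped TensorProduct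

noncomputable section

namespace GInfinity

open SuperModule TensorInstances

set_option linter.unusedSectionVars false

variable {G : Type*} [AddCommGroup G] [Module ℝ G] {𝒢 : ℤ → Submodule ℝ G}
  [DirectSum.Decomposition 𝒢]

theorem mul_mk_letters (X : List (HomEl 𝒢)) (P : List (List (HomEl 𝒢))) (Y : Hsp 𝒢)
    (t : TensorAlgebra ℝ (Hsp 𝒢)) :
    Sym.mul (cls X) (Sym.mk (tensH P * TensorAlgebra.ι ℝ Y * t)) =
      Sym.mk (tensH (X :: P) * TensorAlgebra.ι ℝ Y * t) := by
  rw [Sym.mul_mk, tensH_cons]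
  simp only [cons, mul_assoc]

/-- An operator on `S⁺` which is induced by an operator on the symmetric algebra. -/
structure Lifts (D : SPlus 𝒢 →ₗ[ℝ] SPlus 𝒢) (E : Sym (Hsp 𝒢) →ₗ[ℝ] Sym (Hsp 𝒢)) : Prop where
  apply : ∀ x, D (toSPlus 𝒢 x) = toSPlus 𝒢 (E x)

theorem parityS_toSPlus (x : Sym (Hsp 𝒢)) :
    parityS 𝒢 (toSPlus 𝒢 x) = toSPlus 𝒢 (par x) := by
  obtain ⟨t, rfl⟩ := Sym.mk_surjective x
  rw [Sym.par_mk, toSPlus_mk, toSPlus_mk]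
  rfl

theorem Lifts.koszulExt {D : SPlus 𝒢 →ₗ[ℝ] SPlus 𝒢} {E : Sym (Hsp 𝒢) →ₗ[ℝ] Sym (Hsp 𝒢)}
    (h : Lifts D E) (z : Sym (Hsp 𝒢) ⊗[ℝ] Sym (Hsp 𝒢)) :
    koszulExt D (TensorProduct.map (toSPlus 𝒢) (toSPlus 𝒢) z) =
      TensorProduct.map (toSPlus 𝒢) (toSPlus 𝒢) (kext 1 E z) := by
  induction z with
  | zero => simp
  | add z z' h h' => simp only [map_add, h, h']
  | tmul x y =>
    rw [GInfinity.koszulExt, kext, parPow_one, LinearMap.add_apply, LinearMap.add_apply, map_add]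
    simp only [TensorProduct.map_tmul, h.apply, parityS_toSPlus, LinearMap.id_apply]

theorem Lifts.coderivation {D : SPlus 𝒢 →ₗ[ℝ] SPlus 𝒢} {E : Sym (Hsp 𝒢) →ₗ[ℝ] Sym (Hsp 𝒢)}
    (h : Lifts D E) {Δ : SPlus 𝒢 →ₗ[ℝ] SPlus 𝒢 ⊗[ℝ] SPlus 𝒢}
    {Δ' : Sym (Hsp 𝒢) →ₗ[ℝ] Sym (Hsp 𝒢) ⊗[ℝ] Sym (Hsp 𝒢)}
    (hΔ : ∀ x, Δ (toSPlus 𝒢 x) = TensorProduct.map (toSPlus 𝒢) (toSPlus 𝒢) (Δ' x))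
    (hE : kext 1 E ∘ₗ Δ' = Δ' ∘ₗ E) : IsCoderivationOfCoproduct Δ D := by
  refine LinearMap.ext fun x => ?_
  obtain ⟨x, rfl⟩ := toSPlus_surjective x
  have h1 := LinearMap.congr_fun hE x
  rw [LinearMap.comp_apply, LinearMap.comp_apply] at h1
  rw [LinearMap.comp_apply, hΔ, h.koszulExt, h1, LinearMap.comp_apply, h.apply, hΔ]

theorem Lifts.coderivation_neg {D : SPlus 𝒢 →ₗ[ℝ] SPlus 𝒢}
    {E : Sym (Hsp 𝒢) →ₗ[ℝ] Sym (Hsp 𝒢)} (h : Lifts D E)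
    {κ : SPlus 𝒢 →ₗ[ℝ] SPlus 𝒢 ⊗[ℝ] SPlus 𝒢}
    {κ' : Sym (Hsp 𝒢) →ₗ[ℝ] Sym (Hsp 𝒢) ⊗[ℝ] Sym (Hsp 𝒢)}
    (hκ : ∀ x, κ (toSPlus 𝒢 x) = TensorProduct.map (toSPlus 𝒢) (toSPlus 𝒢) (κ' x))
    (hE : kext 1 E ∘ₗ κ' = -(κ' ∘ₗ E)) : IsCoderivationOfCobracket κ D := by
  refine LinearMap.ext fun x => ?_
  obtain ⟨x, rfl⟩ := toSPlus_surjective x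
  have h1 := LinearMap.congr_fun hE x
  rw [LinearMap.comp_apply, LinearMap.neg_apply, LinearMap.comp_apply] at h1
  rw [LinearMap.comp_apply, hκ, h.koszulExt, h1, LinearMap.neg_apply, LinearMap.comp_apply,
    h.apply, hκ]
  exact map_neg _ _

namespace GradedProductBracket

variable (A : GradedProductBracket 𝒢)

theorem IsProductOnH.unique {A : GradedProductBracket 𝒢} {m m' : Hsp 𝒢 →ₗ[ℝ] Hsp 𝒢}
    (h : A.IsProductOnH m) (h' : A.IsProductOnH m') : m = m' :=
  LinearMap.ext_on_range (span_cls 𝒢) fun L => (h L).trans (h' L).symm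

theorem IsBracketOnH.unique {A : GradedProductBracket 𝒢} {b b' : Hsp 𝒢 →ₗ[ℝ] Hsp 𝒢 →ₗ[ℝ] Hsp 𝒢}
    (h : A.IsBracketOnH b) (h' : A.IsBracketOnH b') : b = b' :=
  LinearMap.ext_on_range (span_cls 𝒢) fun L => LinearMap.ext_on_range (span_cls 𝒢) fun L' =>
    (h L L').trans (h' L L').symm

theorem IsProductExtension.unique {A : GradedProductBracket 𝒢} {m m' : SPlus 𝒢 →ₗ[ℝ] SPlus 𝒢}
    (h : A.IsProductExtension m) (h' : A.IsProductExtension m') : m = m' :=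
  LinearMap.ext_on_range (span_mon 𝒢) fun L => (h L).trans (h' L).symm

theorem IsBracketExtension.unique {A : GradedProductBracket 𝒢} {l l' : SPlus 𝒢 →ₗ[ℝ] SPlus 𝒢}
    (h : A.IsBracketExtension l) (h' : A.IsBracketExtension l') : l = l' :=
  LinearMap.ext_on_range (span_mon 𝒢) fun L => (h L).trans (h' L).symm

variable [SuperModule G] [GradedSuper 𝒢]

/-- The head of `picks` cuts the first factor (`cobracketTermSym_nil`) and the tail cuts a later one
(`cobracketTermSym_cons`); these are the two summands of `cobracket_mul`. -/
theorem cobracket_sprod (L : List (List (HomEl 𝒢))) : A.symData.cobracket (sprod L) =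
    ((picks L).map fun t => ∑ j ∈ Finset.Ico 1 t.2.1.length,
      cobracketTermSym t.1 (t.2.1.take j) (t.2.1.drop j) t.2.2).sum := by
  induction L with
  | nil => simp [sprod_nil, SymData.cobracket_one, picks]
  | cons X L ih =>
    rw [sprod_cons, A.symData.cobracket_mul (hasParity_cls X), ih, picks, List.map_cons,
      List.sum_cons, List.map_map, add_comm, map_sum_map, List.smul_sum, List.map_map]
    refine congrArg₂ _ ?_ (sum_map_congr (fun t => ?_) _)
    · rw [symData_k0, map_sum, LinearMap.sum_apply]
      simp only [cobracketTermSym_nil]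
    · simp only [Function.comp_apply, cobracketTermSym_cons, map_sum, Finset.smul_sum,
        neg_one_zpow_eq_sg]

theorem mS_sprod (L : List (List (HomEl 𝒢))) : A.symData.mS (sprod L) =
    ((picks L).map fun t => (-1 : ℝ) ^ sdeg t.1 •
      Sym.mk (tensH t.1 * TensorAlgebra.ι ℝ (A.mulWord t.2.1) * tensH t.2.2)).sum := by
  induction L with
  | nil => simp [sprod_nil, SymData.mS_one, picks]
  | cons X L ih =>
    rw [sprod_cons, A.symData.mS_mul (hasParity_cls X), ih, picks, List.map_cons,
      List.sum_cons, List.map_map, map_sum_map, List.smul_sum, List.map_map]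
    refine congrArg₂ _ ?_ (sum_map_congr (fun t => ?_) _)
    · rw [symData_m0, sdeg_nil, zpow_zero, one_smul, tensH_nil, one_mul]
      exact Sym.mul_mk _ _
    · simp only [Function.comp_apply]
      rw [map_smul, mul_mk_letters, sdeg_cons, smul_smul, ← neg_one_zpow_eq_sg,
        zpow_add₀ (by norm_num)]

theorem hasParity_bracketWord (X Y : List (HomEl 𝒢)) :
    HasParity ((hdeg X : ZMod 2) + (hdeg Y : ZMod 2) + 1) (A.bracketWord X Y) := by
  rw [← bH_cls]
  exact A.quotient.bH_parity (hasParity_cls X) (hasParity_cls Y)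

theorem ad_sprod (X : List (HomEl 𝒢)) (L : List (List (HomEl 𝒢))) :
    A.symData.ad (cls X) (sprod L) =
      ((picks L).map fun s => ((-1 : ℝ) ^ (hdeg s.2.1 * sdeg s.1) * (-1 : ℝ) ^ hdeg X) •
        Sym.mul (A.bracketWord X s.2.1) (sprod (s.1 ++ s.2.2))).sum := by
  induction L with
  | nil => simp [sprod_nil, SymData.ad_one, picks]
  | cons Z L ih =>
    rw [sprod_cons, A.symData.ad_mul (hasParity_cls X) (hasParity_cls Z), ih, picks, List.map_cons,
      List.sum_cons, List.map_map, map_sum_map, List.smul_sum, List.map_map]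
    refine congrArg₂ _ ?_ (sum_map_congr (fun t => ?_) _)
    · rw [symData_l2, sdeg_nil, mul_zero, zpow_zero, one_mul, map_smul, LinearMap.smul_apply,
        List.nil_append]
    · simp only [Function.comp_apply]
      rw [map_smul, List.cons_append, sprod_cons,
        Sym.mul_comm (hasParity_cls Z) (A.hasParity_bracketWord X t.2.1), smul_smul, smul_smul,
        sdeg_cons, neg_one_zpow_eq_sg, neg_one_zpow_eq_sg, neg_one_zpow_eq_sg]
      congr 1
      push_cast
      generalize (hdeg X : ZMod 2) = x, (hdeg Z : ZMod 2) = z, (hdeg t.2.1 : ZMod 2) = y,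
        (sdeg t.1 : ZMod 2) = p
      simp only [sg]; norm_cast; clear * - x y z p; revert x y z p; decide

/-- Pairs containing the first factor come from `ad`, all others from the induction hypothesis after
the bracket has been moved in front of the first factor. -/
theorem lS_sprod (L : List (List (HomEl 𝒢))) : A.symData.lS (sprod L) =
    ((picks L).map fun t => ((picks t.2.2).map fun s =>
      ((-1 : ℝ) ^ (hdeg t.2.1 * sdeg t.1 + hdeg s.2.1 * (sdeg t.1 + sdeg s.1)) *
          (-1 : ℝ) ^ hdeg t.2.1) •
        Sym.mul (A.bracketWord t.2.1 s.2.1) (sprod (t.1 ++ s.1 ++ s.2.2))).sum).sum := by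
  induction L with
  | nil => simp [sprod_nil, SymData.lS_one, picks]
  | cons X L ih =>
    rw [sprod_cons, A.symData.lS_mul (hasParity_cls X), ih, ad_sprod, picks, List.map_cons,
      List.sum_cons, List.map_map, map_sum_map, List.smul_sum, List.map_map]
    refine congrArg₂ _ (sum_map_congr (fun s => ?_) _) (sum_map_congr (fun t => ?_) _)
    · rw [sdeg_nil, mul_zero, zero_add, zero_add, List.nil_append]
    · simp only [Function.comp_apply]
      rw [map_sum_map, List.smul_sum, List.map_map]
      refine sum_map_congr (fun s => ?_) _
      simp only [Function.comp_apply]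
      rw [map_smul, List.cons_append, List.cons_append, sprod_cons,
        Sym.mul_comm (hasParity_cls X) (A.hasParity_bracketWord t.2.1 s.2.1), smul_smul, smul_smul,
        sdeg_cons]
      simp only [neg_one_zpow_eq_sg]
      congr 1
      push_cast
      generalize (hdeg X : ZMod 2) = x, (hdeg t.2.1 : ZMod 2) = z, (hdeg s.2.1 : ZMod 2) = y,
        (sdeg t.1 : ZMod 2) = p, (sdeg s.1 : ZMod 2) = q
      simp only [sg_add, mul_add, add_mul, one_mul, _root_.mul_comm x]
      linear_combination (sg z * sg (z * p) * sg (y * p) * sg (y * q) * sg (z * x) * sg (y * x)) *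
        sg_mul_self x

/-- The cobracket of `S⁺`. -/
def cobracketSPlus : SPlus 𝒢 →ₗ[ℝ] SPlus 𝒢 ⊗[ℝ] SPlus 𝒢 :=
  descend (TensorProduct.map (toSPlus 𝒢) (toSPlus 𝒢) ∘ₗ A.symData.cobracket) (by
    rw [LinearMap.comp_apply, SymData.cobracket_one, map_zero])

/-- The extension of the product to `S⁺`. -/
def mulSPlus : SPlus 𝒢 →ₗ[ℝ] SPlus 𝒢 :=
  descend (toSPlus 𝒢 ∘ₗ A.symData.mS) (by rw [LinearMap.comp_apply, SymData.mS_one, map_zero])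

/-- The extension of the bracket to `S⁺`. -/
def bracketSPlus : SPlus 𝒢 →ₗ[ℝ] SPlus 𝒢 :=
  descend (toSPlus 𝒢 ∘ₗ A.symData.lS) (by rw [LinearMap.comp_apply, SymData.lS_one, map_zero])

theorem isCobracket_cobracketSPlus : IsCobracket A.cobracketSPlus := by
  intro L
  rw [← toSPlus_sprod, cobracketSPlus, descend_toSPlus, LinearMap.comp_apply, cobracket_sprod,
    map_sum_map]
  refine sum_map_congr (fun t => ?_) _
  rw [map_sum]
  simp only [map_cobracketTermSym]

theorem isProductExtension_mulSPlus : A.IsProductExtension A.mulSPlus := by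
  intro L
  rw [← toSPlus_sprod, mulSPlus, descend_toSPlus, LinearMap.comp_apply, mS_sprod, map_sum_map]
  refine sum_map_congr (fun t => ?_) _
  rw [map_smul, toSPlus_mk]

theorem isBracketExtension_bracketSPlus : A.IsBracketExtension A.bracketSPlus := by
  intro L
  rw [← toSPlus_sprod, bracketSPlus, descend_toSPlus, LinearMap.comp_apply, lS_sprod, map_sum_map]
  refine sum_map_congr (fun t => ?_) _
  rw [map_sum_map]
  refine sum_map_congr (fun s => ?_) _
  rw [map_smul, sprod, Sym.mul_mk, toSPlus_mk]
  rfl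

theorem isProductOnH_mH : A.IsProductOnH A.quotient.mH := A.symData_m0

theorem isBracketOnH_bH : A.IsBracketOnH A.quotient.bH := A.bH_cls

theorem lifts_mulSPlus : Lifts A.mulSPlus A.symData.mS := ⟨descend_toSPlus _ _⟩

theorem lifts_bracketSPlus : Lifts A.bracketSPlus A.symData.lS := ⟨descend_toSPlus _ _⟩

theorem mulSPlus_coproduct : IsCoderivationOfCoproduct (coproductSPlus 𝒢) A.mulSPlus :=
  A.lifts_mulSPlus.coderivation (descend_toSPlus _ _) A.symData.mS_coproduct

theorem mulSPlus_cobracket : IsCoderivationOfCobracket A.cobracketSPlus A.mulSPlus :=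
  A.lifts_mulSPlus.coderivation_neg (descend_toSPlus _ _) A.symData.mS_cobracket

theorem bracketSPlus_coproduct : IsCoderivationOfCoproduct (coproductSPlus 𝒢) A.bracketSPlus :=
  A.lifts_bracketSPlus.coderivation (descend_toSPlus _ _) A.symData.lS_coproduct

theorem bracketSPlus_cobracket : IsCoderivationOfCobracket A.cobracketSPlus A.bracketSPlus :=
  A.lifts_bracketSPlus.coderivation_neg (descend_toSPlus _ _) A.symData.lS_cobracket

end GradedProductBracket

end GInfinity

end

open scoped TensorProduct

noncomputable section

namespace GInfinity

open SuperModule TensorInstances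

set_option linter.unusedSectionVars false

namespace SymData

open _root_.GInfinity.Sym

variable {W : Type*} [AddCommGroup W] [Module ℝ W] [SuperModule W] (S : SymData W)

/-! ### Evaluation on products of few letters -/

theorem mS_one_letter {p : ZMod 2} {X : W} (hX : HasParity p X) :
    S.mS (mul X 1) = mul (S.m0 X) 1 := by
  rw [S.mS_mul hX, mS_one, map_zero, smul_zero, add_zero]

theorem lS_one_letter {p : ZMod 2} {X : W} (hX : HasParity p X) : S.lS (mul X 1) = 0 := by
  rw [S.lS_mul hX, lS_one, map_zero, smul_zero, add_zero, ad_one]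

theorem lS_two_letters {p q : ZMod 2} {X Y : W} (hX : HasParity p X) (hY : HasParity q Y) :
    S.lS (mul X (mul Y 1)) = mul (S.l2 X Y) 1 := by
  rw [S.lS_mul hX, S.lS_one_letter hY, map_zero, smul_zero, add_zero, S.ad_mul hX hY, ad_one,
    map_zero, smul_zero, add_zero]

theorem lS_three_letters {p q r : ZMod 2} {X Y Z : W} (hX : HasParity p X) (hY : HasParity q Y)
    (hZ : HasParity r Z) : S.lS (mul X (mul Y (mul Z 1))) = mul (S.l2 X Y) (mul Z 1)
      + sg ((p + 1) * q) • mul Y (mul (S.l2 X Z) 1) + sg p • mul X (mul (S.l2 Y Z) 1) := by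
  rw [S.lS_mul hX, S.lS_two_letters hY hZ, S.ad_mul hX hY, S.ad_mul hX hZ, ad_one, map_zero,
    smul_zero, add_zero]

/-- The operator `mS` keeps the number of letters. -/
theorem linearPart_mS_mul_mul {p q : ZMod 2} {X Y : W} (hX : HasParity p X) (hY : HasParity q Y)
    (r : Sym W) : linearPart (S.mS (mul X (mul Y r))) = 0 := by
  rw [S.mS_mul hX, S.mS_mul hY]
  simp [linearPart_mul_mul]

/-- The operator `lS` removes only one letter, so at least two remain. -/
theorem linearPart_lS_mul_mul_mul {p q r : ZMod 2} {X Y Z : W} (hX : HasParity p X)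
    (hY : HasParity q Y) (hZ : HasParity r Z) (s : Sym W) :
    linearPart (S.lS (mul X (mul Y (mul Z s)))) = 0 := by
  rw [S.lS_mul hX, S.lS_mul hY, S.ad_mul hX hY, S.ad_mul hX hZ, S.ad_mul hY hZ]
  simp [linearPart_mul_mul]

theorem linearPart_mS_mS_one {p : ZMod 2} {X : W} (hX : HasParity p X) :
    linearPart (S.mS (S.mS (mul X 1))) = S.m0 (S.m0 X) := by
  rw [S.mS_one_letter hX, S.mS_one_letter (S.m0_parity hX), linearPart_mul_one]

theorem linearPart_mS_mS_two {p q : ZMod 2} {X Y : W} (hX : HasParity p X) (hY : HasParity q Y)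
    (r : Sym W) : linearPart (S.mS (S.mS (mul X (mul Y r)))) = 0 := by
  rw [S.mS_mul hX, S.mS_mul hY]
  simp only [map_add, map_smul, S.linearPart_mS_mul_mul hX hY,
    S.linearPart_mS_mul_mul (S.m0_parity hX) hY, S.linearPart_mS_mul_mul hX (S.m0_parity hY),
    smul_zero, add_zero]

theorem linearPart_mS_lS_two {p q : ZMod 2} {X Y : W} (hX : HasParity p X) (hY : HasParity q Y) :
    linearPart (S.mS (S.lS (mul X (mul Y 1)))) + linearPart (S.lS (S.mS (mul X (mul Y 1)))) =
      S.m0 (S.l2 X Y) + S.l2 (S.m0 X) Y + sg p • S.l2 X (S.m0 Y) := by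
  rw [S.lS_two_letters hX hY, S.mS_one_letter (S.l2_parity hX hY), S.mS_mul hX,
    S.mS_one_letter hY, map_add, map_smul, S.lS_two_letters (S.m0_parity hX) hY,
    S.lS_two_letters hX (S.m0_parity hY), map_add, map_smul, linearPart_mul_one,
    linearPart_mul_one, linearPart_mul_one, add_assoc]

theorem linearPart_lS_lS_two {p q : ZMod 2} {X Y : W} (hX : HasParity p X) (hY : HasParity q Y) :
    linearPart (S.lS (S.lS (mul X (mul Y 1)))) = 0 := by
  rw [S.lS_two_letters hX hY, S.lS_one_letter (S.l2_parity hX hY), map_zero]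

theorem linearPart_lS_lS_three {p q r : ZMod 2} {X Y Z : W} (hX : HasParity p X)
    (hY : HasParity q Y) (hZ : HasParity r Z) :
    linearPart (S.lS (S.lS (mul X (mul Y (mul Z 1))))) =
      S.l2 (S.l2 X Y) Z + sg ((p + 1) * q) • S.l2 Y (S.l2 X Z) + sg p • S.l2 X (S.l2 Y Z) := by
  rw [S.lS_three_letters hX hY hZ]
  simp only [map_add, map_smul]
  rw [S.lS_two_letters (S.l2_parity hX hY) hZ, S.lS_two_letters hY (S.l2_parity hX hZ),
    S.lS_two_letters hX (S.l2_parity hY hZ), linearPart_mul_one, linearPart_mul_one,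
    linearPart_mul_one]

theorem linearPart_mS_lS_three {p q r : ZMod 2} {X Y Z : W} (hX : HasParity p X)
    (hY : HasParity q Y) (hZ : HasParity r Z) :
    linearPart (S.mS (S.lS (mul X (mul Y (mul Z 1))))) = 0 := by
  rw [S.lS_three_letters hX hY hZ]
  simp only [map_add, map_smul, S.linearPart_mS_mul_mul (S.l2_parity hX hY) hZ,
    S.linearPart_mS_mul_mul hY (S.l2_parity hX hZ), S.linearPart_mS_mul_mul hX (S.l2_parity hY hZ),
    smul_zero, add_zero]

theorem linearPart_lS_mS_three {p q r : ZMod 2} {X Y Z : W} (hX : HasParity p X)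
    (hY : HasParity q Y) (hZ : HasParity r Z) :
    linearPart (S.lS (S.mS (mul X (mul Y (mul Z 1))))) = 0 := by
  rw [S.mS_mul hX, S.mS_mul hY, S.mS_one_letter hZ]
  simp only [map_add, map_smul, S.linearPart_lS_mul_mul_mul (S.m0_parity hX) hY hZ,
    S.linearPart_lS_mul_mul_mul hX (S.m0_parity hY) hZ,
    S.linearPart_lS_mul_mul_mul hX hY (S.m0_parity hZ), smul_zero, add_zero]

theorem m0_m0_of_mS (h : ∀ x, linearPart (S.mS (S.mS x)) = 0) (X : W) : S.m0 (S.m0 X) = 0 := by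
  refine LinearMap.congr_fun (f := S.m0 ∘ₗ S.m0) (g := 0) (linearMap_ext_parity ?_) X
  intro p X hX
  exact (S.linearPart_mS_mS_one hX).symm.trans (h _)

/-- The three parts of the square lower the number of letters by zero, one and two. The linear part
on a product of one, two or three letters therefore isolates one of them. -/
theorem linearPart_sq {p q r : ZMod 2} {X Y Z : W} (hX : HasParity p X)
    (hY : HasParity q Y) (hZ : HasParity r Z)
    (h : ∀ x, linearPart ((S.mS + S.lS) ((S.mS + S.lS) x)) = 0) :
    S.m0 (S.m0 X) = 0 ∧
    S.m0 (S.l2 X Y) + S.l2 (S.m0 X) Y + sg p • S.l2 X (S.m0 Y) = 0 ∧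
    S.l2 (S.l2 X Y) Z + sg ((p + 1) * q) • S.l2 Y (S.l2 X Z) + sg p • S.l2 X (S.l2 Y Z) = 0 := by
  have h' : ∀ x, linearPart (S.mS (S.mS x)) + (linearPart (S.mS (S.lS x)) +
      linearPart (S.lS (S.mS x))) + linearPart (S.lS (S.lS x)) = 0 := by
    intro x
    rw [← h x]
    simp only [LinearMap.add_apply, map_add]
    abel
  refine ⟨?_, ?_, ?_⟩
  · have h1 := h' (mul X 1)
    rwa [S.linearPart_mS_mS_one hX, S.lS_one_letter hX, S.mS_one_letter hX,
      S.lS_one_letter (S.m0_parity hX), map_zero, map_zero, map_zero, map_zero, add_zero, add_zero,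
      add_zero] at h1
  · have h1 := h' (mul X (mul Y 1))
    rwa [S.linearPart_mS_mS_two hX hY, S.linearPart_mS_lS_two hX hY, S.linearPart_lS_lS_two hX hY,
      zero_add, add_zero] at h1
  · have h1 := h' (mul X (mul Y (mul Z 1)))
    rwa [S.linearPart_mS_mS_two hX hY, S.linearPart_mS_lS_three hX hY hZ,
      S.linearPart_lS_mS_three hX hY hZ, S.linearPart_lS_lS_three hX hY hZ, zero_add, zero_add,
      zero_add] at h1

end SymData

/-! ### Degrees -/

variable {G : Type*} [AddCommGroup G] [Module ℝ G] {𝒢 : ℤ → Submodule ℝ G}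

variable (𝒢) in
/-- The span of the words of degree `n`. -/
def gradeT (n : ℤ) : Submodule ℝ (TensorAlgebra ℝ G) :=
  Submodule.span ℝ (tens '' {w : List (HomEl 𝒢) | wdeg w = n})

theorem tens_mem_gradeT {w : List (HomEl 𝒢)} {n : ℤ} (h : wdeg w = n) : tens w ∈ gradeT 𝒢 n :=
  Submodule.subset_span ⟨w, h, rfl⟩

theorem ι_mul_mem_gradeT (a : HomEl 𝒢) {n k : ℤ} {x : TensorAlgebra ℝ G} (hx : x ∈ gradeT 𝒢 n)
    (h : a.deg + n = k) : TensorAlgebra.ι ℝ a.val * x ∈ gradeT 𝒢 k := by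
  induction hx using Submodule.span_induction with
  | mem x hx =>
    obtain ⟨w, hw, rfl⟩ := hx
    have h1 := tens_mem_gradeT (w := a :: w) (n := k) (by rw [wdeg_cons, show wdeg w = _ from hw, h])
    rwa [tens_cons] at h1
  | zero => rw [mul_zero]; exact Submodule.zero_mem _
  | add x y _ _ hx hy => rw [mul_add]; exact Submodule.add_mem _ hx hy
  | smul c x _ hx => rw [mul_smul_comm]; exact Submodule.smul_mem _ _ hx

theorem shuffle_mem_gradeT (u v : List (HomEl 𝒢)) : shuffle u v ∈ gradeT 𝒢 (wdeg u + wdeg v) := by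
  induction u, v using shuffle.induct with
  | case1 v => rw [shuffle]; exact tens_mem_gradeT (by simp [wdeg])
  | case2 a u => rw [shuffle]; exact tens_mem_gradeT (by simp [wdeg])
  | case3 a u b v ih1 ih2 =>
    rw [shuffle]
    refine Submodule.add_mem _ (ι_mul_mem_gradeT a ih1 ?_)
      (Submodule.smul_mem _ _ (ι_mul_mem_gradeT b ih2 ?_))
    all_goals rw [wdeg_cons, wdeg_cons]; ring

theorem picks_eq {α : Type*} {L : List α} {t : List α × α × List α} (h : t ∈ picks L) :
    L = t.1 ++ t.2.1 :: t.2.2 := by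
  induction L generalizing t with
  | nil => simp [picks] at h
  | cons a L ih =>
    rw [picks, List.mem_cons, List.mem_map] at h
    rcases h with rfl | ⟨s, hs, rfl⟩
    · rfl
    · rw [List.cons_append, ← ih hs]

theorem sum_map_mem {α M : Type*} [AddCommGroup M] [Module ℝ M] (P : Submodule ℝ M) {f : α → M}
    {l : List α} (h : ∀ a ∈ l, f a ∈ P) : (l.map f).sum ∈ P :=
  list_sum_mem (by simpa using h)

theorem ι_mem_gradeS (P Q : List (List (HomEl 𝒢))) {d n : ℤ} {Y : TensorAlgebra ℝ G}
    (hY : Y ∈ gradeT 𝒢 d) (h : sdeg P + (d - 1) + sdeg Q = n) :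
    (symRel 𝒢).mkQ (tensH P * TensorAlgebra.ι ℝ ((shuffleRel 𝒢).mkQ Y) * tensH Q) ∈
      gradeS 𝒢 n := by
  induction hY using Submodule.span_induction with
  | mem x hx =>
    obtain ⟨w, hw, rfl⟩ := hx
    refine Submodule.subset_span ⟨P ++ w :: Q, ?_, ?_⟩
    · rw [sdeg_append, sdeg_cons, ← h, hdeg, show wdeg w = _ from hw]; ring
    · rw [mon, tensH_append, tensH_cons, cons, mul_assoc]
      rfl
  | zero => simp
  | add x y _ _ hx hy =>
    rw [map_add, map_add, mul_add, add_mul, map_add]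
    exact Submodule.add_mem _ hx hy
  | smul c x _ hx =>
    rw [map_smul, map_smul, mul_smul_comm, smul_mul_assoc, map_smul]
    exact Submodule.smul_mem _ _ hx

/-- Integral degrees are invisible to parities, so degree one is read off from the explicit formulas
on monomials. -/
theorem isDegreeOne_of_mon [DirectSum.Decomposition 𝒢] {D : SPlus 𝒢 →ₗ[ℝ] SPlus 𝒢}
    (h : ∀ L : List (List (HomEl 𝒢)), D (mon L) ∈ gradeS 𝒢 (sdeg L + 1)) : IsDegreeOne D := by
  intro n x hx
  induction hx using Submodule.span_induction with
  | mem x hx =>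
    obtain ⟨L, rfl, rfl⟩ := hx
    exact h L
  | zero => rw [map_zero]; exact Submodule.zero_mem _
  | add x y _ _ hx hy => rw [map_add]; exact Submodule.add_mem _ hx hy
  | smul c x _ hx => rw [map_smul]; exact Submodule.smul_mem _ _ hx

namespace GradedProductBracket

variable [DirectSum.Decomposition 𝒢] (A : GradedProductBracket 𝒢)

theorem mulTens_mem_gradeT (w : List (HomEl 𝒢)) : A.mulTens w ∈ gradeT 𝒢 (wdeg w + 1) := by
  induction w using mulTens.induct with
  | case1 => rw [mulTens]; exact Submodule.zero_mem _
  | case2 a => rw [mulTens]; exact Submodule.zero_mem _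
  | case3 a b w ih =>
    rw [mulTens]
    refine Submodule.add_mem _ (Submodule.smul_mem _ _ ?_) (Submodule.smul_mem _ _ ?_)
    · refine ι_mul_mem_gradeT (A.mulEl a b) (tens_mem_gradeT rfl) ?_
      rw [mulEl_deg, wdeg_cons, wdeg_cons]; ring
    · refine ι_mul_mem_gradeT a ih ?_
      rw [wdeg_cons a]; ring

theorem bracketTens_mem_gradeT (u v : List (HomEl 𝒢)) :
    A.bracketTens u v ∈ gradeT 𝒢 (wdeg u + wdeg v) := by
  induction u, v using bracketTens.induct with
  | case1 v => rw [bracketTens]; exact Submodule.zero_mem _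
  | case2 a u => rw [bracketTens]; exact Submodule.zero_mem _
  | case3 a u b v ih1 ih2 =>
    rw [bracketTens]
    refine Submodule.add_mem _ (Submodule.add_mem _ (Submodule.smul_mem _ _ ?_) ?_)
      (Submodule.smul_mem _ _ ?_)
    · refine ι_mul_mem_gradeT (A.bracketEl a b) (shuffle_mem_gradeT u v) ?_
      rw [bracketEl_deg, wdeg_cons, wdeg_cons]; ring
    · refine ι_mul_mem_gradeT a ih1 ?_
      rw [wdeg_cons a]; ring
    · refine ι_mul_mem_gradeT b ih2 ?_
      rw [wdeg_cons b]; ring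

theorem IsProductExtension.isDegreeOne {A : GradedProductBracket 𝒢} {m : SPlus 𝒢 →ₗ[ℝ] SPlus 𝒢}
    (h : A.IsProductExtension m) : IsDegreeOne m := by
  refine isDegreeOne_of_mon fun L => ?_
  rw [h L]
  refine sum_map_mem _ fun t ht => Submodule.smul_mem _ _ ?_
  refine ι_mem_gradeS _ _ (A.mulTens_mem_gradeT t.2.1) ?_
  rw [picks_eq ht, sdeg_append, sdeg_cons, hdeg]
  ring

theorem IsBracketExtension.isDegreeOne {A : GradedProductBracket 𝒢} {l : SPlus 𝒢 →ₗ[ℝ] SPlus 𝒢}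
    (h : A.IsBracketExtension l) : IsDegreeOne l := by
  refine isDegreeOne_of_mon fun L => ?_
  rw [h L]
  refine sum_map_mem _ fun t ht => sum_map_mem _ fun s hs => Submodule.smul_mem _ _ ?_
  -- The bracket stands in front, so the list of factors before it is empty.
  rw [← one_mul (TensorAlgebra.ι ℝ _), ← tensH_nil]
  refine ι_mem_gradeS _ _ (A.bracketTens_mem_gradeT t.2.1 s.2.1) ?_
  rw [picks_eq ht, picks_eq hs]
  simp only [sdeg_append, sdeg_cons, hdeg, sdeg_nil]
  ring

end GradedProductBracket

end GInfinity

end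

/-! ### Letters in `ℋ`, the axioms in shifted form, and the equivalences -/

open scoped TensorProduct

noncomputable section

namespace GInfinity

open SuperModule TensorInstances

set_option linter.unusedSectionVars false

variable {G : Type*} [AddCommGroup G] [Module ℝ G] {𝒢 : ℤ → Submodule ℝ G}
  [DirectSum.Decomposition 𝒢]

/-- The projection of the tensor algebra to the letters. -/
def letterPart {V : Type*} [AddCommGroup V] [Module ℝ V] [SuperModule V] :
    TensorAlgebra ℝ V →ₗ[ℝ] V :=
  recT 0 0 ((LinearMap.lsmul ℝ V).flip.compl₂ ShuffleQuotient.counit)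

theorem letterPart_one {V : Type*} [AddCommGroup V] [Module ℝ V] [SuperModule V] :
    letterPart (1 : TensorAlgebra ℝ V) = 0 := recT_one _ _ _

theorem letterPart_cons {V : Type*} [AddCommGroup V] [Module ℝ V] [SuperModule V] (v : V)
    (t : TensorAlgebra ℝ V) : letterPart (cons v t) = ShuffleQuotient.counit t • v := by
  rw [letterPart, recT_cons]
  simp

namespace GradedProductBracket

variable (A : GradedProductBracket 𝒢) [SuperModule G] [GradedSuper 𝒢]

theorem counit_sh (u v : List (HomEl 𝒢)) (h : u ≠ [] ∨ v ≠ []) :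
    ShuffleQuotient.counit (sh (tens u) (tens v)) = 0 := by
  rcases u with _ | ⟨a, u⟩
  · obtain ⟨b, v, rfl⟩ := List.exists_cons_of_ne_nil (by simpa using h)
    rw [tens_nil, one_sh, tens_cons, ShuffleQuotient.counit_cons]
  · rcases v with _ | ⟨b, v⟩
    · rw [tens_nil, sh_one, tens_cons, ShuffleQuotient.counit_cons]
    · rw [tens_cons, tens_cons,
        cons_sh_cons (hasParity_val a) (hasParity_tens u) (hasParity_val b), map_add, map_smul,
        ShuffleQuotient.counit_cons, ShuffleQuotient.counit_cons, smul_zero, add_zero]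

/-- Shuffles of two nonempty words involve only words with at least two letters. The projection to
letters therefore kills all relations and recovers `a` from its class. -/
theorem quotient_pr_letter (a : G) (h : A.quotient.pr (cons a 1) = 0) : a = 0 := by
  have h1 : shuffleRel 𝒢 ≤ LinearMap.ker (letterPart : TensorAlgebra ℝ G →ₗ[ℝ] G) := by
    refine shuffleRel_le_ker letterPart_one fun a b u v => ?_
    rw [cons_sh_cons (hasParity_val a) (hasParity_tens u) (hasParity_val b), map_add, map_smul,
      letterPart_cons, letterPart_cons, ← tens_cons, ← tens_cons, counit_sh _ _ (by simp),
      counit_sh _ _ (by simp), zero_smul, zero_smul, smul_zero, add_zero]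
  have h2 := h1 ((Submodule.Quotient.mk_eq_zero _).1 h)
  rwa [LinearMap.mem_ker, letterPart_cons, ShuffleQuotient.counit_one, one_smul] at h2

/-! ### The identities on letters -/

theorem trilinear_eq_zero {M : Type*} [AddCommGroup M] [Module ℝ M]
    (F : G →ₗ[ℝ] G →ₗ[ℝ] G →ₗ[ℝ] M) {p q r : ZMod 2}
    (h : ∀ a b c : HomEl 𝒢, (a.deg : ZMod 2) = p → (b.deg : ZMod 2) = q →
      (c.deg : ZMod 2) = r → F a.val b.val c.val = 0)
    {a b c : G} (ha : HasParity p a) (hb : HasParity q b) (hc : HasParity r c) : F a b c = 0 := by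
  refine letter_induction (𝒢 := 𝒢) (C := fun a => F a b c = 0) ?_ ?_ ?_ ?_ ha
  · simp
  · intro x y hx hy; simp [hx, hy]
  · intro t x hx; simp [hx]
  · intro a ha
    refine letter_induction (𝒢 := 𝒢) (C := fun b => F a.val b c = 0) ?_ ?_ ?_ ?_ hb
    · simp
    · intro x y hx hy; simp [hx, hy]
    · intro t x hx; simp [hx]
    · intro b hb
      refine letter_induction (𝒢 := 𝒢) (C := fun c => F a.val b.val c = 0) ?_ ?_ ?_ ?_ hc
      · simp
      · intro x y hx hy; simp [hx, hy]
      · intro t x hx; simp [hx]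
      · intro c hc
        exact h a b c ha hb hc

/-- The shifted expression is a nonzero multiple of the associator, which serves both directions of
`associative_iff`. -/
theorem shiftedOps_assoc (a b c : HomEl 𝒢) :
    A.shiftedOps.mm (A.shiftedOps.mm a.val b.val) c.val
        + sg (a.deg : ZMod 2) • A.shiftedOps.mm a.val (A.shiftedOps.mm b.val c.val) =
      sg (b.deg : ZMod 2) • (A.mul a.val (A.mul b.val c.val) - A.mul (A.mul a.val b.val) c.val) := by
  rw [shiftedOps_mm, shiftedOps_mm, shiftedOps_mm, map_smul, map_smul, LinearMap.smul_apply,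
    ← mulEl_val, shiftedOps_mm, mulEl_deg]
  simp only [neg_one_zpow_eq_sg]
  push_cast
  generalize (a.deg : ZMod 2) = p, (b.deg : ZMod 2) = q
  match_scalars
  all_goals first
    | ring1
    | simp only [sg]; norm_cast; clear * - p q; revert p q; decide

theorem associative_iff : A.Associative ↔ ∀ {p q r : ZMod 2} {a b c : G}, HasParity p a →
    HasParity q b → HasParity r c →
    A.shiftedOps.mm (A.shiftedOps.mm a b) c + sg p • A.shiftedOps.mm a (A.shiftedOps.mm b c)
      = 0 := by
  constructor
  · intro h p q r a b c ha hb hc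
    refine trilinear_eq_zero (𝒢 := 𝒢) (LinearMap.mk₂ ℝ (fun a b => A.shiftedOps.mm
      (A.shiftedOps.mm a b) + sg p • (A.shiftedOps.mm a ∘ₗ A.shiftedOps.mm b))
      (fun _ _ _ => by ext; simp; module) (fun _ _ _ => by ext; simp; module)
      (fun _ _ _ => by ext; simp; module) (fun _ _ _ => by ext; simp; module)) ?_ ha hb hc
    intro a b c ha hb hc
    refine Eq.trans ?_ ((A.shiftedOps_assoc a b c).trans ?_)
    · rw [ha]; rfl
    · rw [h, sub_self, smul_zero]
  · intro h a b c
    have h1 := h (hasParity_val a) (hasParity_val b) (hasParity_val c)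
    rw [shiftedOps_assoc, smul_eq_zero_iff_right (sg_ne_zero _), sub_eq_zero] at h1
    exact h1

theorem jacobi_iff : A.Jacobi ↔ ∀ {p q r : ZMod 2} {a b c : G}, HasParity p a →
    HasParity q b → HasParity r c →
    sg (p * r) • A.shiftedOps.br (A.shiftedOps.br a b) c
      + sg (q * p) • A.shiftedOps.br (A.shiftedOps.br b c) a
      + sg (r * q) • A.shiftedOps.br (A.shiftedOps.br c a) b = 0 := by
  constructor
  · intro h p q r a b c ha hb hc
    refine trilinear_eq_zero (𝒢 := 𝒢) (LinearMap.mk₂ ℝ (fun a b => sg (p * r) • A.shiftedOps.br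
      (A.shiftedOps.br a b) + sg (q * p) • (A.shiftedOps.br.flip a ∘ₗ A.shiftedOps.br b)
        + sg (r * q) • (A.shiftedOps.br.flip b ∘ₗ A.shiftedOps.br.flip a))
      (fun _ _ _ => by ext; simp; module) (fun _ _ _ => by ext; simp; module)
      (fun _ _ _ => by ext; simp; module) (fun _ _ _ => by ext; simp; module)) ?_ ha hb hc
    intro a b c ha hb hc
    have h1 := h a b c
    simp only [neg_one_zpow_eq_sg, Int.cast_mul, ha, hb, hc] at h1
    exact h1
  · intro h a b c
    have h1 := h (hasParity_val a) (hasParity_val b) (hasParity_val c)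
    simp only [neg_one_zpow_eq_sg, Int.cast_mul]
    exact h1

/-- The shifted rule has the product in the first argument of the bracket, the axiom in the second.
Three applications of antisymmetry relate them up to an invertible sign, so both directions of
`leibniz_iff` follow. -/
theorem shiftedOps_leibniz (a b c : HomEl 𝒢) :
    A.shiftedOps.br (A.shiftedOps.mm a.val b.val) c.val
        - A.shiftedOps.mm a.val (A.shiftedOps.br b.val c.val)
        - sg ((b.deg : ZMod 2) * (c.deg : ZMod 2)) •
          A.shiftedOps.mm (A.shiftedOps.br a.val c.val) b.val =
      (-sg ((a.deg : ZMod 2) + ((a.deg : ZMod 2) + (b.deg : ZMod 2) + 1) * (c.deg : ZMod 2))) •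
        (A.bracket c.val (A.mul a.val b.val) - (A.mul (A.bracket c.val a.val) b.val
        + (-1 : ℝ) ^ (a.1 * c.deg) • A.mul a.val (A.bracket c.val b.val))) := by
  have h1 := A.bracket_antisymm (A.mulEl a b) c
  have h2 := A.bracket_antisymm a c
  have h3 := A.bracket_antisymm b c
  rw [mulEl_val, mulEl_deg] at h1
  rw [shiftedOps_mm, shiftedOps_mm, map_smul, LinearMap.smul_apply, shiftedOps_br, shiftedOps_br,
    shiftedOps_br, ← bracketEl_val A a c, shiftedOps_mm, bracketEl_val, bracketEl_deg, h1, h2, h3]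
  simp only [neg_one_zpow_eq_sg, map_neg, map_smul, LinearMap.neg_apply, LinearMap.smul_apply]
  push_cast
  rw [parity_deg]
  generalize (a.deg : ZMod 2) = p, (b.deg : ZMod 2) = q, (c.deg : ZMod 2) = r
  match_scalars
  all_goals first
    | ring1
    | simp only [sg]; norm_cast; clear * - p q r; revert p q r; decide

theorem leibniz_iff : A.Leibniz ↔ ∀ {p q r : ZMod 2} {a b c : G}, HasParity p a →
    HasParity q b → HasParity r c →
    A.shiftedOps.br (A.shiftedOps.mm a b) c = A.shiftedOps.mm a (A.shiftedOps.br b c)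
      + sg (q * r) • A.shiftedOps.mm (A.shiftedOps.br a c) b := by
  constructor
  · intro h p q r a b c ha hb hc
    rw [← sub_eq_zero, ← sub_sub]
    refine trilinear_eq_zero (𝒢 := 𝒢) (LinearMap.mk₂ ℝ (fun a b => A.shiftedOps.br
      (A.shiftedOps.mm a b) - A.shiftedOps.mm a ∘ₗ A.shiftedOps.br b
        - sg (q * r) • (A.shiftedOps.mm.flip b ∘ₗ A.shiftedOps.br a))
      (fun _ _ _ => by ext; simp; module) (fun _ _ _ => by ext; simp; module)
      (fun _ _ _ => by ext; simp; module) (fun _ _ _ => by ext; simp; module)) ?_ ha hb hc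
    intro a b c ha hb hc
    refine Eq.trans ?_ ((A.shiftedOps_leibniz a b c).trans ?_)
    · rw [hb, hc]; rfl
    · rw [h c a b, sub_self, smul_zero]
  · intro h c a b
    have h1 := h (hasParity_val a) (hasParity_val b) (hasParity_val c)
    rw [← sub_eq_zero, ← sub_sub, shiftedOps_leibniz,
      smul_eq_zero_iff_right (neg_ne_zero.2 (sg_ne_zero _)), sub_eq_zero] at h1
    exact h1

/-! ### Squares -/

theorem mulSPlus_toSPlus (x : Sym (Hsp 𝒢)) :
    A.mulSPlus (toSPlus 𝒢 x) = toSPlus 𝒢 (A.symData.mS x) := A.lifts_mulSPlus.apply x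

theorem bracketSPlus_toSPlus (x : Sym (Hsp 𝒢)) :
    A.bracketSPlus (toSPlus 𝒢 x) = toSPlus 𝒢 (A.symData.lS x) := A.lifts_bracketSPlus.apply x

/-- The linear part of `1` is `0`, so the linear part depends only on the image in `S⁺`. -/
theorem linearPart_eq_zero {x : Sym (Hsp 𝒢)} (h : toSPlus 𝒢 x = 0) : Sym.linearPart x = 0 := by
  rw [← descend_toSPlus Sym.linearPart Sym.linearPart_one, h, map_zero]

theorem mulSPlus_sq (h : A.Associative) : A.mulSPlus ∘ₗ A.mulSPlus = 0 := by
  refine LinearMap.ext fun x => ?_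
  obtain ⟨x, rfl⟩ := toSPlus_surjective x
  have h1 := LinearMap.congr_fun (A.symData.mS_mS (A.quotient.mH_mH (A.associative_iff.1 h))) x
  rw [LinearMap.comp_apply] at h1
  rw [LinearMap.comp_apply, mulSPlus_toSPlus, mulSPlus_toSPlus, h1, LinearMap.zero_apply,
    LinearMap.zero_apply, map_zero]

theorem bracketSPlus_sq (h : A.Jacobi) : A.bracketSPlus ∘ₗ A.bracketSPlus = 0 := by
  refine LinearMap.ext fun x => ?_
  obtain ⟨x, rfl⟩ := toSPlus_surjective x
  have h1 := LinearMap.congr_fun (A.symData.lS_lS (A.quotient.ell_ell (A.jacobi_iff.1 h))) x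
  rw [LinearMap.comp_apply] at h1
  rw [LinearMap.comp_apply, bracketSPlus_toSPlus, bracketSPlus_toSPlus, h1, LinearMap.zero_apply,
    LinearMap.zero_apply, map_zero]

theorem mulSPlus_bracketSPlus (h : A.Leibniz) :
    A.mulSPlus ∘ₗ A.bracketSPlus + A.bracketSPlus ∘ₗ A.mulSPlus = 0 := by
  refine LinearMap.ext fun x => ?_
  obtain ⟨x, rfl⟩ := toSPlus_surjective x
  have h1 := LinearMap.congr_fun (A.symData.mS_lS (A.quotient.mH_ell (A.leibniz_iff.1 h))) x
  rw [LinearMap.add_apply, LinearMap.comp_apply, LinearMap.comp_apply] at h1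
  rw [LinearMap.add_apply, LinearMap.comp_apply, LinearMap.comp_apply, bracketSPlus_toSPlus,
    mulSPlus_toSPlus, mulSPlus_toSPlus, bracketSPlus_toSPlus, ← map_add, h1, LinearMap.zero_apply,
    LinearMap.zero_apply, map_zero]

theorem associative_of_sq (h : A.mulSPlus ∘ₗ A.mulSPlus = 0) : A.Associative := by
  refine A.associative_iff.2 (A.quotient.mm_mm_of_mH A.quotient_pr_letter
    (A.symData.m0_m0_of_mS fun x => linearPart_eq_zero ?_))
  rw [← mulSPlus_toSPlus, ← mulSPlus_toSPlus]
  exact LinearMap.congr_fun h _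

theorem jacobi_of_sq (h : A.bracketSPlus ∘ₗ A.bracketSPlus = 0) : A.Jacobi := by
  refine A.jacobi_iff.2 (A.quotient.br_br_of_ell_ell A.quotient_pr_letter ?_)
  intro p q r X Y Z hX hY hZ
  refine (A.symData.linearPart_lS_lS_three hX hY hZ).symm.trans (linearPart_eq_zero ?_)
  rw [← bracketSPlus_toSPlus, ← bracketSPlus_toSPlus]
  exact LinearMap.congr_fun h _

theorem leibniz_of_anticommute
    (h : A.mulSPlus ∘ₗ A.bracketSPlus + A.bracketSPlus ∘ₗ A.mulSPlus = 0) : A.Leibniz := by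
  refine A.leibniz_iff.2 (A.quotient.br_mm_of_mH_ell A.quotient_pr_letter ?_)
  intro p q X Y hX hY
  refine (A.symData.linearPart_mS_lS_two hX hY).symm.trans ?_
  rw [← map_add]
  refine linearPart_eq_zero ?_
  rw [map_add, ← mulSPlus_toSPlus, ← bracketSPlus_toSPlus, ← bracketSPlus_toSPlus,
    ← mulSPlus_toSPlus]
  exact LinearMap.congr_fun h _

theorem isGerstenhaber_of_sq
    (h : (A.mulSPlus + A.bracketSPlus) ∘ₗ (A.mulSPlus + A.bracketSPlus) = 0) :
    A.IsGerstenhaber := by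
  have h1 : ∀ x, Sym.linearPart ((A.symData.mS + A.symData.lS)
      ((A.symData.mS + A.symData.lS) x)) = 0 := by
    intro x
    refine linearPart_eq_zero ?_
    have h2 : ∀ x, toSPlus 𝒢 ((A.symData.mS + A.symData.lS) x) =
        (A.mulSPlus + A.bracketSPlus) (toSPlus 𝒢 x) := by
      intro x
      rw [LinearMap.add_apply, LinearMap.add_apply, map_add, mulSPlus_toSPlus,
        bracketSPlus_toSPlus]
    rw [h2, h2]
    exact LinearMap.congr_fun h _
  refine ⟨?_, ?_, ?_⟩
  · refine A.associative_iff.2 (A.quotient.mm_mm_of_mH A.quotient_pr_letter fun X => ?_)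
    refine LinearMap.congr_fun (f := A.symData.m0 ∘ₗ A.symData.m0) (g := 0)
      (linearMap_ext_parity ?_) X
    intro p X hX
    -- Only the identity on one letter is wanted; the other two arguments are fillers.
    exact (A.symData.linearPart_sq hX hX hX h1).1
  · refine A.jacobi_iff.2 (A.quotient.br_br_of_ell_ell A.quotient_pr_letter ?_)
    intro p q r X Y Z hX hY hZ
    exact (A.symData.linearPart_sq hX hY hZ h1).2.2
  · refine A.leibniz_iff.2 (A.quotient.br_mm_of_mH_ell A.quotient_pr_letter ?_)
    intro p q X Y hX hY
    exact (A.symData.linearPart_sq hX hY hY h1).2.1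

end GradedProductBracket

end GInfinity

end

theorem mainTheorem5 {G : Type*} [AddCommGroup G] [Module ℝ G] (𝒢 : ℤ → Submodule ℝ G)
    [DirectSum.Decomposition 𝒢] (A : GradedProductBracket 𝒢) :
    (∃! Δ : SPlus 𝒢 →ₗ[ℝ] SPlus 𝒢 ⊗[ℝ] SPlus 𝒢, IsCoproduct Δ) ∧
    (∃! κ : SPlus 𝒢 →ₗ[ℝ] SPlus 𝒢 ⊗[ℝ] SPlus 𝒢, IsCobracket κ) ∧
    (∃! m₀ : Hsp 𝒢 →ₗ[ℝ] Hsp 𝒢, A.IsProductOnH m₀) ∧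
    (∃! b : Hsp 𝒢 →ₗ[ℝ] Hsp 𝒢 →ₗ[ℝ] Hsp 𝒢, A.IsBracketOnH b) ∧
    (∃! m : SPlus 𝒢 →ₗ[ℝ] SPlus 𝒢, A.IsProductExtension m) ∧
    (∃! l : SPlus 𝒢 →ₗ[ℝ] SPlus 𝒢, A.IsBracketExtension l) ∧
    ∀ (Δ κ : SPlus 𝒢 →ₗ[ℝ] SPlus 𝒢 ⊗[ℝ] SPlus 𝒢) (m l : SPlus 𝒢 →ₗ[ℝ] SPlus 𝒢),
      IsCoproduct Δ → IsCobracket κ → A.IsProductExtension m → A.IsBracketExtension l →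
      (IsDegreeOne m ∧ IsCoderivationOfCobracket κ m ∧ IsCoderivationOfCoproduct Δ m) ∧
      (IsDegreeOne l ∧ IsCoderivationOfCobracket κ l ∧ IsCoderivationOfCoproduct Δ l) ∧
      (A.IsGerstenhaber ↔ (m + l) ∘ₗ (m + l) = 0) ∧
      ((m + l) ∘ₗ (m + l) = 0 ↔ m ∘ₗ m = 0 ∧ l ∘ₗ l = 0 ∧ m ∘ₗ l + l ∘ₗ m = 0) ∧
      (A.Associative ↔ m ∘ₗ m = 0) ∧
      (A.Jacobi ↔ l ∘ₗ l = 0) ∧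
      (A.Leibniz ↔ m ∘ₗ l + l ∘ₗ m = 0) := by
  -- The sign operator of `G` depends on the grading `𝒢`, so it is fixed here, and `GradedSuper`
  -- holds by definition of it.
  let _ : SuperModule G := ⟨parityG 𝒢, parityG_parityG⟩
  have _ : GradedSuper 𝒢 := ⟨rfl⟩
  refine ⟨⟨_, isCoproduct_coproductSPlus, fun _ h => h.unique isCoproduct_coproductSPlus⟩,
    ⟨_, A.isCobracket_cobracketSPlus, fun _ h => h.unique A.isCobracket_cobracketSPlus⟩,
    ⟨_, A.isProductOnH_mH, fun _ h => h.unique A.isProductOnH_mH⟩,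
    ⟨_, A.isBracketOnH_bH, fun _ h => h.unique A.isBracketOnH_bH⟩,
    ⟨_, A.isProductExtension_mulSPlus, fun _ h => h.unique A.isProductExtension_mulSPlus⟩,
    ⟨_, A.isBracketExtension_bracketSPlus, fun _ h => h.unique A.isBracketExtension_bracketSPlus⟩,
    ?_⟩
  intro Δ κ m l hΔ hκ hm hl
  have hm1 := hm.isDegreeOne
  have hl1 := hl.isDegreeOne
  obtain rfl := hΔ.unique isCoproduct_coproductSPlus
  obtain rfl := hκ.unique A.isCobracket_cobracketSPlus
  obtain rfl := hm.unique A.isProductExtension_mulSPlus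
  obtain rfl := hl.unique A.isBracketExtension_bracketSPlus
  have hsq : A.IsGerstenhaber ↔
      (A.mulSPlus + A.bracketSPlus) ∘ₗ (A.mulSPlus + A.bracketSPlus) = 0 := by
    refine ⟨fun h => ?_, A.isGerstenhaber_of_sq⟩
    have h1 := A.mulSPlus_sq h.1
    have h2 := A.bracketSPlus_sq h.2.1
    have h3 := A.mulSPlus_bracketSPlus h.2.2
    rw [LinearMap.add_comp, LinearMap.comp_add, LinearMap.comp_add, h1, h2, zero_add, add_zero, h3]
  have hA : A.Associative ↔ A.mulSPlus ∘ₗ A.mulSPlus = 0 := ⟨A.mulSPlus_sq, A.associative_of_sq⟩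
  have hJ : A.Jacobi ↔ A.bracketSPlus ∘ₗ A.bracketSPlus = 0 := ⟨A.bracketSPlus_sq, A.jacobi_of_sq⟩
  have hL : A.Leibniz ↔ A.mulSPlus ∘ₗ A.bracketSPlus + A.bracketSPlus ∘ₗ A.mulSPlus = 0 :=
    ⟨A.mulSPlus_bracketSPlus, A.leibniz_of_anticommute⟩
  exact ⟨⟨hm1, A.mulSPlus_cobracket, A.mulSPlus_coproduct⟩,
    ⟨hl1, A.bracketSPlus_cobracket, A.bracketSPlus_coproduct⟩, hsq,
    -- The square splits into three equations by way of the algebra: its vanishing is equivalent to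
    -- the three axioms together, and each axiom to its own equation.
    hsq.symm.trans (and_congr hA (and_congr hJ hL)), hA, hJ, hL⟩
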